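/- Let $K$ be an algebraically closed field, and let $\Gamma$ be the quiver with four vertices $e_i$ ($i\in\mathbb Z/4$) and eight arrows $a_{l,m}\colon e_m\to e_{m+1}$ ($l\in\mathbb Z/2$, $m\in\mathbb Z/4$), with paths written from left to right. In the path algebra $K\Gamma$ put $x_l=\sum_{m=0}^{3}a_{l,m}$ for $l\in\mathbb Z/2$. For an integer $T\ge 0$ and $q_0,q_1,q_2,q_3\in K^\times$ let $$A=A_T(q_0,q_1,q_2,q_3)=K\Gamma\big/\big\langle x_lx_{l+1},\ e_i\big(q_ix_i^{4T+2}+x_{i+1}^{4T+2}\big)\ \big|\ l=0,1;\ 0\le i\le 3\big\rangle ,$$ where the index of $x$ is read modulo $2$, and let $\mathrm{HH}^n(A)=\mathrm{Ext}^n_{A\otimes_K A^{\mathrm{op}}}(A,A)$ be the Hochschild cohomology groups. Suppose that $q_0q_1q_2q_3$ is not a root of unity. Then the following hold. (a) For all $m\ge 0$ and $0\le r\le 3$, $$\dim_K \mathrm{HH}^{4m+r}(A)=\begin{cases} 2T+1 & \text{if } m=r=0,\\ 2T+3 & \text{if } m=0,\ r=1 \text{ and } \operatorname{char}K\mid 2T+1,\\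 2T+2 & \text{if } m=0,\ r=1 \text{ and } \operatorname{char}K\nmid 2T+1,\\ 2T+2 & \text{if } m=0,\ r=2 \text{ and } \operatorname{char}K\mid 2T+1,\\ 2T+1 & \text{if } m=0,\ r=2 \text{ and } \operatorname{char}K\nmid 2T+1,\\ 2T & \text{if } m\ge 0,\ r=3, \text{ or if } m\ge 1,\ r=0,\\ 2T+2 & \text{if } m\ge 1,\ r\in\{1,2\} \text{ and } \operatorname{char}K\mid 2T+1,\\ 2T & \text{if } m\ge 1,\ r\in\{1,2\} \text{ and } \operatorname{char}K\nmid 2T+1. \end{cases}$$ (b) $\mathrm{HH}^n(A)=0$ for all $n\ge 3$ if and only if $T=0$. Moreover, if $T=0$, then $A$ is a finite-dimensional $K$-algebra of infinite global dimension; so $A_0(q_0,q_1,q_2,q_3)$ gives a negative answer to Happel's question whether a finite-dimensional algebra whose Hochschild cohomology vanishes in all large degrees has finite global dimension. -/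

import Mathlib

open CategoryTheory
open scoped TensorProduct

universe u v w

noncomputable section

/-! ### The path algebra of a quiver with finitely many vertices -/

/-- All paths of a quiver (including the trivial path at each vertex), with their endpoints. -/
structure QuiverPath (V : Type v) [Quiver.{w} V] where
  /-- origin of the path -/
  src : V
  /-- terminus of the path -/
  tgt : V
  /-- the path itself -/
  path : Quiver.Path src tgt

/-- The path algebra `KV`: the vector space with basis the set of all paths. -/
def PathAlgebra (K : Type u) [Field K] (V : Type v) [Quiver.{w} V] : Type _ :=
  QuiverPath V →₀ K

namespace PathAlgebra

variable (K : Type u) [Field K] {V : Type v} [Quiver.{w} V]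

instance : AddCommGroup (PathAlgebra K V) :=
  inferInstanceAs (AddCommGroup (QuiverPath V →₀ K))

instance : Module K (PathAlgebra K V) :=
  inferInstanceAs (Module K (QuiverPath V →₀ K))

/-- The basis of the path algebra given by the paths. -/
def basis : Module.Basis (QuiverPath V) K (PathAlgebra K V) :=
  ⟨LinearEquiv.refl K (QuiverPath V →₀ K)⟩

/-- A path, regarded as an element of the path algebra. -/
def of (p : QuiverPath V) : PathAlgebra K V :=
  basis K p

open Classical in
/-- The product of two paths, read from left to right: the concatenation `p q` if `p` ends where
`q` starts, and `0` otherwise. -/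
def mulPath (p q : QuiverPath V) : PathAlgebra K V :=
  if h : p.tgt = q.src then of K ⟨p.src, q.tgt, p.path.comp (q.path.cast h.symm rfl)⟩ else 0

/-- The bilinear extension of the product of paths. -/
def mulBilin : PathAlgebra K V →ₗ[K] PathAlgebra K V →ₗ[K] PathAlgebra K V :=
  (basis K).constr K fun p => (basis K).constr K fun q => mulPath K p q

instance : Mul (PathAlgebra K V) := ⟨fun f g => mulBilin K f g⟩

/-- The identity is the sum of the trivial paths. -/
instance [Fintype V] : One (PathAlgebra K V) :=
  ⟨∑ v : V, of K ⟨v, v, Quiver.Path.nil⟩⟩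

variable {K}

theorem mul_def (f g : PathAlgebra K V) : f * g = mulBilin K f g := rfl

theorem of_mul_of (p q : QuiverPath V) : of K p * of K q = mulPath K p q := by
  rw [mul_def, mulBilin, of, of, Module.Basis.constr_basis, Module.Basis.constr_basis]

theorem hom_ext {M : Type*} [AddCommGroup M] [Module K M] {f g : PathAlgebra K V →ₗ[K] M}
    (h : ∀ p, f (of K p) = g (of K p)) : f = g :=
  (basis K).ext h

theorem mulPath_of_eq (p q : QuiverPath V) (h : p.tgt = q.src) :
    mulPath K p q = of K ⟨p.src, q.tgt, p.path.comp (q.path.cast h.symm rfl)⟩ :=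
  dif_pos h

theorem mulPath_of_ne (p q : QuiverPath V) (h : p.tgt ≠ q.src) : mulPath K p q = 0 :=
  dif_neg h

theorem zero_mul_aux (f : PathAlgebra K V) : 0 * f = 0 := by simp [mul_def]

theorem mul_zero_aux (f : PathAlgebra K V) : f * 0 = 0 := by simp [mul_def]

theorem of_mul_assoc (p q r : QuiverPath V) :
    of K p * of K q * of K r = of K p * (of K q * of K r) := by
  rw [of_mul_of, of_mul_of]
  by_cases h₁ : p.tgt = q.src
  · by_cases h₂ : q.tgt = r.src
    · obtain ⟨a, b, p⟩ := p
      obtain ⟨b', c, q⟩ := q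
      obtain ⟨c', d, r⟩ := r
      obtain rfl : b = b' := h₁
      obtain rfl : c = c' := h₂
      rw [mulPath_of_eq _ _ rfl, mulPath_of_eq _ _ rfl, of_mul_of, of_mul_of,
        mulPath_of_eq _ _ rfl, mulPath_of_eq _ _ rfl]
      simp
    · rw [mulPath_of_eq _ _ h₁, mulPath_of_ne q r h₂, of_mul_of, mul_zero_aux]
      exact mulPath_of_ne _ _ h₂
  · rw [mulPath_of_ne _ _ h₁, zero_mul_aux]
    by_cases h₂ : q.tgt = r.src
    · rw [mulPath_of_eq _ _ h₂, of_mul_of]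
      symm
      exact mulPath_of_ne _ _ h₁
    · rw [mulPath_of_ne q r h₂, mul_zero_aux]

theorem mul_assoc_aux (f g h : PathAlgebra K V) : f * g * h = f * (g * h) := by
  have key : (LinearMap.compr₂ (mulBilin K (V := V)) (mulBilin K)) =
      ((LinearMap.llcomp K (PathAlgebra K V) (PathAlgebra K V) (PathAlgebra K V)).flip.comp
        (mulBilin K)).flip.compr₂ LinearMap.id ∘ₗ (mulBilin K (V := V)) := by
    refine hom_ext fun p => hom_ext fun q => hom_ext fun r => ?_
    exact of_mul_assoc p q r
  exact congrArg (fun F => F f g h) key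

theorem one_mul_aux [Fintype V] (f : PathAlgebra K V) : 1 * f = f := by
  have key : mulBilin K (V := V) 1 = LinearMap.id := by
    refine hom_ext fun p => ?_
    change (1 : PathAlgebra K V) * of K p = of K p
    have h1 : (1 : PathAlgebra K V) = ∑ v : V, of K ⟨v, v, Quiver.Path.nil⟩ := rfl
    rw [h1, mul_def, map_sum, LinearMap.sum_apply, Finset.sum_eq_single p.src]
    · rw [← mul_def, of_mul_of, mulPath_of_eq _ _ rfl]
      simp
    · intro v _ hv
      rw [← mul_def, of_mul_of]
      exact mulPath_of_ne _ _ hv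
    · simp
  exact congrArg (fun F => F f) key

theorem mul_one_aux [Fintype V] (f : PathAlgebra K V) : f * 1 = f := by
  have key : (mulBilin K (V := V)).flip 1 = LinearMap.id := by
    refine hom_ext fun p => ?_
    change of K p * (1 : PathAlgebra K V) = of K p
    have h1 : (1 : PathAlgebra K V) = ∑ v : V, of K ⟨v, v, Quiver.Path.nil⟩ := rfl
    rw [h1, mul_def, map_sum, Finset.sum_eq_single p.tgt]
    · rw [← mul_def, of_mul_of, mulPath_of_eq _ _ rfl]
      simp
    · intro v _ hv
      rw [← mul_def, of_mul_of]
      exact mulPath_of_ne _ _ (Ne.symm hv)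
    · simp
  exact congrArg (fun F => F f) key

instance [Fintype V] : Ring (PathAlgebra K V) :=
  { (inferInstance : AddCommGroup (PathAlgebra K V)),
    (inferInstance : Mul (PathAlgebra K V)),
    (inferInstance : One (PathAlgebra K V)) with
    left_distrib := fun f g h => map_add (mulBilin K f) g h
    right_distrib := fun f g h => by simp [mul_def]
    zero_mul := zero_mul_aux
    mul_zero := mul_zero_aux
    mul_assoc := mul_assoc_aux
    one_mul := one_mul_aux
    mul_one := mul_one_aux }

instance [Fintype V] : Algebra K (PathAlgebra K V) :=
  Algebra.ofModule (fun c f g => by simp [mul_def]) (fun c f g => by simp [mul_def])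

end PathAlgebra

/-! ### Hochschild cohomology and global dimension -/

/-- The Hochschild cohomology group `HHⁿ(A) = Extⁿ(A, A)`, where `A` is viewed as a module over
its enveloping algebra, `(a ⊗ bᵒᵖ) • x = a x b`. It is a `K`-vector space. -/
abbrev HochschildCohomology (K : Type u) [Field K] (A : Type u) [Ring A] [Algebra K A] (n : ℕ) :
    Type u :=
  letI : Module (A ⊗[K] Aᵐᵒᵖ) A := instModuleTensorProductMop K A
  Abelian.Ext.{u} (ModuleCat.of (A ⊗[K] Aᵐᵒᵖ) A) (ModuleCat.of (A ⊗[K] Aᵐᵒᵖ) A) n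

/-- The (left) global dimension of a ring: the supremum of the projective dimensions of all its
modules. -/
def globalDimension (A : Type u) [Ring A] : WithBot ℕ∞ :=
  ⨆ M : ModuleCat.{u} A, projectiveDimension M

/-! ### The algebra `A_T(q₀, q₁, q₂, q₃)` -/

/-- The vertices `e₀, e₁, e₂, e₃` of the quiver `Γ`, indexed modulo `4`. -/
def GammaVertex : Type := ZMod 4

namespace GammaVertex

instance : CommRing GammaVertex := inferInstanceAs (CommRing (ZMod 4))

instance : Fintype GammaVertex := inferInstanceAs (Fintype (ZMod 4))

instance : DecidableEq GammaVertex := inferInstanceAs (DecidableEq (ZMod 4))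

/-- Reduction of the index of a vertex modulo `2`. -/
def toZModTwo : GammaVertex →+* ZMod 2 := ZMod.castHom (show 2 ∣ 4 by norm_num) (ZMod 2)

end GammaVertex

/-- The arrows of `Γ`: for `l` modulo `2` and `m` modulo `4`, an arrow `a l m` from the vertex `m`
to the vertex `m + 1`. -/
inductive GammaArrow : GammaVertex → GammaVertex → Type
  | a (l : ZMod 2) (m : GammaVertex) : GammaArrow m (m + 1)

instance : Quiver GammaVertex := ⟨GammaArrow⟩

/-- The arrow `a l m` as a path of `Γ`. -/
def gammaArrowPath (l : ZMod 2) (m : GammaVertex) : QuiverPath GammaVertex :=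
  ⟨m, m + 1, Quiver.Hom.toPath (GammaArrow.a l m)⟩

section

variable (K : Type u) [Field K]

/-- The idempotent `e_i` of `KΓ`. -/
def gammaE (i : GammaVertex) : PathAlgebra K GammaVertex :=
  PathAlgebra.of K ⟨i, i, Quiver.Path.nil⟩

/-- The element `x_l = ∑ₘ a_{l,m}` of `KΓ`. -/
def gammaX (l : ZMod 2) : PathAlgebra K GammaVertex :=
  ∑ m : GammaVertex, PathAlgebra.of K (gammaArrowPath l m)

variable {K}

/-- The two-sided ideal of `KΓ` generated by `x_l x_{l+1}` for `l` modulo `2` and by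
`e_i (q_i x_i^{4T+2} + x_{i+1}^{4T+2})` for `i` modulo `4`. -/
def gammaIdeal (T : ℕ) (q : GammaVertex → Kˣ) : TwoSidedIdeal (PathAlgebra K GammaVertex) :=
  TwoSidedIdeal.span
    ((Set.range fun l : ZMod 2 => gammaX K l * gammaX K (l + 1)) ∪
      Set.range fun i : GammaVertex =>
        gammaE K i * ((q i : K) • gammaX K i.toZModTwo ^ (4 * T + 2) +
          gammaX K (i.toZModTwo + 1) ^ (4 * T + 2)))

/-- The algebra `A_T(q₀, q₁, q₂, q₃) = KΓ / I_T(q₀, q₁, q₂, q₃)`. -/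
abbrev AlgA (T : ℕ) (q : GammaVertex → Kˣ) : Type u :=
  (gammaIdeal T q).ringCon.Quotient

end

end

/-! Along a path of `Γ` that uses arrows of one index only, that index agrees with the parity of the
current vertex at every second step. Renaming arrows by this agreement turns `A` into the four-fold
cyclic cover of the local algebra `K⟨x, y⟩ / (x², y², s(xy)^(2T+1) + (yx)^(2T+1))`: paths of
constant index become alternating words in `x` and `y`. Rescaling the arrows makes the four
relations uniform, and of the parameters only the product survives, as `s⁴ = q₀q₁q₂q₃`
(`exists_scaling`, `exists_cover`). A normal form for paths shows that the alternating words, one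
copy at each vertex, form a basis.

Such a cover has a projective bimodule resolution with generators in the bidegrees `(i, j)` with `i
+ j = n`. Lowering the strictly larger exponent multiplies by its letter from both sides (`lin`),
lowering the strictly smaller one multiplies by a word of length `4T + 1` (`hvy`), and at equal
exponents a twisted noncommutative derivative of the long relation appears (`fox`). Signs and powers
of `s` are chosen so that all squares vanish or anticommute. Exactness is proved first for the part
that multiplies from the left only, which has an explicit contraction by removing last letters
(`diffL_htpy_add`), and is then carried over to the full differential along the finite filtration by
word length in the right factor (`exists_diff_eq`).

Every component of the differential has path length `1` modulo `4`. Hence a cochain of degree `n` is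
a family of `n + 1` elements of `A` supported on paths of length `n` modulo `4`, and cocycles are
counted by linear algebra. The cocycle conditions split into two strands, one for each letter, which
meet only on the diagonal (`mem_cocycle_iff`). Words of intermediate length give a contribution
linear in `T`. The exceptional lengths `0`, `1`, `4T + 1` and `4T + 2` lead to equations `shift ε =
c ε` for functions on the four vertices, with `c` up to sign a power of `s`. Such an equation has
only the zero solution if `c⁴ ≠ 1` (`eq_zero_of_shift_eq_smul`), and this is what the hypothesis on
the product of the `qᵢ` provides.

In degrees `n = 2m + 1` congruent to `1` modulo `4` one diagonal condition remains. It is the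
composite of the operators `shift - s^m` and `shift - s^(-m)` of the two strands with `theta`, which
is multiplication by `2T + 1` on functions of period two and the identity on antiperiodic ones. This
is the origin of the case distinction on the characteristic. The operators `shift - s^(±m)` are
singular only for `m = 0`, which is why degrees `1` and `2` differ from the later ones. The
dimensions follow by comparing cochains and cocycles in consecutive degrees.

For (b), the third cohomology group has dimension `2T`, and for `T = 0` all dimensions from degree
`3` on vanish because no characteristic divides `1`. In that case `x² = 0` and the left annihilator
of `x` is `A x`, so `A x` is its own syzygy; as it is not projective, the global dimension is
infinite. -/

noncomputable section

/-! ### `Ext` from a projective resolution -/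

namespace ExtDim

section Abelian

variable (K : Type w) [Field K] {C : Type u} [Category.{v} C] [Abelian C] [Linear K C]
  [HasExt.{v} C]

open Abelian Abelian.Ext

/-- Dimension shifting along a short exact sequence with projective middle term. -/
def extShiftEquiv {S : ShortComplex C} (hS : S.ShortExact) [Projective S.X₂] (Y : C) (n : ℕ) :
    Ext.{v} S.X₁ Y (n + 1) ≃ₗ[K] Ext.{v} S.X₃ Y (n + 2) :=
  LinearEquiv.ofBijective
    (precompOfLinear hS.extClass K Y (show 1 + (n + 1) = n + 2 by omega)) (by
    constructor
    · rw [injective_iff_map_eq_zero]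
      intro a ha
      obtain ⟨b, rfl⟩ := contravariant_sequence_exact₁ hS Y a (by omega) ha
      rw [eq_zero_of_projective b, comp_zero]
    · intro a
      exact contravariant_sequence_exact₃ hS Y a (eq_zero_of_projective _) (by omega))

/-- The connecting map `Hom(X₁, Y) → Ext¹(X₃, Y)`. -/
def connecting {S : ShortComplex C} (hS : S.ShortExact) (Y : C) :
    (S.X₁ ⟶ Y) →ₗ[K] Ext.{v} S.X₃ Y 1 :=
  (precompOfLinear hS.extClass K Y (show 1 + 0 = 1 by omega)).comp
    (linearEquiv₀ (R := K)).symm.toLinearMap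

theorem connecting_surjective {S : ShortComplex C} (hS : S.ShortExact) [Projective S.X₂] (Y : C) :
    Function.Surjective (connecting K hS Y) := by
  intro a
  obtain ⟨b, hb⟩ := contravariant_sequence_exact₃ hS Y a (eq_zero_of_projective _)
    (show 1 + 0 = 1 by omega)
  exact ⟨linearEquiv₀ (R := K) b, by simpa [connecting] using hb⟩

theorem ker_connecting {S : ShortComplex C} (hS : S.ShortExact) (Y : C) :
    LinearMap.ker (connecting K hS Y) = LinearMap.range (Linear.leftComp K Y S.f) := by
  ext a
  constructor
  · intro ha
    obtain ⟨b, hb⟩ := contravariant_sequence_exact₁ hS Y (mk₀ a) (show 1 + 0 = 1 by omega)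
      (by simpa [connecting] using ha)
    refine ⟨linearEquiv₀ (R := K) b, ?_⟩
    apply (linearEquiv₀ (R := K)).symm.injective
    simpa [← mk₀_comp_mk₀] using hb
  · rintro ⟨b, rfl⟩
    simp only [connecting, LinearMap.mem_ker, LinearMap.comp_apply, LinearEquiv.coe_coe,
      linearEquiv₀_symm_apply, Linear.leftComp_apply]
    change hS.extClass.comp (mk₀ (S.f ≫ b)) (add_zero 1) = 0
    rw [← mk₀_comp_mk₀]
    exact ShortComplex.ShortExact.extClass_comp_assoc hS _

theorem finite_ext_one {S : ShortComplex C} (hS : S.ShortExact) [Projective S.X₂] (Y : C)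
    [Module.Finite K (S.X₁ ⟶ Y)] : Module.Finite K (Ext.{v} S.X₃ Y 1) :=
  Module.Finite.of_surjective _ (connecting_surjective K hS Y)

/-- Two applications of rank–nullity to the exact sequence `0 → Hom(X₃, Y) → Hom(X₂, Y) → Hom(X₁, Y)
→ Ext¹(X₃, Y) → 0`, which ends there because `X₂` is projective. The additive form avoids truncated
subtraction. -/
theorem finrank_ext_one_add {S : ShortComplex C} (hS : S.ShortExact) [Projective S.X₂] (Y : C)
    [Module.Finite K (S.X₁ ⟶ Y)] [Module.Finite K (S.X₂ ⟶ Y)] :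
    Module.finrank K (Ext.{v} S.X₃ Y 1) + Module.finrank K (S.X₂ ⟶ Y) =
      Module.finrank K (S.X₁ ⟶ Y) + Module.finrank K (S.X₃ ⟶ Y) := by
  have h1 := (connecting K hS Y).finrank_range_add_finrank_ker
  rw [LinearMap.range_eq_top.2 (connecting_surjective K hS Y), finrank_top,
    ker_connecting] at h1
  have h2 := (Linear.leftComp K Y S.f).finrank_range_add_finrank_ker
  have := hS.epi_g
  have e : (S.X₃ ⟶ Y) ≃ₗ[K] LinearMap.ker (Linear.leftComp K Y S.f) :=
    LinearEquiv.ofBijective ((Linear.leftComp K Y S.g).codRestrict _ fun a => by simp) (by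
      constructor
      · intro a b hab
        have := congrArg Subtype.val hab
        simpa [cancel_epi] using this
      · rintro ⟨b, hb⟩
        have hb' : S.f ≫ b = 0 := by simpa using hb
        exact ⟨hS.exact.desc b hb', Subtype.ext (hS.exact.g_desc b hb')⟩)
  rw [e.finrank_eq]
  omega

theorem rank_ext_one_add {S : ShortComplex C} (hS : S.ShortExact) [Projective S.X₂] (Y : C)
    {V₁ V₂ V₃ : Type v} [AddCommGroup V₁] [Module K V₁] [AddCommGroup V₂] [Module K V₂]
    [AddCommGroup V₃] [Module K V₃] (e₁ : (S.X₁ ⟶ Y) ≃ₗ[K] V₁) (e₂ : (S.X₂ ⟶ Y) ≃ₗ[K] V₂)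
    (e₃ : (S.X₃ ⟶ Y) ≃ₗ[K] V₃) [Module.Finite K V₁] [Module.Finite K V₂] :
    ∃ h : ℕ, Module.rank K (Ext.{v} S.X₃ Y 1) = h ∧
      h + Module.finrank K V₂ = Module.finrank K V₁ + Module.finrank K V₃ := by
  have := Module.Finite.equiv e₁.symm
  have := Module.Finite.equiv e₂.symm
  have := finite_ext_one K hS Y
  refine ⟨_, (Module.finrank_eq_rank _ _).symm, ?_⟩
  rw [← e₁.finrank_eq, ← e₂.finrank_eq, ← e₃.finrank_eq]
  exact finrank_ext_one_add K hS Y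

end Abelian

section Modules

variable (K : Type u) [Field K] {R : Type u} [Ring R] [Algebra K R]

/-- Linear maps vanishing on the image of `f`. -/
def homKer {P Q : Type u} [AddCommGroup P] [Module R P] [AddCommGroup Q] [Module R Q]
    (f : Q →ₗ[R] P) (Y : Type u) [AddCommGroup Y] [Module R Y] [Module K Y] [IsScalarTower K R Y] :
    Submodule K (P →ₗ[R] Y) where
  carrier := {φ | φ ∘ₗ f = 0}
  add_mem' {a b} ha hb := by
    simp only [Set.mem_ofPred_eq] at ha hb ⊢
    rw [LinearMap.add_comp, ha, hb, add_zero]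
  zero_mem' := LinearMap.zero_comp _
  smul_mem' c a ha := by
    simp only [Set.mem_ofPred_eq] at ha ⊢
    rw [LinearMap.smul_comp, ha, smul_zero]

theorem mem_homKer {P Q : Type u} [AddCommGroup P] [Module R P] [AddCommGroup Q] [Module R Q]
    {f : Q →ₗ[R] P} {Y : Type u} [AddCommGroup Y] [Module R Y] [Module K Y] [IsScalarTower K R Y]
    {φ : P →ₗ[R] Y} : φ ∈ homKer K f Y ↔ ∀ z, φ (f z) = 0 :=
  ⟨fun h z => LinearMap.congr_fun h z, fun h => LinearMap.ext h⟩

/-- Morphisms in `ModuleCat` are linear maps, as vector spaces over the ground field. -/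
def homEquiv (M Y : Type u) [AddCommGroup M] [Module R M] [AddCommGroup Y] [Module R Y]
    [Module K Y] [IsScalarTower K R Y] :
    letI : Module K (ModuleCat.of R M ⟶ ModuleCat.of R Y) := Linear.homModule _ _
    (ModuleCat.of R M ⟶ ModuleCat.of R Y) ≃ₗ[K] (M →ₗ[R] Y) :=
  letI : Module K (ModuleCat.of R M ⟶ ModuleCat.of R Y) := Linear.homModule _ _
  { toFun := fun f => f.hom
    invFun := fun f => ModuleCat.ofHom f
    map_add' := fun _ _ => rfl
    map_smul' := fun c f => LinearMap.ext fun m => algebraMap_smul R c (f.hom m)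
    left_inv := fun _ => rfl
    right_inv := fun _ => rfl }

/-- Linear maps out of a quotient of `P`. -/
def homKerEquiv {P Q Z : Type u} [AddCommGroup P] [Module R P] [AddCommGroup Q] [Module R Q]
    [AddCommGroup Z] [Module R Z] (f : Q →ₗ[R] P) (g : P →ₗ[R] Z) (hfg : Function.Exact f g)
    (hg : Function.Surjective g)
    (Y : Type u) [AddCommGroup Y] [Module R Y] [Module K Y] [IsScalarTower K R Y] :
    (Z →ₗ[R] Y) ≃ₗ[K] homKer K f Y :=
  LinearEquiv.ofBijective
    ({ toFun := fun a => ⟨a ∘ₗ g, LinearMap.ext fun z => by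
          simp [hfg.apply_apply_eq_zero z]⟩
       map_add' := fun _ _ => rfl
       map_smul' := fun _ _ => rfl } : (Z →ₗ[R] Y) →ₗ[K] homKer K f Y) (by
    constructor
    · intro a b hab
      exact (LinearMap.cancel_right hg).1 (congrArg Subtype.val hab)
    · rintro ⟨φ, hφ⟩
      have hker : LinearMap.ker g ≤ LinearMap.ker φ := by
        intro z hz
        obtain ⟨t, rfl⟩ := (hfg z).1 hz
        exact (mem_homKer K).1 hφ t
      refine ⟨((LinearMap.ker g).liftQ φ hker).comp
        (g.quotKerEquivOfSurjective hg).symm.toLinearMap, Subtype.ext (LinearMap.ext fun z => ?_)⟩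
      have : (g.quotKerEquivOfSurjective hg).symm (g z) = (LinearMap.ker g).mkQ z := by
        rw [LinearEquiv.symm_apply_eq]; rfl
      simp [this])

/-- The short exact sequence `0 → range f → P → Z → 0`. -/
def rangeComplex {P Q Z : Type u} [AddCommGroup P] [Module R P] [AddCommGroup Q] [Module R Q]
    [AddCommGroup Z] [Module R Z] (f : Q →ₗ[R] P) (g : P →ₗ[R] Z) (hfg : Function.Exact f g) :
    ShortComplex (ModuleCat.{u} R) :=
  ShortComplex.mk (ModuleCat.ofHom (LinearMap.range f).subtype) (ModuleCat.ofHom g) (by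
    ext ⟨_, t, rfl⟩
    exact hfg.apply_apply_eq_zero t)

theorem rangeComplex_shortExact {P Q Z : Type u} [AddCommGroup P] [Module R P] [AddCommGroup Q]
    [Module R Q] [AddCommGroup Z] [Module R Z] (f : Q →ₗ[R] P) (g : P →ₗ[R] Z)
    (hfg : Function.Exact f g) (hg : Function.Surjective g) :
    (rangeComplex f g hfg).ShortExact where
  exact := by
    rw [ShortComplex.moduleCat_exact_iff]
    intro z hz
    obtain ⟨t, ht⟩ := (hfg z).1 hz
    exact ⟨⟨z, t, ht⟩, rfl⟩
  mono_f := (ModuleCat.mono_iff_injective _).2 Subtype.val_injective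
  epi_g := (ModuleCat.epi_iff_surjective _).2 hg

/-- The dimensions of `Ext` groups in terms of the spaces of cocycles of the complex obtained
from a projective resolution. -/
theorem rank_ext (Y : Type u) [AddCommGroup Y] [Module R Y] [Module K Y] [IsScalarTower K R Y]
    (n : ℕ) (P : ℕ → Type u) [∀ n, AddCommGroup (P n)] [∀ n, Module R (P n)]
    [∀ n, Module.Projective R (P n)] (d : ∀ n, P (n + 1) →ₗ[R] P n)
    (hd : ∀ n, Function.Exact (d (n + 1)) (d n))
    [∀ n, Module.Finite K (P n →ₗ[R] Y)]
    (M : Type u) [AddCommGroup M] [Module R M] (g : P 0 →ₗ[R] M) (hg : Function.Surjective g)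
    (hdg : Function.Exact (d 0) g) :
    ∃ h : ℕ, Module.rank K (Abelian.Ext.{u} (ModuleCat.of R M) (ModuleCat.of R Y) (n + 1)) = h ∧
      h + Module.finrank K (P n →ₗ[R] Y) =
        Module.finrank K (homKer K (d (n + 1)) Y) + Module.finrank K (homKer K (d n) Y) := by
  have hS := rangeComplex_shortExact (d 0) g hdg hg
  have hsurj : Function.Surjective (d 0).rangeRestrict := (d 0).surjective_rangeRestrict
  have hex : Function.Exact (d 1) (d 0).rangeRestrict := by
    intro z
    rw [← hd 0 z, Subtype.ext_iff]
    rfl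
  have : Projective (rangeComplex (d 0) g hdg).X₂ :=
    (IsProjective.iff_projective (P 0)).1 inferInstance
  induction n generalizing P M with
  | zero =>
    exact rank_ext_one_add K hS (ModuleCat.of R Y)
      ((homEquiv (R := R) K (LinearMap.range (d 0)) Y).trans
        (homKerEquiv K (d 1) (d 0).rangeRestrict hex hsurj Y))
      (homEquiv (R := R) K (P 0) Y)
      ((homEquiv (R := R) K M Y).trans (homKerEquiv K (d 0) g hdg hg Y))
  | succ n ih =>
    -- Dimension shift: without its term of degree zero the complex resolves the image of `d 0`,
    -- whose `Ext` in degree `n + 1` is that of `M` in degree `n + 2`.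
    obtain ⟨h, h1, h2⟩ := ih (fun n => P (n + 1)) (fun n => d (n + 1)) (fun n => hd (n + 1))
      (LinearMap.range (d 0)) (d 0).rangeRestrict hsurj hex
      (rangeComplex_shortExact _ _ hex hsurj) (d 1).surjective_rangeRestrict
      (fun z => by rw [← hd 1 z, Subtype.ext_iff]; rfl)
      ((IsProjective.iff_projective (P 1)).1 inferInstance)
    refine ⟨h, ?_, h2⟩
    rw [← h1]
    exact (extShiftEquiv K hS (ModuleCat.of R Y) n).rank_eq.symm

theorem rank_ext_zero (Y : Type u) [AddCommGroup Y] [Module R Y] [Module K Y]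
    [IsScalarTower K R Y] {P Q : Type u} [AddCommGroup P] [Module R P] [AddCommGroup Q] [Module R Q]
    (f : Q →ₗ[R] P) [Module.Finite K (P →ₗ[R] Y)]
    (M : Type u) [AddCommGroup M] [Module R M] (g : P →ₗ[R] M) (hg : Function.Surjective g)
    (hdg : Function.Exact f g) :
    Module.rank K (Abelian.Ext.{u} (ModuleCat.of R M) (ModuleCat.of R Y) 0) =
      Module.finrank K (homKer K f Y) := by
  rw [Module.finrank_eq_rank]
  exact (Abelian.Ext.linearEquiv₀.trans ((homEquiv (R := R) K M Y).trans
    (homKerEquiv K f g hdg hg Y))).rank_eq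

end Modules

end ExtDim

end

noncomputable section

/-! ### Cyclic covers of the algebras `K⟨x, y⟩ / (x², y², s (xy)^(2T+1) + (yx)^(2T+1))` -/

/-- Generators and relations of the four-fold cyclic cover of
`K⟨x, y⟩ / (x², y², s (xy)^(2T+1) + (yx)^(2T+1))` inside an algebra `A`. -/
structure CoverRel (K : Type u) [Field K] (A : Type u) [Ring A] [Algebra K A] (T : ℕ) where
  /-- the deformation parameter -/
  s : K
  s_ne : s ≠ 0
  /-- the vertex idempotents -/
  e : ZMod 4 → A
  /-- the two letters -/
  letter : Bool → A
  e_mul : ∀ i j, e i * e j = if i = j then e i else 0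
  e_sum : ∑ i, e i = 1
  e_letter : ∀ i b, e i * letter b = letter b * e (i + 1)
  letter_sq : ∀ b, letter b * letter b = 0
  rel : s • (letter true * letter false) ^ (2 * T + 1) +
    (letter false * letter true) ^ (2 * T + 1) = 0

namespace CoverRel

variable {K : Type u} [Field K] {A : Type u} [Ring A] [Algebra K A] {T : ℕ} (C : CoverRel K A T)

/-- The alternating word of length `j` with first letter `b`. -/
def word : Bool → ℕ → A
  | _, 0 => 1
  | b, j + 1 => C.letter b * word (!b) j

@[simp] theorem word_zero (b : Bool) : C.word b 0 = 1 := rfl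

theorem word_succ (b : Bool) (j : ℕ) : C.word b (j + 1) = C.letter b * C.word (!b) j := rfl

theorem word_one (b : Bool) : C.word b 1 = C.letter b := by simp [word_succ]

theorem letter_mul_word_self (b : Bool) (j : ℕ) : C.letter b * C.word b (j + 1) = 0 := by
  rw [word_succ, ← mul_assoc, C.letter_sq, zero_mul]

/-- Each letter flips the next one, so after `i` letters the word continues with `b` exactly when
`i` is even. -/
theorem word_add (b : Bool) (i j : ℕ) :
    C.word b (i + j) = C.word b i * C.word (xor b i.bodd) j := by
  induction i generalizing b with
  | zero => simp
  | succ i ih =>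
    rw [show i + 1 + j = i + j + 1 by omega, word_succ, word_succ, ih, mul_assoc]
    congr 3
    cases b <;> simp

theorem word_succ' (b : Bool) (j : ℕ) :
    C.word b (j + 1) = C.word b j * C.letter (xor b j.bodd) := by
  rw [word_add, word_one]

theorem word_succ_mul_letter (b : Bool) (j : ℕ) :
    C.word b (j + 1) * C.letter (xor b j.bodd) = 0 := by
  rw [word_succ', mul_assoc, C.letter_sq, mul_zero]

theorem pow_eq_word (b : Bool) (k : ℕ) :
    (C.letter b * C.letter (!b)) ^ k = C.word b (2 * k) := by
  induction k with
  | zero => simp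
  | succ k ih =>
    rw [pow_succ', ih, show 2 * (k + 1) = 2 * k + 1 + 1 by ring, word_succ, word_succ, mul_assoc,
      Bool.not_not]

theorem word_false_top : C.word false (4 * T + 2) = -(C.s • C.word true (4 * T + 2)) := by
  have h := C.rel
  have h1 := C.pow_eq_word true (2 * T + 1)
  have h2 := C.pow_eq_word false (2 * T + 1)
  simp only [Bool.not_true, Bool.not_false] at h1 h2
  rw [h1, h2, show 2 * (2 * T + 1) = 4 * T + 2 by ring] at h
  exact eq_neg_of_add_eq_zero_right h

theorem word_true_top : C.word true (4 * T + 2) = -(C.s⁻¹ • C.word false (4 * T + 2)) := by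
  rw [word_false_top, smul_neg, smul_smul, inv_mul_cancel₀ C.s_ne, one_smul, neg_neg]

/-- After the first letter `b` stands a top word beginning with the other letter. The relation
rewrites it as a multiple of the top word beginning with `b`, and a square appears. -/
theorem word_top_succ (b : Bool) : C.word b (4 * T + 3) = 0 := by
  rw [show 4 * T + 3 = 4 * T + 2 + 1 by ring, word_succ]
  cases b
  · rw [Bool.not_false, word_true_top, show 4 * T + 2 = 4 * T + 1 + 1 by ring, mul_neg,
      mul_smul_comm, letter_mul_word_self, smul_zero, neg_zero]
  · rw [Bool.not_true, word_false_top, show 4 * T + 2 = 4 * T + 1 + 1 by ring, mul_neg,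
      mul_smul_comm, letter_mul_word_self, smul_zero, neg_zero]

theorem word_eq_zero (b : Bool) {j : ℕ} (h : 4 * T + 3 ≤ j) : C.word b j = 0 := by
  obtain ⟨k, rfl⟩ := Nat.exists_eq_add_of_le h
  rw [word_add, word_top_succ, zero_mul]

theorem e_word (i : ZMod 4) (b : Bool) (j : ℕ) : C.e i * C.word b j = C.word b j * C.e (i + j) := by
  induction j generalizing i b with
  | zero => simp
  | succ j ih =>
    rw [word_succ, ← mul_assoc, C.e_letter, mul_assoc, ih, mul_assoc]
    push_cast
    rw [add_right_comm, add_assoc]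

end CoverRel

/-- The indices of the nonzero alternating words: the empty word, the word of maximal length
`4 T + 2`, and the words of length `j + 1` with first letter `b`. -/
abbrev WordIndex (T : ℕ) : Type := Option (Option (Bool × Fin (4 * T + 1)))

namespace CoverRel

variable {K : Type u} [Field K] {A : Type u} [Ring A] [Algebra K A] {T : ℕ} (C : CoverRel K A T)

/-- The word with the given index. -/
def wordOf : WordIndex T → A
  | none => 1
  | some none => C.word false (4 * T + 2)
  | some (some (b, j)) => C.word b (j + 1)

/-- The span of the vectors `e_i w`, for `w` an alternating word. -/
def wordSpan : Submodule K A :=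
  Submodule.span K (Set.range fun t : ZMod 4 × WordIndex T => C.e t.1 * C.wordOf t.2)

theorem e_mul_word_mem (i : ZMod 4) (b : Bool) (j : ℕ) : C.e i * C.word b j ∈ C.wordSpan := by
  have key : ∀ t : ZMod 4 × WordIndex T, C.e t.1 * C.wordOf t.2 ∈ C.wordSpan :=
    fun t => Submodule.subset_span ⟨t, rfl⟩
  rcases j with _ | j
  · exact key (i, none)
  · rcases lt_trichotomy j (4 * T + 1) with h | rfl | h
    · exact key (i, some (some (b, ⟨j, h⟩)))
    · cases b
      · exact key (i, some none)
      · rw [word_true_top, mul_neg, mul_smul_comm]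
        exact neg_mem (Submodule.smul_mem _ _ (key (i, some none)))
    · rw [C.word_eq_zero b (by omega), mul_zero]
      exact zero_mem _

theorem exists_wordOf_eq (w : WordIndex T) : ∃ b j, C.wordOf w = C.word b j := by
  rcases w with _ | _ | ⟨b, j⟩
  · exact ⟨true, 0, rfl⟩
  · exact ⟨false, 4 * T + 2, rfl⟩
  · exact ⟨b, j + 1, rfl⟩

/-- A letter on the right prolongs a nonempty word or repeats its last letter and kills it, and both
letters prolong the empty word. This is the induction step for spanning, where paths are built arrow
by arrow. -/
theorem mul_letter_mem {a : A} (ha : a ∈ C.wordSpan) (b : Bool) : a * C.letter b ∈ C.wordSpan := by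
  have : C.wordSpan ≤ C.wordSpan.comap (LinearMap.mulRight K (C.letter b)) := by
    refine Submodule.span_le.2 ?_
    rintro _ ⟨⟨i, w⟩, rfl⟩
    obtain ⟨c, j, h⟩ := C.exists_wordOf_eq w
    simp only [h, SetLike.mem_coe, Submodule.mem_comap, LinearMap.mulRight_apply, mul_assoc]
    by_cases hb : b = xor c j.bodd
    · rw [hb, ← word_succ']
      exact C.e_mul_word_mem _ _ _
    · rcases j with _ | j
      · rw [word_zero, one_mul, ← word_one]
        exact C.e_mul_word_mem _ _ _
      · have : b = xor c j.bodd := by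
          revert hb; rw [Nat.bodd_succ]; cases b <;> cases c <;> cases j.bodd <;> decide
        rw [this, word_succ_mul_letter, mul_zero]
        exact zero_mem _
  exact this ha

end CoverRel

/-- The four-fold cyclic cover of `K⟨x, y⟩ / (x², y², s (xy)^(2T+1) + (yx)^(2T+1))`. -/
structure Cover (K : Type u) [Field K] (A : Type u) [Ring A] [Algebra K A] (T : ℕ) extends
    CoverRel K A T where
  /-- the basis of alternating words -/
  basis : Module.Basis (ZMod 4 × WordIndex T) K A
  basis_apply : ∀ t, basis t = e t.1 * toCoverRel.wordOf t.2

end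

noncomputable section

/-! ### The algebra `A_T(q₀, q₁, q₂, q₃)` as a cyclic cover -/

namespace GammaPath

/-- The index `l` of an arrow `a l m`. -/
def arrowLetter : {a b : GammaVertex} → GammaArrow a b → ZMod 2
  | _, _, GammaArrow.a l _ => l

/-- The sequence of indices of the arrows of a path. -/
def letters : {a b : GammaVertex} → Quiver.Path a b → List (ZMod 2)
  | _, _, .nil => []
  | _, _, .cons p f => letters p ++ [arrowLetter f]

theorem letters_cons {a b : GammaVertex} (p : Quiver.Path a b) (l : ZMod 2) :
    letters (p.cons (GammaArrow.a l b)) = letters p ++ [l] := by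
  simp [letters, arrowLetter]

theorem letters_comp {a b c : GammaVertex} (p : Quiver.Path a b) (r : Quiver.Path b c) :
    letters (p.comp r) = letters p ++ letters r := by
  induction r with
  | nil => simp [letters]
  | cons r f ih => simp [letters, ih]

theorem letters_cast {a b a' b' : GammaVertex} (p : Quiver.Path a b) (h : a = a') (h' : b = b') :
    letters (p.cast h h') = letters p := by
  subst h h'; rfl

theorem eq_of_letters_eq_nil {a b : GammaVertex} (p : Quiver.Path a b) (h : letters p = []) :
    a = b := by
  cases p with
  | nil => rfl
  | cons p f => simp [letters] at h

variable {K : Type u} [Field K]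

theorem of_mul_gammaE (p : QuiverPath GammaVertex) (i : GammaVertex) :
    PathAlgebra.of K p * gammaE K i = if p.tgt = i then PathAlgebra.of K p else 0 := by
  rw [gammaE, PathAlgebra.of_mul_of]
  split_ifs with h
  · subst h
    rw [PathAlgebra.mulPath_of_eq _ _ rfl]
    simp
  · exact PathAlgebra.mulPath_of_ne _ _ h

theorem of_mul_gammaX (p : QuiverPath GammaVertex) (l : ZMod 2) :
    PathAlgebra.of K p * gammaX K l =
      PathAlgebra.of K ⟨p.src, p.tgt + 1, p.path.cons (GammaArrow.a l p.tgt)⟩ := by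
  rw [gammaX, Finset.mul_sum, Finset.sum_eq_single p.tgt]
  · rw [PathAlgebra.of_mul_of, PathAlgebra.mulPath_of_eq _ _ rfl]
    rfl
  · intro m _ hm
    rw [PathAlgebra.of_mul_of]
    exact PathAlgebra.mulPath_of_ne _ _ (Ne.symm hm)
  · simp

theorem of_mul_gammaX_pow (p : QuiverPath GammaVertex) (l : ZMod 2) (j : ℕ) :
    ∃ p' : QuiverPath GammaVertex, PathAlgebra.of K p * gammaX K l ^ j = PathAlgebra.of K p' ∧
      p'.src = p.src ∧ p'.tgt = p.tgt + j ∧ letters p'.path = letters p.path ++ List.replicate j l := by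
  induction j with
  | zero => exact ⟨p, by simp⟩
  | succ j ih =>
    obtain ⟨p', h1, h2, h3, h4⟩ := ih
    rw [pow_succ, ← mul_assoc, h1, of_mul_gammaX]
    refine ⟨_, rfl, h2, ?_, ?_⟩
    · simp only [h3]; push_cast; ring
    · rw [letters_cons, h4, List.append_assoc, ← List.replicate_succ']

theorem gammaE_mul_of (p : QuiverPath GammaVertex) (i : GammaVertex) :
    gammaE K i * PathAlgebra.of K p = if i = p.src then PathAlgebra.of K p else 0 := by
  rw [gammaE, PathAlgebra.of_mul_of]
  split_ifs with h
  · subst h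
    rw [PathAlgebra.mulPath_of_eq _ _ rfl]
    simp
  · exact PathAlgebra.mulPath_of_ne _ _ h

theorem gammaE_mul_gammaX (i : GammaVertex) (l : ZMod 2) :
    gammaE K i * gammaX K l = gammaX K l * gammaE K (i + 1) := by
  rw [gammaX, Finset.mul_sum, Finset.sum_mul]
  refine Finset.sum_congr rfl fun m _ => ?_
  rw [gammaE_mul_of, of_mul_gammaE]
  by_cases h : i = m
  · rw [if_pos (by exact h), if_pos (show (gammaArrowPath l m).tgt = i + 1 from congrArg (· + 1) h.symm)]
  · rw [if_neg (by exact h), if_neg (show (gammaArrowPath l m).tgt ≠ i + 1 from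
      fun h' => h (add_right_cancel h').symm)]

theorem gammaE_mul_gammaE (i j : GammaVertex) :
    gammaE K i * gammaE K j = if i = j then gammaE K i else 0 :=
  of_mul_gammaE _ _

theorem sum_gammaE : ∑ i, gammaE K i = 1 := rfl

variable {T : ℕ} (q : GammaVertex → Kˣ)

/-- The normal form of a path that only uses arrows of index `l`. -/
def pureNF (T : ℕ) (i : GammaVertex) (l : ZMod 2) (j : ℕ) : ZMod 4 × WordIndex T →₀ K :=
  if h : j < 4 * T + 1 then
    Finsupp.single (i, some (some (decide (l = i.toZModTwo), ⟨j, h⟩))) 1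
  else if j = 4 * T + 1 then
    Finsupp.single (i, some none) (if l = i.toZModTwo then 1 else -(q i : K))
  else 0

/-- The normal form of a path in terms of its origin and its sequence of indices. -/
def listNF (T : ℕ) (i : GammaVertex) : List (ZMod 2) → (ZMod 4 × WordIndex T →₀ K)
  | [] => Finsupp.single (i, none) 1
  | l :: L => if ∀ k ∈ L, k = l then pureNF q T i l L.length else 0

theorem listNF_replicate (i : GammaVertex) (l : ZMod 2) (j : ℕ) :
    listNF q T i (List.replicate (j + 1) l) = pureNF q T i l j := by
  rw [List.replicate_succ, listNF, if_pos fun k hk => List.eq_of_mem_replicate hk,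
    List.length_replicate]

theorem listNF_mixed (i : GammaVertex) (L L' : List (ZMod 2)) (l : ZMod 2) :
    listNF q T i (L ++ [l, l + 1] ++ L') = 0 := by
  have hl : l + 1 ≠ l := by simp
  rcases L with _ | ⟨k, L⟩
  · simp [listNF]
  · simp only [List.cons_append, listNF]
    rw [if_neg]
    intro h
    exact hl ((h (l + 1) (by simp)).trans (h l (by simp)).symm)

theorem listNF_long (i : GammaVertex) (L : List (ZMod 2)) (h : 4 * T + 2 < L.length) :
    listNF q T i L = 0 := by
  rcases L with _ | ⟨k, L⟩
  · simp at h
  · simp only [List.length_cons] at h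
    rw [listNF, pureNF, dif_neg (by omega), if_neg (show L.length ≠ 4 * T + 1 by omega), ite_self]

/-- The normal form, as a linear map on the path algebra. -/
def nf (T : ℕ) : PathAlgebra K GammaVertex →ₗ[K] (ZMod 4 × WordIndex T →₀ K) :=
  (PathAlgebra.basis K).constr K fun p => listNF q T p.src (letters p.path)

theorem nf_of (p : QuiverPath GammaVertex) :
    nf q T (PathAlgebra.of K p) = listNF q T p.src (letters p.path) := by
  rw [nf, PathAlgebra.of, Module.Basis.constr_basis]

theorem nf_of_mul_of (p r : QuiverPath GammaVertex) :
    nf q T (PathAlgebra.of K p * PathAlgebra.of K r) =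
      if p.tgt = r.src then listNF q T p.src (letters p.path ++ letters r.path) else 0 := by
  rw [PathAlgebra.of_mul_of]
  split_ifs with h
  · rw [PathAlgebra.mulPath_of_eq _ _ h, nf_of, letters_comp, letters_cast]
  · rw [PathAlgebra.mulPath_of_ne _ _ h, map_zero]

theorem nf_mul_mul_eq_zero {a : PathAlgebra K GammaVertex}
    (h : ∀ p r, nf q T (PathAlgebra.of K p * a * PathAlgebra.of K r) = 0)
    (f g : PathAlgebra K GammaVertex) : nf q T (f * a * g) = 0 := by
  have h1 : ∀ p, nf q T ∘ₗ LinearMap.mulLeft K (PathAlgebra.of K p * a) = 0 := fun p =>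
    PathAlgebra.hom_ext fun r => h p r
  have h2 : nf q T ∘ₗ LinearMap.mulRight K (a * g) = 0 := PathAlgebra.hom_ext fun p => by
    have := LinearMap.congr_fun (h1 p) g
    simpa [mul_assoc] using this
  have := LinearMap.congr_fun h2 f
  simpa [mul_assoc] using this

/-- The largest two-sided ideal on which the normal form vanishes. -/
def nfIdeal (T : ℕ) : TwoSidedIdeal (PathAlgebra K GammaVertex) :=
  TwoSidedIdeal.mk' {a | ∀ f g, nf q T (f * a * g) = 0} (by simp)
    (fun {a b} ha hb f g => by rw [mul_add, add_mul, map_add, ha, hb, add_zero])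
    (fun {a} ha f g => by rw [mul_neg, neg_mul, map_neg, ha, neg_zero])
    (fun {a b} hb f g => by rw [← mul_assoc]; exact hb _ _)
    (fun {a b} ha f g => by rw [← mul_assoc, mul_assoc]; exact ha _ _)

theorem mem_nfIdeal {a : PathAlgebra K GammaVertex} :
    a ∈ nfIdeal q T ↔ ∀ f g, nf q T (f * a * g) = 0 :=
  TwoSidedIdeal.mem_mk' ..

/-- A path through `x_l x_{l+1}` uses two different indices and has normal form zero. For the long
relation, either both surrounding paths are trivial and the coefficients `qᵢ` and `-qᵢ` of the top
vector cancel, or both terms are longer than `4T + 2` and vanish. Working with the largest ideal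
inside the kernel makes it unnecessary to know that the kernel itself is an ideal. -/
theorem gammaIdeal_le : gammaIdeal T q ≤ nfIdeal q T := by
  refine TwoSidedIdeal.span_le.2 ?_
  rintro _ (⟨l, rfl⟩ | ⟨i, rfl⟩)
  · refine (mem_nfIdeal q).2 (nf_mul_mul_eq_zero q fun p r => ?_)
    rw [← mul_assoc, of_mul_gammaX, of_mul_gammaX, nf_of_mul_of]
    split_ifs with h
    · rw [letters_cons, letters_cons]
      have := listNF_mixed (T := T) q p.src (letters p.path) (letters r.path) l
      simpa using this
    · rfl
  · refine (mem_nfIdeal q).2 (nf_mul_mul_eq_zero q fun p r => ?_)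
    rw [← mul_assoc, of_mul_gammaE]
    split_ifs with hi
    · rw [mul_add, mul_smul_comm, add_mul, smul_mul_assoc, map_add, map_smul]
      obtain ⟨p₁, h1, s1, t1, l1⟩ := of_mul_gammaX_pow (K := K) p i.toZModTwo (4 * T + 2)
      obtain ⟨p₂, h2, s2, t2, l2⟩ := of_mul_gammaX_pow (K := K) p (i.toZModTwo + 1) (4 * T + 2)
      rw [h1, h2, nf_of_mul_of, nf_of_mul_of, l1, l2, s1, s2, t1, t2]
      split_ifs
      · by_cases hL : letters p.path = [] ∧ letters r.path = []
        · have hs : p.src = i := (eq_of_letters_eq_nil _ hL.1).trans hi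
          rw [hL.1, hL.2, List.nil_append, List.nil_append, List.append_nil, List.append_nil,
            listNF_replicate, listNF_replicate, hs]
          simp only [pureNF, lt_irrefl, dite_false, if_true, Finsupp.smul_single]
          rw [← Finsupp.single_add]
          simp
        · have hlen : 0 < (letters p.path).length + (letters r.path).length := by
            rw [← List.length_eq_zero_iff, ← List.length_eq_zero_iff] at hL
            omega
          rw [listNF_long, listNF_long, smul_zero, add_zero] <;>
          · simp only [List.length_append, List.length_replicate]; omega
      · simp
    · simp

theorem nf_gammaE_mul_pow (i : GammaVertex) (l : ZMod 2) (j : ℕ) :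
    nf q T (gammaE K i * gammaX K l ^ j) = listNF q T i (List.replicate j l) := by
  obtain ⟨p, h1, h2, -, h4⟩ := of_mul_gammaX_pow (K := K) ⟨i, i, Quiver.Path.nil⟩ l j
  rw [gammaE, h1, nf_of, h4, h2]
  simp [letters]

end GammaPath

/-- Coefficients that bring the relations into symmetric form. -/
theorem exists_scaling (K : Type u) [Field K] [IsAlgClosed K] (T : ℕ) (q : GammaVertex → Kˣ) :
    ∃ (s : K) (c : GammaVertex → Kˣ), s ^ 4 = q 0 * q 1 * q 2 * q 3 ∧
      ∀ i, s * ((c i * c (i + 2)) ^ T * c i : Kˣ) =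
        q i * ((c (i + 1) * c (i + 3)) ^ T * c (i + 1) : Kˣ) := by
  -- The value of `s⁴` is forced: multiplying the four required equations, all the `c i` cancel.
  obtain ⟨s, hs⟩ := IsAlgClosed.exists_pow_nat_eq ((q 0 * q 1 * q 2 * q 3 : Kˣ) : K)
    (show 0 < 4 by norm_num)
  have hs0 : s ≠ 0 := by
    rintro rfl
    rw [zero_pow (by norm_num)] at hs
    exact Units.ne_zero _ hs.symm
  -- `v` will be the quotient of `c 1 * c 3` by `c 0 * c 2`; the product of the equations for `i =
  -- 0` and `i = 2` prescribes its power of exponent `2T + 1`.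
  obtain ⟨v, hv⟩ := IsAlgClosed.exists_pow_nat_eq (s ^ 2 / (q 0 * q 2 : Kˣ) : K)
    (show 0 < 2 * T + 1 by omega)
  have hv0 : v ≠ 0 := by
    rintro rfl
    rw [zero_pow (by omega)] at hv
    exact div_ne_zero (pow_ne_zero _ hs0) (Units.ne_zero _) hv.symm
  lift s to Kˣ using hs0.isUnit
  lift v to Kˣ using hv0.isUnit
  have hs' : s ^ 4 = q 0 * q 1 * q 2 * q 3 := Units.ext (by simpa using hs)
  have hv' : v ^ (2 * T + 1) = s ^ 2 * (q 0 * q 2)⁻¹ := Units.ext (by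
    simpa [div_eq_mul_inv] using hv)
  set a := v ^ T with ha
  have hav : a ^ 2 * v = s ^ 2 * (q 0 * q 2)⁻¹ := by
    rw [← hv', ha, ← pow_mul, ← pow_succ, mul_comm T 2]
  -- With `c 0 = 1`, the other entries solve the equations for `i = 0, 1, 2` one after the other;
  -- the one for `i = 3` then amounts to the choice of `s⁴`.
  let c : Fin 4 → Kˣ := ![1, s * (q 0 * a)⁻¹, s ^ 2 * (q 0 * q 1)⁻¹,
    s ^ 3 * (q 0 * q 1 * q 2 * a)⁻¹]
  refine ⟨s, c, by exact_mod_cast hs', ?_⟩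
  have c0 : c 0 = 1 := rfl
  have c1 : c 1 = s * (q 0 * a)⁻¹ := rfl
  have c2 : c 2 = s ^ 2 * (q 0 * q 1)⁻¹ := rfl
  have c3 : c 3 = s ^ 3 * (q 0 * q 1 * q 2 * a)⁻¹ := rfl
  have hQ : c 1 * c 3 = v * (c 0 * c 2) := by
    have h4 : c 1 * c 3 = s ^ 2 * (q 0 * q 2)⁻¹ * (a ^ 2)⁻¹ * (c 0 * c 2) := by
      rw [c0, c1, c2, c3]
      simp only [mul_inv_rev]
      have : ∀ x y z w t : Kˣ, x * (y⁻¹ * z⁻¹) * (x ^ 3 * (y⁻¹ * (w⁻¹ * (t⁻¹ * z⁻¹)))) =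
        x ^ 2 * (w⁻¹ * z⁻¹) * (y ^ 2)⁻¹ * (1 * (x ^ 2 * (t⁻¹ * z⁻¹))) := by
        intro x y z w t
        have : (y ^ 2)⁻¹ = y⁻¹ * y⁻¹ := by rw [pow_two, mul_inv]
        rw [this]
        generalize y⁻¹ = y'
        generalize z⁻¹ = z'
        generalize w⁻¹ = w'
        generalize t⁻¹ = t'
        apply Units.ext
        push_cast
        ring
      exact this _ _ _ _ _
    rw [h4, ← hav]
    simp [mul_comm]
  have hQT : (c 1 * c 3) ^ T = a * (c 0 * c 2) ^ T := by rw [hQ, mul_pow]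
  have key : ∀ i : Fin 4, s * ((c i * c (i + 2)) ^ T * c i) =
      q i * ((c (i + 1) * c (i + 3)) ^ T * c (i + 1)) := by
    intro i
    fin_cases i
    · change s * ((c 0 * c 2) ^ T * c 0) = q 0 * ((c 1 * c 3) ^ T * c 1)
      rw [hQT, c1, c0]
      apply Units.ext
      push_cast
      field_simp
    · change s * ((c 1 * c 3) ^ T * c 1) = q 1 * ((c 2 * c 0) ^ T * c 2)
      rw [hQT, mul_comm (c 2) (c 0), c1]
      generalize (c 0 * c 2) ^ T = P
      rw [c2]
      apply Units.ext
      push_cast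
      field_simp
    · change s * ((c 2 * c 0) ^ T * c 2) = q 2 * ((c 3 * c 1) ^ T * c 3)
      rw [mul_comm (c 3) (c 1), hQT, mul_comm (c 2) (c 0)]
      generalize (c 0 * c 2) ^ T = P
      rw [c2, c3]
      apply Units.ext
      push_cast
      field_simp
    · change s * ((c 3 * c 1) ^ T * c 3) = q 3 * ((c 0 * c 2) ^ T * c 0)
      rw [mul_comm (c 3) (c 1), hQT]
      generalize (c 0 * c 2) ^ T = P
      rw [c3, c0]
      apply Units.ext
      have hs'' : (s : K) ^ 4 = q 0 * q 1 * q 2 * q 3 := by exact_mod_cast hs'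
      push_cast
      field_simp
      rw [hs'']
  intro i
  have := congrArg (Units.val) (key i)
  simpa only [Units.val_mul] using! this

end

/-! ### The cyclic cover inside the quotient algebra: rescaled letters and the basis of words. -/

noncomputable section

namespace GammaCover

variable {K : Type u} [Field K] {T : ℕ} {q : GammaVertex → Kˣ}

/-- The image of `e_i` in `A`. -/
def vert (T : ℕ) (q : GammaVertex → Kˣ) (i : GammaVertex) : AlgA T q :=
  (gammaIdeal T q).ringCon.mkₐ (α := K) (gammaE K i)

/-- The image of `x_l` in `A`. -/
def arr (T : ℕ) (q : GammaVertex → Kˣ) (l : ZMod 2) : AlgA T q :=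
  (gammaIdeal T q).ringCon.mkₐ (α := K) (gammaX K l)

theorem mk_eq_zero {a : PathAlgebra K GammaVertex} :
    (gammaIdeal T q).ringCon.mkₐ (α := K) a = 0 ↔ a ∈ gammaIdeal T q := by
  rw [TwoSidedIdeal.mem_iff, ← map_zero ((gammaIdeal T q).ringCon.mkₐ (α := K))]
  exact RingCon.eq _

theorem vert_mul_vert (i j : GammaVertex) :
    vert T q i * vert T q j = if i = j then vert T q i else 0 := by
  rw [vert, vert, ← map_mul, GammaPath.gammaE_mul_gammaE]
  split_ifs <;> simp

theorem sum_vert : ∑ i, vert T q i = 1 := by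
  simp only [vert]
  rw [← map_sum, GammaPath.sum_gammaE, map_one]

theorem vert_mul_arr (i : GammaVertex) (l : ZMod 2) :
    vert T q i * arr T q l = arr T q l * vert T q (i + 1) := by
  rw [vert, vert, arr, ← map_mul, ← map_mul, GammaPath.gammaE_mul_gammaX]

theorem arr_mul_arr (l : ZMod 2) : arr T q l * arr T q (l + 1) = 0 := by
  rw [arr, arr, ← map_mul, mk_eq_zero]
  exact TwoSidedIdeal.subset_span (Or.inl ⟨l, rfl⟩)

theorem vert_mul_arr_pow_add (i : GammaVertex) :
    vert T q i * ((q i : K) • arr T q i.toZModTwo ^ (4 * T + 2) +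
      arr T q (i.toZModTwo + 1) ^ (4 * T + 2)) = 0 := by
  rw [vert, arr, arr, ← map_pow, ← map_pow, ← map_smul, ← map_add, ← map_mul, mk_eq_zero]
  exact TwoSidedIdeal.subset_span (Or.inr ⟨i, rfl⟩)

theorem vert_mul_arr_pow (i : GammaVertex) (l : ZMod 2) (j : ℕ) :
    vert T q i * arr T q l ^ j = arr T q l ^ j * vert T q (i + j) := by
  induction j with
  | zero => simp
  | succ j ih =>
    rw [pow_succ, ← mul_assoc, ih, mul_assoc, vert_mul_arr, mul_assoc]
    push_cast
    rw [add_assoc]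

/-- The index of the arrow that represents the letter `b` at the vertex `i`. -/
def idx (b : Bool) (i : GammaVertex) : ZMod 2 := if b then i.toZModTwo else i.toZModTwo + 1

theorem idx_succ (b : Bool) (i : GammaVertex) : idx b (i + 1) = idx b i + 1 := by
  cases b <;> simp [idx]

theorem idx_not (b : Bool) (i : GammaVertex) : idx (!b) i = idx b i + 1 := by
  cases b
  · simp only [idx, Bool.not_false, if_true, Bool.false_eq_true, if_false, add_assoc]
    rw [show (1 : ZMod 2) + 1 = 0 from rfl, add_zero]
  · simp [idx]

/-- Passing to the next vertex and switching the letter both change the index by one modulo `2`. So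
an alternating word follows arrows of a single index. -/
theorem idx_not_succ (b : Bool) (i : GammaVertex) : idx (!b) (i + 1) = idx b i := by
  rw [idx_succ, idx_not, add_assoc, show (1 : ZMod 2) + 1 = 0 from rfl, add_zero]

variable (c : GammaVertex → Kˣ)

/-- The scaling of the letter `b` at the vertex `i`. -/
def coef (b : Bool) (i : GammaVertex) : Kˣ := if b then c i else 1

/-- The letters `x` and `y`. -/
def letter (T : ℕ) (q c : GammaVertex → Kˣ) (b : Bool) : AlgA T q :=
  ∑ i, (coef c b i : K) • (vert T q i * arr T q (idx b i))

theorem vert_mul_letter (i : GammaVertex) (b : Bool) :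
    vert T q i * letter T q c b = (coef c b i : K) • (vert T q i * arr T q (idx b i)) := by
  rw [letter, Finset.mul_sum, Finset.sum_eq_single i]
  · rw [mul_smul_comm, ← mul_assoc, vert_mul_vert, if_pos rfl]
  · intro j _ hj
    rw [mul_smul_comm, ← mul_assoc, vert_mul_vert, if_neg hj.symm, zero_mul, smul_zero]
  · simp

theorem letter_mul_vert (i : GammaVertex) (b : Bool) :
    letter T q c b * vert T q (i + 1) = (coef c b i : K) • (vert T q i * arr T q (idx b i)) := by
  rw [letter, Finset.sum_mul, Finset.sum_eq_single i]
  · rw [smul_mul_assoc, mul_assoc, ← vert_mul_arr, ← mul_assoc, vert_mul_vert, if_pos rfl]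
  · intro j _ hj
    rw [smul_mul_assoc, mul_assoc, ← vert_mul_arr, ← mul_assoc, vert_mul_vert, if_neg hj, zero_mul,
      smul_zero]
  · simp

theorem eq_of_vert_mul {a b : AlgA T q} (h : ∀ i, vert T q i * a = vert T q i * b) : a = b := by
  rw [← one_mul a, ← one_mul b, ← sum_vert, Finset.sum_mul, Finset.sum_mul]
  exact Finset.sum_congr rfl fun i _ => h i

/-- The same letter at two consecutive vertices stands for arrows of different index, whose product
is a multiple of `x_l x_{l+1}`. -/
theorem letter_mul_self (b : Bool) : letter T q c b * letter T q c b = 0 := by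
  refine eq_of_vert_mul fun i => ?_
  rw [← mul_assoc, vert_mul_letter, vert_mul_arr, smul_mul_assoc, mul_assoc, vert_mul_letter,
    mul_smul_comm, vert_mul_arr, ← mul_assoc, idx_succ, arr_mul_arr]
  simp

theorem vert_mul_letter_letter (i : GammaVertex) (b : Bool) :
    vert T q i * (letter T q c b * letter T q c (!b)) =
      (coef c b i * coef c (!b) (i + 1) : Kˣ) • (vert T q i * arr T q (idx b i) ^ 2) := by
  rw [← mul_assoc, vert_mul_letter, vert_mul_arr, smul_mul_assoc, mul_assoc, vert_mul_letter,
    mul_smul_comm, vert_mul_arr, ← mul_assoc, idx_not_succ, smul_smul, ← pow_two,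
    vert_mul_arr_pow, Units.smul_def, Units.val_mul]
  push_cast
  rw [add_assoc, one_add_one_eq_two]

theorem vert_mul_letter_pow_four (i : GammaVertex) (b : Bool) :
    vert T q i * (letter T q c b * letter T q c (!b)) ^ 2 =
      ((coef c b i * coef c (!b) (i + 1)) * (coef c b (i + 2) * coef c (!b) (i + 3)) : Kˣ) •
        (vert T q i * arr T q (idx b i) ^ 4) := by
  have h2 : idx b (i + 2) = idx b i := by
    rw [show i + 2 = i + 1 + 1 by ring, idx_succ, idx_succ, add_assoc,
      show (1 : ZMod 2) + 1 = 0 from rfl, add_zero]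
  rw [pow_two, ← mul_assoc, vert_mul_letter_letter, vert_mul_arr_pow, smul_mul_assoc, mul_assoc]
  have := vert_mul_letter_letter (T := T) (q := q) c (i + 2) b
  push_cast
  rw [this, h2, vert_mul_arr_pow, mul_smul_comm, smul_smul,
    ← mul_assoc (arr T q (idx b i) ^ 2), ← pow_add, vert_mul_arr_pow]
  push_cast
  rw [show i + 2 + 2 = i + 4 by ring, show i + 2 + 1 = i + 3 by ring]

/-- Four steps lead back to the starting vertex, so each further block of four letters contributes
the same scalar; the induction advances by such blocks. -/
theorem vert_mul_letter_pow (t : ℕ) (i : GammaVertex) (b : Bool) :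
    vert T q i * (letter T q c b * letter T q c (!b)) ^ (2 * t + 1) =
      (((coef c b i * coef c (!b) (i + 1)) * (coef c b (i + 2) * coef c (!b) (i + 3))) ^ t *
        (coef c b i * coef c (!b) (i + 1)) : Kˣ) • (vert T q i * arr T q (idx b i) ^ (4 * t + 2)) := by
  induction t with
  | zero => simpa using vert_mul_letter_letter c i b
  | succ t ih =>
    have h4 : i + 4 = i := by
      have : (4 : GammaVertex) = 0 := rfl
      rw [this, add_zero]
    rw [show 2 * (t + 1) + 1 = 2 + (2 * t + 1) by ring, pow_add _ 2, ← mul_assoc,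
      vert_mul_letter_pow_four, vert_mul_arr_pow, smul_mul_assoc,
      mul_assoc (arr T q (idx b i) ^ 4)]
    push_cast
    rw [h4, ih, mul_smul_comm, smul_smul, ← mul_assoc (arr T q (idx b i) ^ 4), pow_succ' _ t]
    have : arr T q (idx b i) ^ 4 * vert T q i = vert T q i * arr T q (idx b i) ^ 4 := by
      rw [vert_mul_arr_pow]
      push_cast
      rw [h4]
    rw [this, mul_assoc (vert T q i), ← pow_add, show 4 + (4 * t + 2) = 4 * (t + 1) + 2 by ring]
    congr 1
    simp only [mul_assoc]

/-- The generators and relations of a cyclic cover inside `A`. -/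
def coverRel (s : K) (hs : s ≠ 0) (c : GammaVertex → Kˣ)
    (hc : ∀ i, s * ((c i * c (i + 2)) ^ T * c i : Kˣ) =
      q i * ((c (i + 1) * c (i + 3)) ^ T * c (i + 1) : Kˣ)) : CoverRel K (AlgA T q) T where
  s := s
  s_ne := hs
  e := vert T q
  letter := letter T q c
  e_mul := vert_mul_vert
  e_sum := sum_vert
  e_letter i b := (vert_mul_letter c i b).trans (letter_mul_vert c i b).symm
  letter_sq := letter_mul_self c
  rel := eq_of_vert_mul fun i => by
    have h1 := vert_mul_letter_pow (T := T) (q := q) c T i true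
    have h2 := vert_mul_letter_pow (T := T) (q := q) c T i false
    simp only [Bool.not_true, Bool.not_false] at h1 h2
    rw [mul_add, mul_smul_comm, h1, h2, mul_zero]
    have h3 := vert_mul_arr_pow_add (T := T) (q := q) i
    rw [mul_add, mul_smul_comm] at h3
    simp only [coef, idx, if_true, Bool.false_eq_true, if_false, mul_one, one_mul]
    rw [eq_neg_of_add_eq_zero_right h3, smul_neg, ← sub_eq_add_neg, sub_eq_zero, Units.smul_def,
      smul_smul, hc i, Units.smul_def, smul_smul, mul_comm]

section

variable (s : K) (hs : s ≠ 0) (c : GammaVertex → Kˣ)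
    (hc : ∀ i, s * ((c i * c (i + 2)) ^ T * c i : Kˣ) =
      q i * ((c (i + 1) * c (i + 3)) ^ T * c (i + 1) : Kˣ))

theorem exists_vert_mul_word (i : GammaVertex) (b : Bool) (j : ℕ) :
    ∃ r : Kˣ, vert T q i * (coverRel s hs c hc).word b j =
      r • (vert T q i * arr T q (idx b i) ^ j) := by
  induction j generalizing i b with
  | zero => exact ⟨1, by simp⟩
  | succ j ih =>
    obtain ⟨r, hr⟩ := ih (i + 1) (!b)
    refine ⟨coef c b i * r, ?_⟩
    rw [CoverRel.word_succ, ← mul_assoc]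
    change vert T q i * letter T q c b * _ = _
    rw [vert_mul_letter, vert_mul_arr, smul_mul_assoc, mul_assoc, hr, idx_not_succ,
      vert_mul_arr_pow, mul_smul_comm, ← mul_assoc, ← pow_succ', vert_mul_arr_pow, mul_smul]
    push_cast
    rw [add_assoc, add_comm (1 : GammaVertex)]
    rfl

/-- Induction on the path: cut down at its starting vertex, the last arrow is a unit multiple of one
of the two letters, and the span is stable under right multiplication by letters. -/
theorem mk_of_mem_wordSpan {a b : GammaVertex} (p : Quiver.Path a b) :
    (gammaIdeal T q).ringCon.mkₐ (α := K) (PathAlgebra.of K ⟨a, b, p⟩) ∈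
      (coverRel s hs c hc).wordSpan := by
  induction p with
  | nil => simpa using! (coverRel s hs c hc).e_mul_word_mem a true 0
  | cons p f ih =>
    rename_i m m'
    obtain ⟨l, m⟩ := f
    have h1 := GammaPath.of_mul_gammaX (K := K) ⟨a, m, p⟩ l
    have h2 : PathAlgebra.of K ⟨a, m, p⟩ * gammaE K m = PathAlgebra.of K ⟨a, m, p⟩ := by
      rw [GammaPath.of_mul_gammaE, if_pos rfl]
    dsimp only at h1
    rw [← h1, ← h2, map_mul, map_mul]
    change _ * vert T q m * arr T q l ∈ _
    obtain ⟨b, rfl⟩ : ∃ b, l = idx b m := by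
      by_cases h : l = m.toZModTwo
      · exact ⟨true, by simpa [idx] using h⟩
      · refine ⟨false, ?_⟩
        simp only [idx, Bool.false_eq_true, if_false]
        have key : ∀ l z : ZMod 2, ¬l = z → l = z + 1 := by decide
        exact key _ _ h
    have h3 : vert T q m * arr T q (idx b m) =
        (coef c b m)⁻¹ • (vert T q m * letter T q c b) := by
      rw [vert_mul_letter, ← Units.smul_def, inv_smul_smul]
    rw [mul_assoc, h3, mul_smul_comm, Units.smul_def, ← mul_assoc]
    refine Submodule.smul_mem _ _ ?_
    refine (coverRel s hs c hc).mul_letter_mem ?_ b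
    rw [vert, ← map_mul, h2]
    exact ih

theorem wordSpan_eq_top : (coverRel s hs c hc).wordSpan = ⊤ := by
  rw [eq_top_iff]
  rintro a -
  obtain ⟨f, rfl⟩ := (gammaIdeal T q).ringCon.mkₐ_surjective (α := K) a
  have h := (PathAlgebra.basis K).mem_span f
  refine Submodule.span_induction (p := fun f _ => (gammaIdeal T q).ringCon.mkₐ (α := K) f ∈
    (coverRel s hs c hc).wordSpan) ?_ ?_ ?_ ?_ h
  · rintro _ ⟨p, rfl⟩
    exact mk_of_mem_wordSpan s hs c hc p.path
  · simp
  · intro f g _ _ hf hg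
    rw [map_add]
    exact add_mem hf hg
  · intro r f _ hf
    rw [map_smul]
    exact Submodule.smul_mem _ _ hf

/-- The first letter and the length of a word. -/
def pathData : WordIndex T → Bool × ℕ
  | none => (true, 0)
  | some none => (false, 4 * T + 2)
  | some (some (b, j)) => (b, j + 1)

theorem units_smul_single (r : Kˣ) (t : ZMod 4 × WordIndex T) :
    (r • Finsupp.single t 1 : ZMod 4 × WordIndex T →₀ K) = Finsupp.single t (r : K) := by
  rw [Units.smul_def, Finsupp.smul_single, smul_eq_mul, mul_one]

theorem nf_pathData (i : GammaVertex) (w : WordIndex T) :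
    ∃ r : Kˣ, GammaPath.nf q T (gammaE K i * gammaX K (idx (pathData w).1 i) ^ (pathData w).2) =
      r • Finsupp.single (i, w) 1 := by
  rw [GammaPath.nf_gammaE_mul_pow]
  obtain _ | _ | ⟨b, j⟩ := w
  · exact ⟨1, (one_smul _ _).symm⟩
  -- The top basis word begins with the letter `false`, that is, with the arrow of index `i + 1`. In
  -- the normal form the pure path of that index carries the coefficient `-qᵢ`.
  · refine ⟨-q i, Eq.trans ?_ (units_smul_single _ _).symm⟩
    simp only [pathData, GammaPath.listNF_replicate, GammaPath.pureNF, idx, lt_irrefl, dite_false,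
      if_true, Bool.false_eq_true, if_false, add_eq_left, one_ne_zero, Units.val_neg]
    rfl
  · refine ⟨1, Eq.trans ?_ (units_smul_single _ _).symm⟩
    simp only [pathData, GammaPath.listNF_replicate, GammaPath.pureNF, j.2, dite_true,
      Units.val_one]
    cases b <;> simp [idx] <;> rfl

/-- A relation between words lifts to an element of the defining ideal, on which the normal form
vanishes. The normal form sends the lifted pure paths to unit multiples of distinct basis vectors,
and passing from pure paths to words only rescales by units. -/
theorem linearIndependent_words :
    LinearIndependent K fun t : ZMod 4 × WordIndex T =>
      (coverRel s hs c hc).e t.1 * (coverRel s hs c hc).wordOf t.2 := by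
  have h1 : LinearIndependent K fun t : ZMod 4 × WordIndex T =>
      vert T q t.1 * arr T q (idx (pathData t.2).1 t.1) ^ (pathData t.2).2 := by
    choose r hr using fun t : ZMod 4 × WordIndex T => nf_pathData (K := K) (q := q) t.1 t.2
    have h2 : LinearIndependent K fun t : ZMod 4 × WordIndex T =>
        (r t • Finsupp.single t 1 : ZMod 4 × WordIndex T →₀ K) :=
      LinearIndependent.units_smul (Finsupp.linearIndependent_single_one K _) r
    rw [linearIndependent_iff'] at h2 ⊢
    intro S g hg t ht
    refine h2 S g ?_ t ht
    have h3 : ∑ t ∈ S, g t • (gammaE K t.1 *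
        gammaX K (idx (pathData t.2).1 t.1) ^ (pathData t.2).2) ∈ gammaIdeal T q := by
      rw [← mk_eq_zero, map_sum, ← hg]
      refine Finset.sum_congr rfl fun t _ => ?_
      rw [map_smul, map_mul, map_pow]
      rfl
    have h4 := (GammaPath.mem_nfIdeal q).1 (GammaPath.gammaIdeal_le q h3) 1 1
    rw [one_mul, mul_one, map_sum] at h4
    rw [← h4]
    refine Finset.sum_congr rfl fun t _ => ?_
    rw [map_smul]
    exact congrArg _ (hr t).symm
  have h5 : ∀ t : ZMod 4 × WordIndex T, ∃ r : Kˣ,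
      (coverRel s hs c hc).e t.1 * (coverRel s hs c hc).wordOf t.2 =
      r • (vert T q t.1 * arr T q (idx (pathData t.2).1 t.1) ^ (pathData t.2).2) := by
    rintro ⟨i, _ | _ | ⟨b, j⟩⟩
    · exact exists_vert_mul_word s hs c hc i true 0
    · exact exists_vert_mul_word s hs c hc i false (4 * T + 2)
    · exact exists_vert_mul_word s hs c hc i b (j + 1)
  choose r hr using h5
  simp_rw [hr]
  exact h1.units_smul r

/-- The algebra `A` is a cyclic cover. -/
def cover : Cover K (AlgA T q) T where
  toCoverRel := coverRel s hs c hc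
  basis := Module.Basis.mk (linearIndependent_words s hs c hc) (wordSpan_eq_top s hs c hc).ge
  basis_apply t := Module.Basis.mk_apply _ _ t

end

theorem exists_cover [IsAlgClosed K] (T : ℕ) (q : GammaVertex → Kˣ) :
    ∃ C : Cover K (AlgA T q) T, C.s ^ 4 = q 0 * q 1 * q 2 * q 3 := by
  obtain ⟨s, c, h4, hc⟩ := exists_scaling K T q
  have hs : s ≠ 0 := by
    rintro rfl
    rw [zero_pow (by norm_num)] at h4
    exact Units.ne_zero (q 0 * q 1 * q 2 * q 3) (by push_cast; exact h4.symm)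
  exact ⟨cover s hs c hc, h4⟩

end GammaCover

end

noncomputable section

/-! ### The differentials of the bimodule resolution -/

namespace CoverRel

variable {K : Type u} [Field K] {A : Type u} [Ring A] [Algebra K A] {T : ℕ} (C : CoverRel K A T)

/-- The commutation parameter of the letter `b`. -/
def par (b : Bool) : K := if b then C.s else C.s⁻¹

/-- The normalisation factor of the strand of the letter `b`. -/
def kap (b : Bool) : K := if b then 1 else C.s

theorem par_ne (b : Bool) : C.par b ≠ 0 := by
  cases b <;> simp [par, C.s_ne]

theorem kap_ne (b : Bool) : C.kap b ≠ 0 := by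
  cases b <;> simp [kap, C.s_ne]

theorem par_not (b : Bool) : C.par (!b) = (C.par b)⁻¹ := by
  cases b <;> simp [par]

/-- The longest proper word that is not killed by the letter `b`. -/
def cow (b : Bool) : A := C.word (!b) (4 * T + 1)

theorem word_not_top (b : Bool) :
    C.word (!b) (4 * T + 2) = -(C.par b • C.word b (4 * T + 2)) := by
  cases b
  · exact C.word_true_top
  · exact C.word_false_top

theorem letter_mul_cow (b : Bool) : C.letter b * C.cow b = C.word b (4 * T + 2) := rfl

theorem bodd_four_mul (n : ℕ) : (4 * n).bodd = false := by simp

theorem cow_mul_letter (b : Bool) : C.cow b * C.letter b = C.word (!b) (4 * T + 2) := by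
  rw [show 4 * T + 2 = 4 * T + 1 + 1 by ring, word_succ', cow]
  simp

/-- The two products are the two top words, which the long relation identifies up to a scalar. This
skew commutation is the source of all powers of `par b` in the differential. -/
theorem cow_mul_letter' (b : Bool) :
    C.cow b * C.letter b = -(C.par b • (C.letter b * C.cow b)) := by
  rw [cow_mul_letter, letter_mul_cow, word_not_top]

theorem word_mul_word_eq_zero {b b' : Bool} {i j : ℕ} (h : b' = xor b i.bodd) :
    C.word b (i + 1) * C.word b' (j + 1) = 0 := by
  rw [word_succ', word_succ, h, mul_assoc, ← mul_assoc (C.letter _), C.letter_sq, zero_mul,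
    mul_zero]

theorem cow_mul_cow (b : Bool) : C.cow b * C.cow b = 0 :=
  C.word_mul_word_eq_zero (by simp)

/-- The element `a ⊗ v` of the enveloping algebra. -/
def tm (K : Type u) [Field K] {A : Type u} [Ring A] [Algebra K A] (a v : A) : A ⊗[K] Aᵐᵒᵖ :=
  a ⊗ₜ MulOpposite.op v

theorem tm_mul (a v a' v' : A) : tm K a v * tm K a' v' = tm K (a * a') (v' * v) := by
  simp [tm, Algebra.TensorProduct.tmul_mul_tmul]

theorem tm_zero_left (v : A) : tm K 0 v = 0 := TensorProduct.zero_tmul _ _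

theorem tm_zero_right (a : A) : tm K a 0 = 0 := by simp [tm]

theorem tm_smul_left (c : K) (a v : A) : tm K (c • a) v = c • tm K a v :=
  TensorProduct.smul_tmul' _ _ _ |>.symm

theorem tm_smul_right (c : K) (a v : A) : tm K a (c • v) = c • tm K a v := by
  simp [tm]

theorem tm_neg_left (a v : A) : tm K (-a) v = -tm K a v := TensorProduct.neg_tmul _ _

theorem tm_neg_right (a v : A) : tm K a (-v) = -tm K a v := by
  simp [tm, TensorProduct.tmul_neg]

/-- Left multiplication by a letter plus a multiple of right multiplication. -/
def lin (b : Bool) (a c : ℕ) : A ⊗[K] Aᵐᵒᵖ :=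
  tm K (C.letter b) 1 + ((-1) ^ a * (C.par b)⁻¹ ^ c) • tm K 1 (C.letter b)

/-- Left multiplication by the long word plus a multiple of right multiplication. -/
def hvy (b : Bool) (a c : ℕ) : A ⊗[K] Aᵐᵒᵖ :=
  C.kap b • ((C.par b)⁻¹ ^ a • tm K (C.cow b) 1 + ((-1) ^ a * C.par b ^ c) • tm K 1 (C.cow b))

/-- The noncommutative derivative of the long relation with respect to the letter `b`. -/
def fox (b : Bool) (c : ℕ) : A ⊗[K] Aᵐᵒᵖ :=
  C.kap b • ∑ k ∈ Finset.HasAntidiagonal.antidiagonal (2 * T),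
    (C.par b ^ c • tm K (C.word b (2 * k.1)) (C.word (!b) (2 * k.2 + 1)) +
      tm K (C.word (!b) (2 * k.1 + 1)) (C.word (!b) (2 * k.2)))

/-- Squares of letters vanish, and the two terms with one letter on each side have opposite signs
because the parity of `a` changes. -/
theorem lin_mul_lin (b : Bool) (a c : ℕ) : C.lin b (a + 1) c * C.lin b a c = 0 := by
  simp only [lin, mul_add, add_mul, smul_mul_assoc, mul_smul_comm, tm_mul, C.letter_sq, one_mul,
    mul_one, tm_zero_left, tm_zero_right, smul_zero, zero_add, add_zero]
  rw [← add_smul, pow_succ]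
  simp

theorem hvy_mul_hvy (b : Bool) (a c : ℕ) : C.hvy b a (c + 1) * C.hvy b (a + 1) c = 0 := by
  have h := C.par_ne b
  simp only [hvy, mul_add, add_mul, smul_mul_assoc, mul_smul_comm, tm_mul, cow_mul_cow, one_mul,
    mul_one, tm_zero_left, tm_zero_right, smul_zero, zero_add, add_zero]
  match_scalars
  simp only [inv_pow]
  field_simp
  ring

/-- Terms with letter and long word on different sides cancel by the choice of signs and exponents;
terms with both on the same side cancel by the skew commutation of letter and long word. -/
theorem lin_mul_hvy (b : Bool) (a c : ℕ) :
    C.lin b (a + 1) (c + 1) * C.hvy b a (c + 1) + C.hvy b (a + 1) (c + 1) * C.lin b (a + 2) c = 0 := by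
  have h := C.par_ne b
  simp only [lin, hvy, mul_add, add_mul, smul_mul_assoc, mul_smul_comm, tm_mul, one_mul,
    mul_one, cow_mul_letter', tm_neg_left, tm_neg_right, tm_smul_left, tm_smul_right]
  match_scalars <;> (try simp only [inv_pow]) <;> field_simp <;> ring

theorem word_even_mul (b : Bool) (m : ℕ) :
    C.word b (2 * m) * C.letter b = C.word b (2 * m + 1) := by
  rw [word_succ']; simp

theorem word_odd_mul (b : Bool) (m : ℕ) : C.word b (2 * m + 1) * C.letter b = 0 := by
  have := C.word_succ_mul_letter b (2 * m)
  simpa using this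

theorem word_odd_mul_not (b : Bool) (m : ℕ) :
    C.word b (2 * m + 1) * C.letter (!b) = C.word b (2 * (m + 1)) := by
  rw [show 2 * (m + 1) = 2 * m + 1 + 1 by ring, word_succ' _ b (2 * m + 1)]; simp

theorem word_even_mul_not (b : Bool) (m : ℕ) :
    C.word b (2 * (m + 1)) * C.letter (!b) = 0 := by
  have := C.word_succ_mul_letter b (2 * m + 1)
  simpa [show 2 * (m + 1) = 2 * m + 1 + 1 by ring] using this

/-- Every summand of the derivative dies on its own: in one half the letter meets itself, and in the
remaining products the left and the right letter give the same tensor with opposite coefficients. -/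
theorem lin_mul_fox_not (b : Bool) (c : ℕ) : C.lin b 1 c * C.fox (!b) c = 0 := by
  rw [fox, mul_smul_comm, Finset.mul_sum, Finset.sum_eq_zero, smul_zero]
  rintro ⟨k, m⟩ -
  have h := C.par_ne b
  simp only [lin, mul_add, add_mul, smul_mul_assoc, mul_smul_comm, tm_mul, one_mul, mul_one,
    Bool.not_not, C.letter_mul_word_self, C.word_even_mul, C.word_odd_mul, tm_zero_left,
    tm_zero_right, smul_zero, par_not]
  rw [← C.word_succ]
  match_scalars
  ring

theorem sum_antidiagonal_fst {M : Type*} [AddCommMonoid M] (n : ℕ) (f : ℕ → ℕ → M)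
    (h : ∀ k m, f (k + 1) m = 0) :
    ∑ k ∈ Finset.HasAntidiagonal.antidiagonal n, f k.1 k.2 = f 0 n := by
  rw [Finset.sum_eq_single (0, n)]
  · rintro ⟨k, m⟩ hk hne
    rcases k with _ | k
    · simp_all
    · exact h k m
  · simp

theorem sum_antidiagonal_snd {M : Type*} [AddCommMonoid M] (n : ℕ) (f : ℕ → ℕ → M)
    (h : ∀ k m, f k (m + 1) = 0) :
    ∑ k ∈ Finset.HasAntidiagonal.antidiagonal n, f k.1 k.2 = f n 0 := by
  rw [Finset.sum_eq_single (n, 0)]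
  · rintro ⟨k, m⟩ hk hne
    rcases m with _ | m
    · simp_all
    · exact h k m
  · simp

theorem sum_antidiagonal_shift {M : Type*} [AddCommGroup M] (n : ℕ) (f : ℕ → ℕ → M) :
    ∑ k ∈ Finset.HasAntidiagonal.antidiagonal n, (f (k.1 + 1) k.2 - f k.1 (k.2 + 1)) =
      f (n + 1) 0 - f 0 (n + 1) := by
  have h1 := Finset.Nat.sum_antidiagonal_succ (n := n) (f := fun k => f k.1 k.2)
  have h2 := Finset.Nat.sum_antidiagonal_succ' (n := n) (f := fun k => f k.1 k.2)
  rw [h1] at h2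
  rw [Finset.sum_sub_distrib]
  simp only at h2
  rw [sub_eq_sub_iff_add_eq_add, add_comm, h2, add_comm]

/-- The long word leaves no room for a nontrivial factor on its side, so each half of the heavy
component keeps only one end of the sum. Both survivors are multiples of the same tensor. -/
theorem fox_mul_hvy (b : Bool) (c : ℕ) : C.fox b (c + 1) * C.hvy b 1 c = 0 := by
  have h := C.par_ne b
  have hL : (∑ k ∈ Finset.HasAntidiagonal.antidiagonal (2 * T),
      (C.par b ^ (c + 1) • tm K (C.word b (2 * k.1)) (C.word (!b) (2 * k.2 + 1)) +
      tm K (C.word (!b) (2 * k.1 + 1)) (C.word (!b) (2 * k.2)))) * tm K (C.cow b) 1 =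
      C.par b ^ (c + 1) • tm K (C.cow b) (C.cow b) := by
    rw [Finset.sum_mul, sum_antidiagonal_fst (2 * T) (fun k m =>
      (C.par b ^ (c + 1) • tm K (C.word b (2 * k)) (C.word (!b) (2 * m + 1)) +
      tm K (C.word (!b) (2 * k + 1)) (C.word (!b) (2 * m))) * tm K (C.cow b) 1)]
    · rw [add_mul, smul_mul_assoc, tm_mul, tm_mul, cow,
        C.word_mul_word_eq_zero (by simp), tm_zero_left, add_zero]
      simp [← mul_assoc]
    · intro k m
      rw [add_mul, smul_mul_assoc, tm_mul, tm_mul, cow,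
        C.word_mul_word_eq_zero (by simp), tm_zero_left, add_zero,
        show 2 * (k + 1) = 2 * k + 1 + 1 by ring, C.word_mul_word_eq_zero (by simp), tm_zero_left,
        smul_zero]
  have hR : (∑ k ∈ Finset.HasAntidiagonal.antidiagonal (2 * T),
      (C.par b ^ (c + 1) • tm K (C.word b (2 * k.1)) (C.word (!b) (2 * k.2 + 1)) +
      tm K (C.word (!b) (2 * k.1 + 1)) (C.word (!b) (2 * k.2)))) * tm K 1 (C.cow b) =
      tm K (C.cow b) (C.cow b) := by
    rw [Finset.sum_mul, sum_antidiagonal_snd (2 * T) (fun k m =>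
      (C.par b ^ (c + 1) • tm K (C.word b (2 * k)) (C.word (!b) (2 * m + 1)) +
      tm K (C.word (!b) (2 * k + 1)) (C.word (!b) (2 * m))) * tm K 1 (C.cow b))]
    · rw [add_mul, smul_mul_assoc, tm_mul, tm_mul, cow,
        C.word_mul_word_eq_zero (by simp), tm_zero_right, smul_zero, zero_add]
      simp [← mul_assoc]
    · intro k m
      rw [add_mul, smul_mul_assoc, tm_mul, tm_mul, cow,
        C.word_mul_word_eq_zero (by simp), tm_zero_right, smul_zero, zero_add,
        show 2 * (m + 1) = 2 * m + 1 + 1 by ring, C.word_mul_word_eq_zero (by simp), tm_zero_right]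
  rw [fox, hvy, smul_mul_assoc, mul_smul_comm, mul_add, mul_smul_comm, mul_smul_comm, hL, hR]
  match_scalars
  simp only [inv_pow]
  field_simp
  ring

/-- Neighbouring summands telescope, apart from the terms where the letter meets itself except at an
end of the sum. The four boundary terms left over are those produced by the heavy component. -/
theorem lin_mul_fox (b : Bool) (c : ℕ) :
    C.lin b 1 (c + 1) * C.fox b (c + 1) + C.hvy b 1 (c + 1) * C.lin b 2 c = 0 := by
  have h := C.par_ne b
  have h1 : C.lin b 1 (c + 1) * C.fox b (c + 1) = C.kap b •
      (C.par b ^ (c + 1) • tm K (C.letter b) (C.cow b)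
        - (C.par b)⁻¹ ^ (c + 1) • tm K (C.cow b) (C.letter b)
        + (tm K (C.letter b * C.cow b) 1 - tm K 1 (C.cow b * C.letter b))) := by
    have e1 := sum_antidiagonal_fst (2 * T) (fun k m =>
      C.par b ^ (c + 1) • tm K (C.letter b * C.word b (2 * k)) (C.word (!b) (2 * m + 1)))
      (fun k m => by
        rw [show 2 * (k + 1) = 2 * k + 1 + 1 by ring, C.letter_mul_word_self, tm_zero_left,
          smul_zero])
    have e2 := sum_antidiagonal_snd (2 * T) (fun k m =>
      (C.par b)⁻¹ ^ (c + 1) • tm K (C.word (!b) (2 * k + 1)) (C.word (!b) (2 * m) * C.letter b))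
      (fun k m => by
        have := C.word_even_mul_not (!b) m
        rw [Bool.not_not] at this
        rw [this, tm_zero_right, smul_zero])
    have e3 := sum_antidiagonal_shift (2 * T) (fun k m =>
      tm K (C.word b (2 * k)) (C.word (!b) (2 * m)))
    have e4 : C.cow b * C.letter b = C.word (!b) (2 * (2 * T + 1)) := by
      rw [cow_mul_letter]; congr 1; ring
    have e5 : C.letter b * C.cow b = C.word b (2 * (2 * T + 1)) := by
      rw [letter_mul_cow]; congr 1; ring
    have e6 : C.cow b = C.word (!b) (2 * (2 * T) + 1) := by
      rw [cow]; congr 1; ring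
    simp only [mul_zero, word_zero, mul_one, one_mul] at e1 e2 e3
    rw [e4, e5, e6, ← e1, ← e2, ← e3, ← Finset.sum_sub_distrib, ← Finset.sum_add_distrib, fox,
      mul_smul_comm, Finset.mul_sum]
    congr 1
    refine Finset.sum_congr rfl fun ⟨k, m⟩ _ => ?_
    have e7 : C.letter b * C.word (!b) (2 * k + 1) = C.word b (2 * (k + 1)) := rfl
    have e8 := C.word_odd_mul_not (!b) m
    rw [Bool.not_not] at e8
    simp only [lin, mul_add, add_mul, smul_mul_assoc, mul_smul_comm, tm_mul, one_mul, mul_one,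
      e7, e8]
    match_scalars <;> (try simp only [inv_pow]) <;> field_simp
  rw [h1]
  simp only [lin, hvy, mul_add, add_mul, smul_mul_assoc, mul_smul_comm, tm_mul, one_mul,
    mul_one, cow_mul_letter', tm_neg_left, tm_neg_right, tm_smul_left, tm_smul_right]
  match_scalars <;> (try simp only [inv_pow]) <;> field_simp <;> ring

/-- The fundamental formula of Fox calculus: derivatives times differences of letters telescope to
`r ⊗ 1 - 1 ⊗ r` for the long relation `r`. The terms that carry the twist `c` cancel between the two
letters. -/
theorem fox_mul_lin (c : ℕ) :
    C.fox false (c + 1) * C.lin false 1 c + C.fox true (c + 1) * C.lin true 1 c = 0 := by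
  have h := C.s_ne
  have e1 := sum_antidiagonal_shift (2 * T) (fun k m =>
      tm K (C.word true (2 * k)) (C.word true (2 * m)))
  have e2 := sum_antidiagonal_shift (2 * T) (fun k m =>
      tm K (C.word false (2 * k)) (C.word false (2 * m)))
  have e3 : C.word false (2 * (2 * T + 1)) = -(C.s • C.word true (2 * (2 * T + 1))) := by
    rw [show 2 * (2 * T + 1) = 4 * T + 2 by ring, word_false_top]
  have key : C.fox false (c + 1) * C.lin false 1 c + C.fox true (c + 1) * C.lin true 1 c =
      C.s • (tm K (C.word true (2 * (2 * T + 1))) 1 - tm K 1 (C.word true (2 * (2 * T + 1)))) +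
      (tm K (C.word false (2 * (2 * T + 1))) 1 - tm K 1 (C.word false (2 * (2 * T + 1)))) := by
    simp only [mul_zero, word_zero] at e1 e2
    rw [← e1, ← e2, Finset.smul_sum, ← Finset.sum_add_distrib, fox, fox, smul_mul_assoc,
      smul_mul_assoc, Finset.sum_mul, Finset.sum_mul, Finset.smul_sum, Finset.smul_sum,
      ← Finset.sum_add_distrib]
    refine Finset.sum_congr rfl fun ⟨k, m⟩ _ => ?_
    have a1 := C.word_even_mul true k
    have a2 := C.word_even_mul false k
    have a3 := C.word_odd_mul_not true k
    have a4 := C.word_odd_mul_not false k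
    have a5 : C.letter true * C.word false (2 * m + 1) = C.word true (2 * (m + 1)) := rfl
    have a6 : C.letter false * C.word true (2 * m + 1) = C.word false (2 * (m + 1)) := rfl
    have a7 : C.letter true * C.word false (2 * m) = C.word true (2 * m + 1) := rfl
    have a8 : C.letter false * C.word true (2 * m) = C.word false (2 * m + 1) := rfl
    simp only [Bool.not_true, Bool.not_false] at a3 a4
    simp only [lin, mul_add, add_mul, smul_mul_assoc, mul_smul_comm, tm_mul, one_mul, mul_one,
      Bool.not_true, Bool.not_false, par, kap, if_true, Bool.false_eq_true, if_false, a1, a2, a3,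
      a4, a5, a6, a7, a8]
    match_scalars <;> (try simp only [inv_pow]) <;> field_simp <;> ring
  rw [key, e3, tm_neg_left, tm_neg_right, tm_smul_left, tm_smul_right]
  module

/-- The component of the differential that lowers the exponent attached to the letter `b`. -/
def dgen (b : Bool) (i j : ℕ) : A ⊗[K] Aᵐᵒᵖ :=
  if j ≤ i then C.lin b (i + 1 - j) j
  else if j = i + 1 then C.fox (!b) j
  else C.hvy (!b) (j - i - 1) (i + 1)

theorem dgen_mul_dgen (b : Bool) (i j : ℕ) : C.dgen b (i + 1) j * C.dgen b i j = 0 := by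
  rcases le_or_gt j i with h | h
  · obtain ⟨a, rfl⟩ := Nat.exists_eq_add_of_le h
    rw [dgen, if_pos (by omega), dgen, if_pos (by omega),
      show j + a + 1 + 1 - j = a + 1 + 1 by omega, show j + a + 1 - j = a + 1 by omega, lin_mul_lin]
  · obtain ⟨a, rfl⟩ := Nat.exists_eq_add_of_lt h
    rcases a with _ | _ | a
    · rw [dgen, if_pos (by omega), dgen, if_neg (by omega), if_pos (by omega),
        show i + 1 + 1 - (i + 0 + 1) = 1 by omega, lin_mul_fox_not]
    · rw [dgen, if_neg (by omega), if_pos (by omega), dgen, if_neg (by omega), if_neg (by omega),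
        show i + (0 + 1) + 1 - i - 1 = 1 by omega, show i + (0 + 1) + 1 = i + 1 + 1 by omega,
        fox_mul_hvy]
    · rw [dgen, if_neg (by omega), if_neg (by omega), dgen, if_neg (by omega), if_neg (by omega),
        show i + (a + 1 + 1) + 1 - (i + 1) - 1 = a + 1 by omega,
        show i + (a + 1 + 1) + 1 - i - 1 = a + 1 + 1 by omega, hvy_mul_hvy]

theorem dgen_comm_of_lt (b : Bool) {i j : ℕ} (h : j < i) :
    C.dgen b i (j + 1) * C.dgen (!b) j i + C.dgen (!b) j (i + 1) * C.dgen b i j = 0 := by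
  obtain ⟨a, rfl⟩ := Nat.exists_eq_add_of_lt h
  rcases a with _ | a
  · rw [dgen, if_pos (by omega), dgen, if_neg (by omega), if_pos (by omega),
      dgen, if_neg (by omega), if_neg (by omega), dgen, if_pos (by omega), Bool.not_not,
      show j + 0 + 1 + 1 - (j + 1) = 1 by omega, show j + 0 + 1 + 1 - j - 1 = 1 by omega,
      show j + 0 + 1 + 1 - j = 2 by omega, show j + 0 + 1 = j + 1 by omega, lin_mul_fox]
  · rw [dgen, if_pos (by omega), dgen, if_neg (by omega), if_neg (by omega),
      dgen, if_neg (by omega), if_neg (by omega), dgen, if_pos (by omega), Bool.not_not,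
      show j + (a + 1) + 1 + 1 - (j + 1) = a + 1 + 1 by omega,
      show j + (a + 1) + 1 - j - 1 = a + 1 by omega,
      show j + (a + 1) + 1 + 1 - j - 1 = a + 1 + 1 by omega,
      show j + (a + 1) + 1 + 1 - j = a + 1 + 2 by omega, lin_mul_hvy]

/-- Components of the differential: `(i + 1, j) → (i, j)`. -/
def d₁ (i j : ℕ) : A ⊗[K] Aᵐᵒᵖ := C.dgen true i j

/-- Components of the differential: `(i, j + 1) → (i, j)`. -/
def d₂ (i j : ℕ) : A ⊗[K] Aᵐᵒᵖ := C.dgen false j i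

theorem d_comm (i j : ℕ) : C.d₁ i (j + 1) * C.d₂ i j + C.d₂ (i + 1) j * C.d₁ i j = 0 := by
  rcases lt_trichotomy i j with h | rfl | h
  · have := C.dgen_comm_of_lt false h
    rw [add_comm]
    exact this
  · rw [d₁, d₂, d₁, d₂, dgen, if_neg (by omega), if_pos rfl, dgen, if_pos le_rfl, dgen,
      if_neg (by omega), if_pos rfl, dgen, if_pos le_rfl, show i + 1 - i = 1 by omega]
    exact C.fox_mul_lin i
  · exact C.dgen_comm_of_lt true h

/-- The differential of the bimodule resolution, on all bidegrees at once. -/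
def diff (ρ : ℕ → ℕ → A ⊗[K] Aᵐᵒᵖ) (i j : ℕ) : A ⊗[K] Aᵐᵒᵖ :=
  ρ (i + 1) j * C.d₁ i j + ρ i (j + 1) * C.d₂ i j

theorem diff_diff (ρ : ℕ → ℕ → A ⊗[K] Aᵐᵒᵖ) (i j : ℕ) : C.diff (C.diff ρ) i j = 0 := by
  have h1 : C.d₁ (i + 1) j * C.d₁ i j = 0 := C.dgen_mul_dgen true i j
  have h2 : C.d₂ i (j + 1) * C.d₂ i j = 0 := C.dgen_mul_dgen false j i
  have h3 := C.d_comm i j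
  simp only [diff, add_mul, mul_assoc, h1, h2, mul_zero, zero_add, add_zero]
  rw [← mul_add, add_comm (C.d₂ _ _ * _), h3, mul_zero]

end CoverRel

end

noncomputable section

/-! ### Removing the last letter of a word -/

namespace Cover

variable {K : Type u} [Field K] {A : Type u} [Ring A] [Algebra K A] {T : ℕ} (C : Cover K A T)

/-- The two top words are proportional, so either may be used for testing. The free choice of `β`
allows the one whose last letter suits the map at hand. -/
theorem linearMap_ext {M : Type*} [AddCommGroup M] [Module K M] (β : Bool) {f g : A →ₗ[K] M}
    (h₁ : ∀ i, f (C.e i) = g (C.e i))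
    (h₂ : ∀ i b j, j ≤ 4 * T → f (C.e i * C.word b (j + 1)) = g (C.e i * C.word b (j + 1)))
    (h₃ : ∀ i, f (C.e i * C.word β (4 * T + 2)) = g (C.e i * C.word β (4 * T + 2))) : f = g := by
  refine C.basis.ext fun ⟨i, w⟩ => ?_
  rw [C.basis_apply]
  rcases w with _ | _ | ⟨b, j⟩
  · simpa [CoverRel.wordOf] using h₁ i
  · change f (C.e i * C.word false (4 * T + 2)) = g (C.e i * C.word false (4 * T + 2))
    cases β
    · exact h₃ i
    · rw [C.word_false_top, mul_neg, mul_smul_comm, map_neg, map_smul, h₃, map_neg, map_smul]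
  · exact h₂ i b j (by omega)

/-- Removal of the last letter `b`. -/
def lop (b : Bool) : A →ₗ[K] A :=
  C.basis.constr K fun t => match t.2 with
    | none => 0
    | some none => if b then C.e t.1 * C.word false (4 * T + 1)
        else -(C.s • (C.e t.1 * C.word true (4 * T + 1)))
    | some (some (b', j)) => if xor b' (j : ℕ).bodd = b then C.e t.1 * C.word b' j else 0

/-- Removal of the last letter `y` of words of non-maximal length. -/
def lopShort : A →ₗ[K] A :=
  C.basis.constr K fun t => match t.2 with
    | none => 0
    | some none => 0
    | some (some (b', j)) => if xor b' (j : ℕ).bodd = false then C.e t.1 * C.word b' j else 0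

/-- The coefficient of the word `x y ⋯ x` of length `4 T + 1`. -/
def cowCoeff : A →ₗ[K] A :=
  C.basis.constr K fun t => match t.2 with
    | none => 0
    | some none => 0
    | some (some (b', j)) => if b' = true ∧ (j : ℕ) = 4 * T then C.e t.1 else 0

theorem e_eq_basis (i : ZMod 4) : C.e i = C.basis (i, none) := by
  rw [C.basis_apply]; simp [CoverRel.wordOf]

theorem e_mul_word_eq_basis (i : ZMod 4) (b : Bool) {j : ℕ} (hj : j ≤ 4 * T) :
    C.e i * C.word b (j + 1) = C.basis (i, some (some (b, ⟨j, by omega⟩))) := by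
  rw [C.basis_apply]; rfl

theorem e_mul_top_eq_basis (i : ZMod 4) :
    C.e i * C.word false (4 * T + 2) = C.basis (i, some none) := by
  rw [C.basis_apply]; rfl

theorem lop_e (b : Bool) (i : ZMod 4) : C.lop b (C.e i) = 0 := by
  rw [e_eq_basis, lop, Module.Basis.constr_basis]

theorem lop_word (b : Bool) (i : ZMod 4) (b' : Bool) {j : ℕ} (hj : j ≤ 4 * T) :
    C.lop b (C.e i * C.word b' (j + 1)) =
      if xor b' j.bodd = b then C.e i * C.word b' j else 0 := by
  rw [C.e_mul_word_eq_basis i b' hj, lop, Module.Basis.constr_basis]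

theorem lop_top (b : Bool) (i : ZMod 4) :
    C.lop b (C.e i * C.word (!b) (4 * T + 2)) = C.e i * C.cow b := by
  cases b
  · rw [Bool.not_false, C.word_true_top, mul_neg, mul_smul_comm, map_neg, map_smul,
      e_mul_top_eq_basis, lop, Module.Basis.constr_basis]
    simp [CoverRel.cow, smul_smul, inv_mul_cancel₀ C.s_ne]
  · rw [Bool.not_true, e_mul_top_eq_basis, lop, Module.Basis.constr_basis]
    simp [CoverRel.cow]

theorem lopShort_e (i : ZMod 4) : C.lopShort (C.e i) = 0 := by
  rw [e_eq_basis, lopShort, Module.Basis.constr_basis]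

theorem lopShort_word (i : ZMod 4) (b' : Bool) {j : ℕ} (hj : j ≤ 4 * T) :
    C.lopShort (C.e i * C.word b' (j + 1)) =
      if xor b' j.bodd = false then C.e i * C.word b' j else 0 := by
  rw [C.e_mul_word_eq_basis i b' hj, lopShort, Module.Basis.constr_basis]

theorem lopShort_top (b : Bool) (i : ZMod 4) :
    C.lopShort (C.e i * C.word b (4 * T + 2)) = 0 := by
  have h : C.lopShort (C.e i * C.word false (4 * T + 2)) = 0 := by
    rw [e_mul_top_eq_basis, lopShort, Module.Basis.constr_basis]
  cases b
  · exact h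
  · rw [C.word_true_top, mul_neg, mul_smul_comm, map_neg, map_smul, h, smul_zero, neg_zero]

theorem cowCoeff_e (i : ZMod 4) : C.cowCoeff (C.e i) = 0 := by
  rw [e_eq_basis, cowCoeff, Module.Basis.constr_basis]

theorem cowCoeff_word (i : ZMod 4) (b' : Bool) {j : ℕ} (hj : j ≤ 4 * T) :
    C.cowCoeff (C.e i * C.word b' (j + 1)) = if b' = true ∧ j = 4 * T then C.e i else 0 := by
  rw [C.e_mul_word_eq_basis i b' hj, cowCoeff, Module.Basis.constr_basis]

theorem cowCoeff_top (b : Bool) (i : ZMod 4) :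
    C.cowCoeff (C.e i * C.word b (4 * T + 2)) = 0 := by
  have h : C.cowCoeff (C.e i * C.word false (4 * T + 2)) = 0 := by
    rw [e_mul_top_eq_basis, cowCoeff, Module.Basis.constr_basis]
  cases b
  · exact h
  · rw [C.word_true_top, mul_neg, mul_smul_comm, map_neg, map_smul, h, smul_zero, neg_zero]

theorem word_mul_letter_of_eq {b b' : Bool} {j : ℕ} (h : xor b' j.bodd = b) :
    C.word b' (j + 1) * C.letter b = 0 := by
  rw [← h, C.word_succ_mul_letter]

theorem word_mul_letter_of_ne {b b' : Bool} {j : ℕ} (h : ¬ xor b' j.bodd = b) :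
    C.word b' (j + 1) * C.letter b = C.word b' (j + 2) := by
  rw [C.word_succ' b' (j + 1)]
  congr 2
  revert h; rw [Nat.bodd_succ]; cases b <;> cases b' <;> cases j.bodd <;> decide

theorem xor_succ_of_ne {b b' : Bool} {j : ℕ} (h : ¬ xor b' j.bodd = b) :
    xor b' (j + 1).bodd = b := by
  revert h; rw [Nat.bodd_succ]; cases b <;> cases b' <;> cases j.bodd <;> decide

theorem word_top_mul_letter (b b' : Bool) : C.word b' (4 * T + 2) * C.letter b = 0 := by
  by_cases h : xor b' (4 * T + 1).bodd = b
  · exact C.word_mul_letter_of_eq h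
  · rw [show 4 * T + 2 = 4 * T + 1 + 1 by ring, C.word_mul_letter_of_ne h]
    exact C.word_top_succ _

theorem word_mul_cow_of_ne {b b' : Bool} {j : ℕ} (h : ¬ xor b' j.bodd = b) :
    C.word b' (j + 1) * C.cow b = 0 :=
  C.word_mul_word_eq_zero (by
    revert h; cases b <;> cases b' <;> cases j.bodd <;> decide)

theorem word_mul_cow_of_eq {b b' : Bool} {j : ℕ} (h : xor b' j.bodd = b) :
    C.word b' (j + 1) * C.cow b = C.word b' (j + (4 * T + 2)) := by
  have : (!b) = xor b' (j + 1).bodd := by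
    rw [← h, Nat.bodd_succ]; cases b' <;> cases j.bodd <;> decide
  rw [CoverRel.cow, this, ← C.word_add]
  congr 1
  ring

theorem word_mul_cow_eq_zero {b b' : Bool} {j : ℕ} (hj : 1 ≤ j) :
    C.word b' (j + 1) * C.cow b = 0 := by
  by_cases h : xor b' j.bodd = b
  · rw [C.word_mul_cow_of_eq h, C.word_eq_zero _ (by omega)]
  · exact C.word_mul_cow_of_ne h

theorem word_top_mul_cow (b b' : Bool) : C.word b' (4 * T + 2) * C.cow b = 0 :=
  C.word_mul_cow_eq_zero (by omega)

/-- A word that ends in `b` is recovered by removing and restoring that letter, and any other word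
by appending `b` and removing it again; for a word of length `4T + 1` the second way passes through
a top word. Thus right multiplication by `b` has its own image as kernel. -/
theorem lop_mul_add_lop_mul (b : Bool) (a : A) :
    C.lop b a * C.letter b + C.lop b (a * C.letter b) = a := by
  have : LinearMap.mulRight K (C.letter b) ∘ₗ C.lop b +
      C.lop b ∘ₗ LinearMap.mulRight K (C.letter b) = LinearMap.id := by
    refine C.linearMap_ext (!b) (fun i => ?_) (fun i b' j hj => ?_) (fun i => ?_)
    · have := C.lop_word b i b (Nat.zero_le _)
      simp only [zero_add, C.word_one] at this
      simp [this, lop_e]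
    · simp only [LinearMap.add_apply, LinearMap.comp_apply, LinearMap.mulRight_apply,
        LinearMap.id_apply, C.lop_word b i b' hj, mul_assoc]
      split_ifs with h
      · rw [C.word_mul_letter_of_eq h, mul_assoc, ← h, ← C.word_succ', mul_zero, map_zero,
          add_zero]
      · rw [C.word_mul_letter_of_ne h, zero_mul, zero_add]
        rcases hj.lt_or_eq with hj | rfl
        · rw [C.lop_word b i b' hj, if_pos (xor_succ_of_ne h)]
        · obtain rfl : b' = !b := by
            revert h; rw [CoverRel.bodd_four_mul]; cases b <;> cases b' <;> decide
          exact C.lop_top b i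
    · simp only [LinearMap.add_apply, LinearMap.comp_apply, LinearMap.mulRight_apply,
        LinearMap.id_apply, C.lop_top, mul_assoc, C.word_top_mul_letter, C.cow_mul_letter, mul_zero,
        map_zero, add_zero]
  exact LinearMap.congr_fun this a

/-- Both sides vanish except on the words `e_i b`, where appending the long word gives a top word.
Rewriting that word so that it ends in `b` costs the scalar. -/
theorem lop_mul_cow (b : Bool) (a : A) :
    C.lop b (a * C.cow b) = -((C.par b)⁻¹ • (C.lop b a * C.cow b)) := by
  have : C.lop b ∘ₗ LinearMap.mulRight K (C.cow b) =
      -((C.par b)⁻¹ • (LinearMap.mulRight K (C.cow b) ∘ₗ C.lop b)) := by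
    refine C.linearMap_ext (!b) (fun i => ?_) (fun i b' j hj => ?_) (fun i => ?_)
    · simp only [LinearMap.neg_apply, LinearMap.smul_apply, LinearMap.comp_apply,
        LinearMap.mulRight_apply, lop_e, zero_mul, smul_zero, neg_zero]
      rw [CoverRel.cow, C.lop_word _ _ _ le_rfl, if_neg]
      rw [CoverRel.bodd_four_mul]; simp
    · simp only [LinearMap.neg_apply, LinearMap.smul_apply, LinearMap.comp_apply,
        LinearMap.mulRight_apply, C.lop_word b i b' hj, mul_assoc]
      rcases Nat.eq_zero_or_pos j with rfl | hj'
      · split_ifs with h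
        · rw [C.word_mul_cow_of_eq h]
          obtain rfl : b' = b := by simpa using h
          rw [zero_add]
          have h2 : C.word b' (4 * T + 2) = -((C.par b')⁻¹ • C.word (!b') (4 * T + 2)) := by
            rw [C.word_not_top, smul_neg, smul_smul, inv_mul_cancel₀ (C.par_ne _), one_smul,
              neg_neg]
          rw [h2, mul_neg, mul_smul_comm, map_neg, map_smul, lop_top, C.word_zero, mul_one]
        · rw [C.word_mul_cow_of_ne h]; simp
      · rw [C.word_mul_cow_eq_zero hj', mul_zero, map_zero]
        split_ifs with h
        · obtain ⟨k, rfl⟩ := Nat.exists_eq_add_of_lt hj'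
          rw [mul_assoc, zero_add, C.word_mul_cow_of_ne, mul_zero, smul_zero, neg_zero]
          rw [zero_add, Nat.bodd_succ] at h
          revert h; cases b <;> cases b' <;> cases k.bodd <;> decide
        · simp
    · simp only [LinearMap.neg_apply, LinearMap.smul_apply, LinearMap.comp_apply,
        LinearMap.mulRight_apply, mul_assoc, lop_top, C.word_top_mul_cow, C.cow_mul_cow, mul_zero,
        map_zero, smul_zero, neg_zero]
  exact LinearMap.congr_fun this a

theorem lopShort_mul_letter (a : A) : C.lopShort (a * C.letter true) = 0 := by
  have : C.lopShort ∘ₗ LinearMap.mulRight K (C.letter true) = 0 := by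
    refine C.linearMap_ext true (fun i => ?_) (fun i b' j hj => ?_) (fun i => ?_)
    · have := C.lopShort_word i true (Nat.zero_le _)
      simp only [zero_add, C.word_one] at this
      simp [this]
    · simp only [LinearMap.comp_apply, LinearMap.mulRight_apply, mul_assoc, LinearMap.zero_apply]
      by_cases h : xor b' j.bodd = true
      · rw [C.word_mul_letter_of_eq h, mul_zero, map_zero]
      · rw [C.word_mul_letter_of_ne h]
        rcases hj.lt_or_eq with hj | rfl
        · rw [C.lopShort_word i b' hj, if_neg]
          rw [xor_succ_of_ne h]; simp
        · exact C.lopShort_top _ _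
    · simp only [LinearMap.comp_apply, LinearMap.mulRight_apply, mul_assoc, LinearMap.zero_apply,
        C.word_top_mul_letter, mul_zero, map_zero]
  exact LinearMap.congr_fun this a

theorem lopShort_mul_cow (a : A) : C.lopShort a * C.cow false = C.lop false a * C.cow false := by
  have : LinearMap.mulRight K (C.cow false) ∘ₗ C.lopShort =
      LinearMap.mulRight K (C.cow false) ∘ₗ C.lop false := by
    refine C.linearMap_ext true (fun i => ?_) (fun i b' j hj => ?_) (fun i => ?_)
    · simp [lopShort_e, lop_e]
    · simp [C.lopShort_word _ _ hj, C.lop_word _ _ _ hj]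
    · have := C.lop_top false i
      rw [Bool.not_false] at this
      simp [lopShort_top, this, mul_assoc, C.cow_mul_cow]
  exact LinearMap.congr_fun this a

theorem cow_false : C.cow false = C.word true (4 * T + 1) := rfl

theorem cow_true : C.cow true = C.word false (4 * T + 1) := rfl

/-- Used on the diagonal, where both incoming components multiply by a letter. Words of positive
length are recovered from their last letter; the top word could be counted for either letter, which
is why the removal of `y` is truncated there. Vertices have no last letter and are recovered by
multiplying with the long word. -/
theorem eq_lop_add_lopShort_add (a : A) :
    C.lop true a * C.letter true + C.lopShort a * C.letter false + C.cowCoeff (a * C.cow false) =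
      a := by
  have : LinearMap.mulRight K (C.letter true) ∘ₗ C.lop true +
      LinearMap.mulRight K (C.letter false) ∘ₗ C.lopShort +
      C.cowCoeff ∘ₗ LinearMap.mulRight K (C.cow false) = LinearMap.id := by
    refine C.linearMap_ext false (fun i => ?_) (fun i b' j hj => ?_) (fun i => ?_)
    · simp [lop_e, lopShort_e, cow_false, C.cowCoeff_word i true le_rfl]
    · simp only [LinearMap.add_apply, LinearMap.comp_apply, LinearMap.mulRight_apply,
        LinearMap.id_apply, C.lop_word _ i b' hj, C.lopShort_word i b' hj, mul_assoc]
      have h0 : C.cowCoeff (C.e i * (C.word b' (j + 1) * C.cow false)) = 0 := by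
        rcases Nat.eq_zero_or_pos j with rfl | hj'
        · by_cases h : xor b' (0 : ℕ).bodd = false
          · rw [C.word_mul_cow_of_eq h, zero_add, cowCoeff_top]
          · rw [C.word_mul_cow_of_ne h, mul_zero, map_zero]
        · rw [C.word_mul_cow_eq_zero hj', mul_zero, map_zero]
      rw [h0, add_zero]
      cases h : xor b' j.bodd
      · have := C.word_succ' b' j
        rw [h] at this
        simp [mul_assoc, ← this]
      · have := C.word_succ' b' j
        rw [h] at this
        simp [mul_assoc, ← this]
    · have h := C.lop_top true i
      rw [Bool.not_true] at h
      simp only [LinearMap.add_apply, LinearMap.comp_apply, LinearMap.mulRight_apply,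
        LinearMap.id_apply, h, mul_assoc, lopShort_top, C.word_top_mul_cow, C.cow_mul_letter,
        mul_zero, map_zero, add_zero, Bool.not_true]
  exact LinearMap.congr_fun this a

theorem cowCoeff_mul_letter (a : A) : C.cowCoeff (a * C.letter false) = 0 := by
  have : C.cowCoeff ∘ₗ LinearMap.mulRight K (C.letter false) = 0 := by
    refine C.linearMap_ext true (fun i => ?_) (fun i b' j hj => ?_) (fun i => ?_)
    · have := C.cowCoeff_word i false (Nat.zero_le _)
      simp only [zero_add, C.word_one] at this
      simp [this]
    · simp only [LinearMap.comp_apply, LinearMap.mulRight_apply, mul_assoc, LinearMap.zero_apply]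
      by_cases h : xor b' j.bodd = false
      · rw [C.word_mul_letter_of_eq h, mul_zero, map_zero]
      · rw [C.word_mul_letter_of_ne h]
        rcases hj.lt_or_eq with hj | rfl
        · rw [C.cowCoeff_word i b' hj, if_neg]
          rintro ⟨rfl, h2⟩
          have h3 := xor_succ_of_ne h
          rw [show j + 1 = 4 * T from h2, CoverRel.bodd_four_mul] at h3
          simp at h3
        · exact C.cowCoeff_top _ _
    · simp only [LinearMap.comp_apply, LinearMap.mulRight_apply, mul_assoc, LinearMap.zero_apply,
        C.word_top_mul_letter, mul_zero, map_zero]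
  exact LinearMap.congr_fun this a

/-- Used right next to the diagonal. A word ending in `y` is shortened and restored, any other is
prolonged by `y` and shortened. The one exception, `xy⋯x` of length `4T + 1`, becomes a top word, on
which the truncated removal vanishes, and is supplied by its coefficient instead. -/
theorem lopShort_add_lop_add (a : A) :
    C.lopShort (a * C.letter false) + C.lop false a * C.letter false +
      C.cowCoeff a * C.cow false = a := by
  have : C.lopShort ∘ₗ LinearMap.mulRight K (C.letter false) +
      LinearMap.mulRight K (C.letter false) ∘ₗ C.lop false +
      LinearMap.mulRight K (C.cow false) ∘ₗ C.cowCoeff = LinearMap.id := by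
    refine C.linearMap_ext true (fun i => ?_) (fun i b' j hj => ?_) (fun i => ?_)
    · have := C.lopShort_word i false (Nat.zero_le _)
      simp only [zero_add, C.word_one] at this
      simp [this, lop_e, cowCoeff_e]
    · simp only [LinearMap.add_apply, LinearMap.comp_apply, LinearMap.mulRight_apply,
        LinearMap.id_apply, C.lop_word _ i b' hj, C.cowCoeff_word i b' hj, mul_assoc]
      by_cases h : xor b' j.bodd = false
      · rw [C.word_mul_letter_of_eq h, if_pos h, if_neg, mul_zero, map_zero, zero_mul, zero_add,
          add_zero, mul_assoc, ← h, ← C.word_succ']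
        rintro ⟨rfl, rfl⟩
        rw [CoverRel.bodd_four_mul] at h
        simp at h
      · rw [C.word_mul_letter_of_ne h, if_neg h]
        rcases hj.lt_or_eq with hj | rfl
        · rw [C.lopShort_word i b' hj, if_pos (xor_succ_of_ne h), if_neg (by omega)]
          simp
        · obtain rfl : b' = true := by
            revert h; rw [CoverRel.bodd_four_mul]; cases b' <;> decide
          rw [lopShort_top]
          simp [cow_false]
    · have h := C.lop_top false i
      rw [Bool.not_false] at h
      simp only [LinearMap.add_apply, LinearMap.comp_apply, LinearMap.mulRight_apply,
        LinearMap.id_apply, h, mul_assoc, cowCoeff_top, C.word_top_mul_letter, C.cow_mul_letter,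
        mul_zero, map_zero, add_zero, zero_add, Bool.not_false]
  exact LinearMap.congr_fun this a

/-- Appending `y` yields a word that also ends in `x` only at top length, through the relation; the
word before it must then be `xy⋯x` of length `4T + 1`. -/
theorem lop_mul_letter_false (a : A) :
    C.lop true (a * C.letter false) = -(C.s⁻¹ • (C.cowCoeff a * C.cow true)) := by
  have : C.lop true ∘ₗ LinearMap.mulRight K (C.letter false) =
      -(C.s⁻¹ • (LinearMap.mulRight K (C.cow true) ∘ₗ C.cowCoeff)) := by
    refine C.linearMap_ext true (fun i => ?_) (fun i b' j hj => ?_) (fun i => ?_)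
    · have := C.lop_word true i false (Nat.zero_le _)
      simp only [zero_add, C.word_one] at this
      simp [this, cowCoeff_e]
    · simp only [LinearMap.neg_apply, LinearMap.smul_apply, LinearMap.comp_apply,
        LinearMap.mulRight_apply, C.cowCoeff_word i b' hj, mul_assoc]
      by_cases h : xor b' j.bodd = false
      · rw [C.word_mul_letter_of_eq h, if_neg, mul_zero, map_zero, zero_mul, smul_zero, neg_zero]
        rintro ⟨rfl, rfl⟩
        rw [CoverRel.bodd_four_mul] at h
        simp at h
      · rw [C.word_mul_letter_of_ne h]
        rcases hj.lt_or_eq with hj | rfl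
        · rw [C.lop_word true i b' hj, xor_succ_of_ne h, if_neg (by simp), if_neg (by omega)]
          simp
        · obtain rfl : b' = true := by
            revert h; rw [CoverRel.bodd_four_mul]; cases b' <;> decide
          have h := C.lop_top true i
          rw [Bool.not_true] at h
          rw [if_pos ⟨rfl, rfl⟩, C.word_true_top, mul_neg, mul_smul_comm, map_neg, map_smul, h]
    · simp only [LinearMap.neg_apply, LinearMap.smul_apply, LinearMap.comp_apply,
        LinearMap.mulRight_apply, mul_assoc, C.word_top_mul_letter, cowCoeff_top, mul_zero, map_zero,
        smul_zero, neg_zero]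
  exact LinearMap.congr_fun this a

end Cover

end

noncomputable section

/-! ### Exactness of the bimodule resolution in positive degrees -/

namespace Cover

variable {K : Type u} [Field K] {A : Type u} [Ring A] [Algebra K A] {T : ℕ} (C : Cover K A T)

open CoverRel (tm tm_mul tm_zero_left tm_zero_right tm_smul_left tm_smul_right)

/-- The extension of a linear map to the left factor of the enveloping algebra. -/
abbrev ext (f : A →ₗ[K] A) : A ⊗[K] Aᵐᵒᵖ →ₗ[K] A ⊗[K] Aᵐᵒᵖ := f.rTensor Aᵐᵒᵖ

theorem ext_tm (f : A →ₗ[K] A) (a v : A) : ext f (tm K a v) = tm K (f a) v := rfl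

theorem tm_induction {P : A ⊗[K] Aᵐᵒᵖ → Prop} (r : A ⊗[K] Aᵐᵒᵖ) (zero : P 0)
    (tmul : ∀ a v, P (tm K a v)) (add : ∀ r r', P r → P r' → P (r + r')) : P r :=
  TensorProduct.induction_on r zero (fun a v => tmul a v.unop) add

theorem ext_lop_mul_add (b : Bool) (r : A ⊗[K] Aᵐᵒᵖ) :
    ext (C.lop b) r * tm K (C.letter b) 1 + ext (C.lop b) (r * tm K (C.letter b) 1) = r := by
  induction r using tm_induction with
  | zero => simp
  | tmul a v =>
    simp only [ext_tm, tm_mul, one_mul]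
    rw [tm, tm, ← TensorProduct.add_tmul, C.lop_mul_add_lop_mul]
    rfl
  | add r r' h h' =>
    rw [map_add, add_mul, add_mul, map_add, add_add_add_comm, h, h']

theorem ext_lop_mul_cow (b : Bool) (r : A ⊗[K] Aᵐᵒᵖ) :
    ext (C.lop b) (r * tm K (C.cow b) 1) =
      -((C.par b)⁻¹ • (ext (C.lop b) r * tm K (C.cow b) 1)) := by
  induction r using tm_induction with
  | zero => simp
  | tmul a v =>
    simp only [ext_tm, tm_mul, one_mul]
    rw [C.lop_mul_cow, CoverRel.tm_neg_left, tm_smul_left]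
  | add r r' h h' => rw [add_mul, map_add, h, h', map_add, add_mul, smul_add, neg_add]

theorem ext_lopShort_mul_letter (r : A ⊗[K] Aᵐᵒᵖ) :
    ext C.lopShort (r * tm K (C.letter true) 1) = 0 := by
  induction r using tm_induction with
  | zero => simp
  | tmul a v => rw [tm_mul, ext_tm, C.lopShort_mul_letter, tm_zero_left]
  | add r r' h h' => rw [add_mul, map_add, h, h', add_zero]

theorem ext_lopShort_mul_cow (r : A ⊗[K] Aᵐᵒᵖ) :
    ext C.lopShort r * tm K (C.cow false) 1 = ext (C.lop false) r * tm K (C.cow false) 1 := by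
  induction r using tm_induction with
  | zero => simp
  | tmul a v => rw [ext_tm, ext_tm, tm_mul, tm_mul, C.lopShort_mul_cow]
  | add r r' h h' => rw [map_add, add_mul, h, h', map_add, add_mul]

theorem ext_eq_lop_add_lopShort_add (r : A ⊗[K] Aᵐᵒᵖ) :
    ext (C.lop true) r * tm K (C.letter true) 1 + ext C.lopShort r * tm K (C.letter false) 1 +
      ext C.cowCoeff (r * tm K (C.cow false) 1) = r := by
  induction r using tm_induction with
  | zero => simp
  | tmul a v =>
    simp only [ext_tm, tm_mul, one_mul]
    rw [tm, tm, tm, ← TensorProduct.add_tmul, ← TensorProduct.add_tmul, C.eq_lop_add_lopShort_add]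
    rfl
  | add r r' h h' =>
    conv_rhs => rw [← h, ← h']
    simp only [map_add, add_mul]
    abel

theorem ext_cowCoeff_mul_letter (r : A ⊗[K] Aᵐᵒᵖ) :
    ext C.cowCoeff (r * tm K (C.letter false) 1) = 0 := by
  induction r using tm_induction with
  | zero => simp
  | tmul a v => rw [tm_mul, ext_tm, C.cowCoeff_mul_letter, tm_zero_left]
  | add r r' h h' => rw [add_mul, map_add, h, h', add_zero]

theorem ext_lopShort_add_lop_add (r : A ⊗[K] Aᵐᵒᵖ) :
    ext C.lopShort (r * tm K (C.letter false) 1) + ext (C.lop false) r * tm K (C.letter false) 1 +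
      ext C.cowCoeff r * tm K (C.cow false) 1 = r := by
  induction r using tm_induction with
  | zero => simp
  | tmul a v =>
    simp only [ext_tm, tm_mul, one_mul]
    rw [tm, tm, tm, ← TensorProduct.add_tmul, ← TensorProduct.add_tmul, C.lopShort_add_lop_add]
    rfl
  | add r r' h h' =>
    conv_rhs => rw [← h, ← h']
    simp only [map_add, add_mul]
    abel

theorem ext_lop_mul_letter_false (r : A ⊗[K] Aᵐᵒᵖ) :
    ext (C.lop true) (r * tm K (C.letter false) 1) =
      -(C.s⁻¹ • (ext C.cowCoeff r * tm K (C.cow true) 1)) := by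
  induction r using tm_induction with
  | zero => simp
  | tmul a v =>
    simp only [ext_tm, tm_mul, one_mul]
    rw [C.lop_mul_letter_false, CoverRel.tm_neg_left, tm_smul_left]
  | add r r' h h' => rw [add_mul, map_add, h, h', map_add, add_mul, smul_add, neg_add]

/-- The part of the differential `(i + 1, j) → (i, j)` that only multiplies from the left. -/
def dl₁ (i j : ℕ) : A ⊗[K] Aᵐᵒᵖ :=
  if j ≤ i then tm K (C.letter true) 1 else C.s ^ (j - i) • tm K (C.cow false) 1

/-- The part of the differential `(i, j + 1) → (i, j)` that only multiplies from the left. -/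
def dl₂ (i j : ℕ) : A ⊗[K] Aᵐᵒᵖ :=
  if i ≤ j then tm K (C.letter false) 1 else C.s⁻¹ ^ (i - j - 1) • tm K (C.cow true) 1

/-- The left part of the differential. -/
def diffL (ρ : ℕ → ℕ → A ⊗[K] Aᵐᵒᵖ) (i j : ℕ) : A ⊗[K] Aᵐᵒᵖ :=
  ρ (i + 1) j * C.dl₁ i j + ρ i (j + 1) * C.dl₂ i j

/-- The contraction of the left part of the differential. -/
def htpy (ρ : ℕ → ℕ → A ⊗[K] Aᵐᵒᵖ) (i j : ℕ) : A ⊗[K] Aᵐᵒᵖ :=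
  if j < i then ext (C.lop true) (ρ (i - 1) j)
  else if i = j then C.s⁻¹ • ext C.cowCoeff (ρ (i - 1) i)
  else if j = i + 1 then ext C.lopShort (ρ i i)
  else ext (C.lop false) (ρ i (j - 1))

/-- Away from the diagonal, removing the last letter contracts the letter component and skew
commutes with the long-word component. On the diagonal and in the bidegrees `(i, i + 1)` the special
decompositions of `A` take over. The bidegree `(0, 0)` is left out since it carries the homology of
the complex. -/
theorem diffL_htpy_add (ρ : ℕ → ℕ → A ⊗[K] Aᵐᵒᵖ) (i j : ℕ) (hij : ¬(i = 0 ∧ j = 0)) :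
    C.diffL (C.htpy ρ) i j + C.htpy (C.diffL ρ) i j = ρ i j := by
  have hs := C.s_ne
  rcases lt_trichotomy i j with h | rfl | h
  · obtain ⟨a, rfl⟩ := Nat.exists_eq_add_of_lt h
    rcases a with _ | a
    · simp only [add_zero]
      have h1 : C.htpy ρ (i + 1) (i + 1) = C.s⁻¹ • ext C.cowCoeff (ρ i (i + 1)) := by
        rw [htpy, if_neg (by omega), if_pos rfl, Nat.add_sub_cancel]
      have h2 : C.htpy ρ i (i + 1 + 1) = ext (C.lop false) (ρ i (i + 1)) := by
        rw [htpy, if_neg (by omega), if_neg (by omega), if_neg (by omega), Nat.add_sub_cancel]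
      have h3 : C.htpy (C.diffL ρ) i (i + 1) = ext C.lopShort (C.diffL ρ i i) := by
        rw [htpy, if_neg (by omega), if_neg (by omega), if_pos rfl]
      have h4 : C.dl₁ i (i + 1) = C.s • tm K (C.cow false) 1 := by
        rw [dl₁, if_neg (by omega), Nat.add_sub_cancel_left, pow_one]
      have h5 : C.dl₂ i (i + 1) = tm K (C.letter false) 1 := by rw [dl₂, if_pos (by omega)]
      have h6 : C.dl₁ i i = tm K (C.letter true) 1 := by rw [dl₁, if_pos le_rfl]
      have h7 : C.dl₂ i i = tm K (C.letter false) 1 := by rw [dl₂, if_pos le_rfl]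
      rw [diffL, h1, h2, h3, h4, h5, diffL, h6, h7, map_add, ext_lopShort_mul_letter, zero_add,
        smul_mul_assoc, mul_smul_comm, smul_smul, inv_mul_cancel₀ hs, one_smul]
      conv_rhs => rw [← C.ext_lopShort_add_lop_add (ρ i (i + 1))]
      abel
    · have h1 : C.htpy ρ (i + 1) (i + (a + 1) + 1) * tm K (C.cow false) 1 =
          ext (C.lop false) (ρ (i + 1) (i + a + 1)) * tm K (C.cow false) 1 := by
        rcases a with _ | a
        · rw [htpy, if_neg (by omega), if_neg (by omega), if_pos (by omega),
            ext_lopShort_mul_cow]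
        · rw [htpy, if_neg (by omega), if_neg (by omega), if_neg (by omega)]
          rfl
      have h2 : C.htpy ρ i (i + (a + 1) + 1 + 1) = ext (C.lop false) (ρ i (i + (a + 1) + 1)) := by
        rw [htpy, if_neg (by omega), if_neg (by omega), if_neg (by omega), Nat.add_sub_cancel]
      have h3 : C.htpy (C.diffL ρ) i (i + (a + 1) + 1) =
          ext (C.lop false) (C.diffL ρ i (i + a + 1)) := by
        rw [htpy, if_neg (by omega), if_neg (by omega), if_neg (by omega)]
        rfl
      have h4 : C.dl₁ i (i + (a + 1) + 1) = C.s ^ (a + 2) • tm K (C.cow false) 1 := by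
        rw [dl₁, if_neg (by omega), show i + (a + 1) + 1 - i = a + 2 by omega]
      have h5 : C.dl₂ i (i + (a + 1) + 1) = tm K (C.letter false) 1 := by rw [dl₂, if_pos (by omega)]
      have h6 : C.dl₁ i (i + a + 1) = C.s ^ (a + 1) • tm K (C.cow false) 1 := by
        rw [dl₁, if_neg (by omega), show i + a + 1 - i = a + 1 by omega]
      have h7 : C.dl₂ i (i + a + 1) = tm K (C.letter false) 1 := by rw [dl₂, if_pos (by omega)]
      rw [diffL, h4, mul_smul_comm, h1, h2, h3, h5, diffL, h6, h7, map_add, mul_smul_comm,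
        map_smul, ext_lop_mul_cow]
      conv_rhs => rw [← C.ext_lop_mul_add false (ρ i (i + (a + 1) + 1))]
      simp only [CoverRel.par, Bool.false_eq_true, if_false, inv_inv, smul_neg, smul_smul, ← pow_succ]
      rw [show i + a + 1 + 1 = i + (a + 1) + 1 by ring]
      abel
  · obtain ⟨c, rfl⟩ : ∃ c, i = c + 1 := Nat.exists_eq_add_one_of_ne_zero (by omega)
    have h1 : C.htpy ρ (c + 1 + 1) (c + 1) = ext (C.lop true) (ρ (c + 1) (c + 1)) := by
      rw [htpy, if_pos (by omega), Nat.add_sub_cancel]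
    have h2 : C.htpy ρ (c + 1) (c + 1 + 1) = ext C.lopShort (ρ (c + 1) (c + 1)) := by
      rw [htpy, if_neg (by omega), if_neg (by omega), if_pos rfl]
    have h3 : C.htpy (C.diffL ρ) (c + 1) (c + 1) =
        C.s⁻¹ • ext C.cowCoeff (C.diffL ρ c (c + 1)) := by
      rw [htpy, if_neg (by omega), if_pos rfl, Nat.add_sub_cancel]
    have h4 : C.dl₁ (c + 1) (c + 1) = tm K (C.letter true) 1 := by rw [dl₁, if_pos le_rfl]
    have h5 : C.dl₂ (c + 1) (c + 1) = tm K (C.letter false) 1 := by rw [dl₂, if_pos le_rfl]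
    have h6 : C.dl₁ c (c + 1) = C.s • tm K (C.cow false) 1 := by
      rw [dl₁, if_neg (by omega), Nat.add_sub_cancel_left, pow_one]
    have h7 : C.dl₂ c (c + 1) = tm K (C.letter false) 1 := by rw [dl₂, if_pos (by omega)]
    rw [diffL, h1, h2, h3, h4, h5, diffL, h6, h7, map_add, ext_cowCoeff_mul_letter, add_zero,
      mul_smul_comm, map_smul, smul_smul, inv_mul_cancel₀ hs, one_smul,
      C.ext_eq_lop_add_lopShort_add]
  · obtain ⟨a, rfl⟩ := Nat.exists_eq_add_of_lt h
    have h1 : C.htpy ρ (j + a + 1 + 1) j = ext (C.lop true) (ρ (j + a + 1) j) := by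
      rw [htpy, if_pos (by omega), Nat.add_sub_cancel]
    have h3 : C.htpy (C.diffL ρ) (j + a + 1) j = ext (C.lop true) (C.diffL ρ (j + a) j) := by
      rw [htpy, if_pos (by omega), Nat.add_sub_cancel]
    have h4 : C.dl₁ (j + a + 1) j = tm K (C.letter true) 1 := by rw [dl₁, if_pos (by omega)]
    have h5 : C.dl₂ (j + a + 1) j = C.s⁻¹ ^ a • tm K (C.cow true) 1 := by
      rw [dl₂, if_neg (by omega), show j + a + 1 - j - 1 = a by omega]
    have h6 : C.dl₁ (j + a) j = tm K (C.letter true) 1 := by rw [dl₁, if_pos (by omega)]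
    rw [diffL, h1, h3, h4, h5, diffL, h6, map_add, mul_smul_comm]
    conv_rhs => rw [← C.ext_lop_mul_add true (ρ (j + a + 1) j)]
    -- The letter component is already contracted; what remains is that the contraction and the
    -- long-word component cancel.
    suffices hz : C.s⁻¹ ^ a • (C.htpy ρ (j + a + 1) (j + 1) * tm K (C.cow true) 1) +
        ext (C.lop true) (ρ (j + a) (j + 1) * C.dl₂ (j + a) j) = 0 by
      rw [eq_neg_of_add_eq_zero_left hz]
      abel
    rcases a with _ | a
    · have h2 : C.htpy ρ (j + 0 + 1) (j + 1) = C.s⁻¹ • ext C.cowCoeff (ρ j (j + 1)) := by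
        rw [htpy, if_neg (by omega), if_pos (by omega), Nat.add_sub_cancel]
        rfl
      have h7 : C.dl₂ (j + 0) j = tm K (C.letter false) 1 := by rw [dl₂, if_pos (by omega)]
      rw [h2, h7, ext_lop_mul_letter_false, pow_zero, one_smul, smul_mul_assoc, add_zero]
      simp
    · have h2 : C.htpy ρ (j + (a + 1) + 1) (j + 1) = ext (C.lop true) (ρ (j + (a + 1)) (j + 1)) := by
        rw [htpy, if_pos (by omega), Nat.add_sub_cancel]
      have h7 : C.dl₂ (j + (a + 1)) j = C.s⁻¹ ^ a • tm K (C.cow true) 1 := by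
        rw [dl₂, if_neg (by omega), show j + (a + 1) - j - 1 = a by omega]
      rw [h2, h7, mul_smul_comm, map_smul, ext_lop_mul_cow]
      simp only [CoverRel.par, if_true, smul_neg, smul_smul, ← pow_succ]
      simp

end Cover

end

/-! ### From the left part to the full differential: the length filtration of the right factor. -/

noncomputable section

namespace Cover

variable {K : Type u} [Field K] {A : Type u} [Ring A] [Algebra K A] {T : ℕ} (C : Cover K A T)

open CoverRel (tm tm_mul tm_zero_left tm_zero_right tm_smul_left tm_smul_right)

theorem letter_mul_word_cases (b b' : Bool) (j : ℕ) :
    C.letter b * C.word b' j = 0 ∨ C.letter b * C.word b' j = C.word b (j + 1) := by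
  rcases j with _ | j
  · right; simp [C.word_one]
  · by_cases h : b = b'
    · left; rw [h, C.letter_mul_word_self]
    · right; rw [C.word_succ b (j + 1), Bool.eq_not_of_ne h, Bool.not_not]

theorem word_mul_word_cases (b b' : Bool) (i j : ℕ) :
    C.word b i * C.word b' j = 0 ∨ ∃ c, C.word b i * C.word b' j = C.word c (i + j) := by
  induction i generalizing b with
  | zero => exact Or.inr ⟨b', by simp⟩
  | succ i ih =>
    rw [C.word_succ, mul_assoc]
    rcases ih (!b) with h | ⟨c, h⟩
    · left; rw [h, mul_zero]
    · rw [h]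
      rcases C.letter_mul_word_cases b c (i + j) with h' | h'
      · exact Or.inl h'
      · exact Or.inr ⟨b, by rw [h', add_right_comm]⟩

/-- The filtration of the enveloping algebra by the radical powers of the right factor. -/
def filt (k : ℕ) : Submodule K (A ⊗[K] Aᵐᵒᵖ) :=
  Submodule.span K {r | ∃ a b j c, k ≤ j ∧ r = tm K a (C.word b j * c)}

theorem tm_mem_filt (a : A) (b : Bool) {k j : ℕ} (h : k ≤ j) (c : A) :
    tm K a (C.word b j * c) ∈ C.filt k :=
  Submodule.subset_span ⟨a, b, j, c, h, rfl⟩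

theorem filt_zero (r : A ⊗[K] Aᵐᵒᵖ) : r ∈ C.filt 0 := by
  induction r using tm_induction with
  | zero => exact zero_mem _
  | tmul a v => simpa using C.tm_mem_filt a true (le_refl 0) v
  | add r r' h h' => exact add_mem h h'

theorem eq_zero_of_mem_filt {r : A ⊗[K] Aᵐᵒᵖ} (h : r ∈ C.filt (4 * T + 3)) : r = 0 := by
  have : C.filt (4 * T + 3) ≤ ⊥ := by
    refine Submodule.span_le.2 ?_
    rintro _ ⟨a, b, j, c, hj, rfl⟩
    rw [C.word_eq_zero b hj, zero_mul, tm_zero_right]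
    exact zero_mem _
  simpa using this h

theorem ext_mem_filt (f : A →ₗ[K] A) {k : ℕ} {r : A ⊗[K] Aᵐᵒᵖ} (h : r ∈ C.filt k) :
    ext f r ∈ C.filt k := by
  have : C.filt k ≤ (C.filt k).comap (ext f) := by
    refine Submodule.span_le.2 ?_
    rintro _ ⟨a, b, j, c, hj, rfl⟩
    exact C.tm_mem_filt _ b hj c
  exact this h

/-- The elements that raise the filtration by right multiplication. -/
def raising : Submodule K (A ⊗[K] Aᵐᵒᵖ) where
  carrier := {t | ∀ k, ∀ r ∈ C.filt k, r * t ∈ C.filt (k + 1)}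
  zero_mem' := fun k r _ => by rw [mul_zero]; exact zero_mem _
  add_mem' := fun h h' k r hr => by rw [mul_add]; exact add_mem (h k r hr) (h' k r hr)
  smul_mem' := fun c t h k r hr => by
    rw [mul_smul_comm]; exact Submodule.smul_mem _ _ (h k r hr)

/-- In the enveloping algebra right multiplication puts the new word in front of the old right
factor; the product of two words is zero or a word of the total length. -/
theorem tm_mem_raising (a : A) (b : Bool) {m : ℕ} (hm : 1 ≤ m) :
    tm K a (C.word b m) ∈ C.raising := by
  intro k r hr
  have : C.filt k ≤ (C.filt (k + 1)).comap (LinearMap.mulRight K (tm K a (C.word b m))) := by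
    refine Submodule.span_le.2 ?_
    rintro _ ⟨a', b', j, c, hj, rfl⟩
    simp only [SetLike.mem_coe, Submodule.mem_comap, LinearMap.mulRight_apply, tm_mul,
      ← mul_assoc]
    rcases C.word_mul_word_cases b b' m j with h | ⟨d, h⟩
    · rw [h, zero_mul, tm_zero_right]
      exact zero_mem _
    · rw [h]
      exact C.tm_mem_filt _ _ (by omega) _
  exact this hr

theorem tm_one_letter_mem_raising (a : A) (b : Bool) : tm K a (C.letter b) ∈ C.raising := by
  rw [← C.word_one]
  exact C.tm_mem_raising a b le_rfl

/-- The left part of a component of the differential. -/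
def dgenL (b : Bool) (i j : ℕ) : A ⊗[K] Aᵐᵒᵖ :=
  if j ≤ i then tm K (C.letter b) 1
  else C.kap (!b) • (C.par (!b))⁻¹ ^ (j - i - 1) • tm K (C.cow (!b)) 1

/-- Exactly one term of the derivative, the one at `(2T, 0)` in its second half, has a trivial right
factor. All others raise the filtration. -/
theorem exists_fox_eq (b : Bool) (c : ℕ) :
    ∃ t ∈ C.raising, C.fox b c = C.kap b • tm K (C.cow b) 1 + t := by
  have hm : ((2 * T, 0) : ℕ × ℕ) ∈ Finset.HasAntidiagonal.antidiagonal (2 * T) := by simp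
  have hc : C.cow b = C.word (!b) (2 * (2 * T) + 1) := by rw [CoverRel.cow]; congr 1; ring
  refine ⟨_, ?_, by rw [CoverRel.fox, Finset.sum_add_distrib, add_comm (Finset.sum _ _),
    ← Finset.add_sum_erase _ _ hm, add_assoc, smul_add, mul_zero, C.word_zero, ← hc]⟩
  refine Submodule.smul_mem _ _ (add_mem ?_ (Submodule.sum_mem _ fun k _ =>
    Submodule.smul_mem _ _ (C.tm_mem_raising _ _ (by omega))))
  refine Submodule.sum_mem _ fun k hk => C.tm_mem_raising _ _ ?_
  obtain ⟨i, j⟩ := k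
  simp only [Finset.mem_erase, ne_eq, Prod.mk.injEq, Finset.HasAntidiagonal.mem_antidiagonal] at hk
  simp only
  omega

theorem exists_dgen_eq (b : Bool) (i j : ℕ) :
    ∃ t ∈ C.raising, C.dgen b i j = C.dgenL b i j + t := by
  rw [CoverRel.dgen, dgenL]
  split_ifs with h h'
  · exact ⟨_, Submodule.smul_mem _ _ (C.tm_one_letter_mem_raising _ _), rfl⟩
  · rw [show j - i - 1 = 0 by omega, pow_zero, one_smul]
    exact C.exists_fox_eq _ _
  · exact ⟨_, Submodule.smul_mem _ _ (Submodule.smul_mem _ _ (C.tm_mem_raising _ _ (by omega))),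
      smul_add _ _ _⟩

theorem dgenL_true (i j : ℕ) : C.dgenL true i j = C.dl₁ i j := by
  rw [dl₁, dgenL]
  split_ifs with h
  · rfl
  · obtain ⟨a, rfl⟩ := Nat.exists_eq_add_of_lt (not_le.1 h)
    rw [show i + a + 1 - i - 1 = a by omega, show i + a + 1 - i = a + 1 by omega, smul_smul,
      pow_succ']
    simp [CoverRel.kap, CoverRel.par]

theorem dgenL_false (i j : ℕ) : C.dgenL false j i = C.dl₂ i j := by
  rw [dl₂, dgenL]
  split_ifs with h
  · rfl
  · simp [CoverRel.kap, CoverRel.par]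

theorem exists_diff_eq_diffL_add {ρ : ℕ → ℕ → A ⊗[K] Aᵐᵒᵖ} {k : ℕ} (h : ∀ i j, ρ i j ∈ C.filt k)
    (i j : ℕ) : ∃ t ∈ C.filt (k + 1), C.diff ρ i j = C.diffL ρ i j + t := by
  obtain ⟨t₁, h₁, e₁⟩ := C.exists_dgen_eq true i j
  obtain ⟨t₂, h₂, e₂⟩ := C.exists_dgen_eq false j i
  refine ⟨_, add_mem (h₁ k _ (h (i + 1) j)) (h₂ k _ (h i (j + 1))), ?_⟩
  rw [CoverRel.diff, diffL, CoverRel.d₁, CoverRel.d₂, e₁, e₂, mul_add, mul_add, dgenL_true,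
    dgenL_false, add_add_add_comm]

theorem htpy_mem {ρ : ℕ → ℕ → A ⊗[K] Aᵐᵒᵖ} {k : ℕ} (h : ∀ i j, ρ i j ∈ C.filt k)
    (i j : ℕ) : C.htpy ρ i j ∈ C.filt k := by
  rw [htpy]
  split_ifs <;> first
    | exact C.ext_mem_filt _ (h _ _)
    | exact Submodule.smul_mem _ _ (C.ext_mem_filt _ (h _ _))

/-- Successive approximation: subtracting the boundary of the left contraction pushes a cycle one
step further down the filtration, which is zero from step `4T + 3` on. -/
theorem exists_diff_eq_of_mem (m k : ℕ) (hm : k + m = 4 * T + 3)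
    {ρ : ℕ → ℕ → A ⊗[K] Aᵐᵒᵖ} (h : ∀ i j, ρ i j ∈ C.filt k) (hd : ∀ i j, C.diff ρ i j = 0) :
    ∃ ρ', ∀ i j, ¬(i = 0 ∧ j = 0) → C.diff ρ' i j = ρ i j := by
  induction m generalizing k ρ with
  | zero =>
    obtain rfl : k = 4 * T + 3 := by omega
    exact ⟨fun _ _ => 0, fun i j _ => by
      rw [C.eq_zero_of_mem_filt (h i j), CoverRel.diff, zero_mul, zero_mul, add_zero]⟩
  | succ m ih =>
    set η := C.htpy ρ with hη
    -- The contraction says nothing about the entry at `(0, 0)`. It may be set to zero because the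
    -- differential never reads it.
    let ρ₂ : ℕ → ℕ → A ⊗[K] Aᵐᵒᵖ := fun i j => if i = 0 ∧ j = 0 then 0 else ρ i j - C.diff η i j
    have h2 : ∀ i j, ρ₂ i j ∈ C.filt (k + 1) := by
      intro i j
      simp only [ρ₂]
      split_ifs with hij
      · exact zero_mem _
      · obtain ⟨t, ht, e2⟩ := C.exists_diff_eq_diffL_add (C.htpy_mem h) i j
        -- For a cycle of the full differential the left part equals minus the correction, which
        -- lies one step deeper.
        have e3 : ∀ i j, C.diffL ρ i j ∈ C.filt (k + 1) := fun i j => by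
          obtain ⟨t, ht, e⟩ := C.exists_diff_eq_diffL_add h i j
          rw [hd] at e
          rw [eq_neg_of_add_eq_zero_left e.symm]
          exact neg_mem ht
        rw [e2, ← C.diffL_htpy_add ρ i j hij, add_sub_add_left_eq_sub]
        exact sub_mem (C.htpy_mem e3 i j) ht
    have hd2 : ∀ i j, C.diff ρ₂ i j = 0 := by
      intro i j
      have e1 := C.diff_diff η i j
      have e2 := hd i j
      simp only [CoverRel.diff, ρ₂] at e1 e2 ⊢
      rw [if_neg (by omega), if_neg (by omega)]
      simp only [sub_mul]
      rw [sub_add_sub_comm, e2, e1, sub_zero]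
    obtain ⟨ρ', h'⟩ := ih (k + 1) (by omega) h2 hd2
    refine ⟨fun i j => ρ' i j + η i j, fun i j hij => ?_⟩
    have e := h' i j hij
    simp only [ρ₂, if_neg hij] at e
    have : C.diff (fun i j => ρ' i j + η i j) i j = C.diff ρ' i j + C.diff η i j := by
      simp only [CoverRel.diff, add_mul, add_add_add_comm]
    rw [this, e, sub_add_cancel]

/-- The bimodule complex is exact in positive degrees. -/
theorem exists_diff_eq {ρ : ℕ → ℕ → A ⊗[K] Aᵐᵒᵖ} (hd : ∀ i j, C.diff ρ i j = 0) :
    ∃ ρ', ∀ i j, ¬(i = 0 ∧ j = 0) → C.diff ρ' i j = ρ i j :=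
  C.exists_diff_eq_of_mem (4 * T + 3) 0 (by omega) (fun _ _ => C.filt_zero _) hd

end Cover

end

noncomputable section

/-! ### The projective bimodule resolution -/

namespace Cover

variable {K : Type u} [Field K] {A : Type u} [Ring A] [Algebra K A] {T : ℕ} (C : Cover K A T)

open CoverRel (tm tm_mul tm_zero_left tm_zero_right tm_smul_left tm_smul_right)

attribute [local instance] instModuleTensorProductMop

theorem tm_smul (a v f : A) : tm K a v • f = a * f * v := by
  rw [tm, TensorProduct.Algebra.smul_def, op_smul_eq_mul, smul_eq_mul, mul_assoc]

theorem zero_env_smul (f : A) : (0 : A ⊗[K] Aᵐᵒᵖ) • f = 0 := by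
  have h : (0 : A ⊗[K] Aᵐᵒᵖ) = tm K 0 0 := (tm_zero_left 0).symm
  rw [h, tm_smul, zero_mul, zero_mul]

theorem isScalarTower_env : IsScalarTower K (A ⊗[K] Aᵐᵒᵖ) A where
  smul_assoc c r f := by
    induction r using tm_induction with
    | zero => rw [smul_zero, zero_env_smul, smul_zero]
    | tmul a v => rw [← tm_smul_left, tm_smul, tm_smul, smul_mul_assoc, smul_mul_assoc]
    | add r r' h h' => rw [smul_add, add_smul, h, h', add_smul, smul_add]

attribute [local instance] isScalarTower_env

/-- The idempotent of the enveloping algebra that cuts out the bimodule `⨁ A e_i ⊗ e_(i+n) A`. -/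
def omega (n : ZMod 4) : A ⊗[K] Aᵐᵒᵖ := ∑ i, tm K (C.e i) (C.e (i + n))

theorem omega_mul_tm_word (n : ZMod 4) (b b' : Bool) (j k : ℕ) :
    C.omega (n + j + k) * tm K (C.word b j) (C.word b' k) =
      tm K (C.word b j) (C.word b' k) * C.omega n := by
  rw [omega, omega, Finset.sum_mul, Finset.mul_sum]
  refine Fintype.sum_equiv (Equiv.addRight (j : ZMod 4)) _ _ fun i => ?_
  rw [tm_mul, tm_mul, Equiv.coe_addRight, C.e_word, C.e_word]
  congr 3
  ring

theorem omega_mul_omega (n : ZMod 4) : C.omega n * C.omega n = C.omega n := by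
  rw [omega, Finset.sum_mul]
  refine Finset.sum_congr rfl fun i _ => ?_
  rw [Finset.mul_sum, Finset.sum_eq_single i]
  · rw [tm_mul, C.e_mul, C.e_mul, if_pos rfl, if_pos rfl]
  · intro j _ hj
    rw [tm_mul, C.e_mul, if_neg hj.symm, tm_zero_left]
  · simp

/-- The elements that intertwine the idempotents of consecutive degrees. -/
def homogeneous : Submodule K (A ⊗[K] Aᵐᵒᵖ) where
  carrier := {t | ∀ n, C.omega (n + 1) * t = t * C.omega n}
  zero_mem' := fun n => by rw [mul_zero, zero_mul]
  add_mem' := fun h h' n => by rw [mul_add, add_mul, h n, h' n]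
  smul_mem' := fun c t h n => by rw [mul_smul_comm, smul_mul_assoc, h n]

/-- All components of the differential have total length `1` or `4T + 1`. Modulo the number of
vertices both are `1`, so the three kinds of component are compatible with the same idempotents. -/
theorem tm_word_mem_homogeneous (b b' : Bool) {j k : ℕ} (h : ∃ m, j + k = 4 * m + 1) :
    tm K (C.word b j) (C.word b' k) ∈ C.homogeneous := by
  intro n
  obtain ⟨m, hm⟩ := h
  rw [← C.omega_mul_tm_word]
  congr 2
  have : ((j + k : ℕ) : ZMod 4) = ((4 * m + 1 : ℕ) : ZMod 4) := by rw [hm]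
  push_cast at this
  rw [add_assoc, this, show (4 : ZMod 4) = 0 from rfl, zero_mul, zero_add]

theorem lin_mem_homogeneous (b : Bool) (a c : ℕ) : C.lin b a c ∈ C.homogeneous := by
  have h1 := C.tm_word_mem_homogeneous b b (j := 1) (k := 0) ⟨0, rfl⟩
  have h2 := C.tm_word_mem_homogeneous b b (j := 0) (k := 1) ⟨0, rfl⟩
  rw [C.word_one, C.word_zero] at h1 h2
  exact add_mem h1 (Submodule.smul_mem _ _ h2)

theorem hvy_mem_homogeneous (b : Bool) (a c : ℕ) : C.hvy b a c ∈ C.homogeneous := by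
  have h1 := C.tm_word_mem_homogeneous (!b) (!b) (j := 4 * T + 1) (k := 0) ⟨T, rfl⟩
  have h2 := C.tm_word_mem_homogeneous (!b) (!b) (j := 0) (k := 4 * T + 1) ⟨T, by ring⟩
  rw [C.word_zero] at h1 h2
  exact Submodule.smul_mem _ _ (add_mem (Submodule.smul_mem _ _ h1) (Submodule.smul_mem _ _ h2))

theorem fox_mem_homogeneous (b : Bool) (c : ℕ) : C.fox b c ∈ C.homogeneous := by
  refine Submodule.smul_mem _ _ (Submodule.sum_mem _ fun k hk => ?_)
  rw [Finset.HasAntidiagonal.mem_antidiagonal] at hk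
  exact add_mem (Submodule.smul_mem _ _ (C.tm_word_mem_homogeneous _ _ ⟨T, by omega⟩))
    (C.tm_word_mem_homogeneous _ _ ⟨T, by omega⟩)

theorem dgen_mem_homogeneous (b : Bool) (i j : ℕ) : C.dgen b i j ∈ C.homogeneous := by
  rw [CoverRel.dgen]
  split_ifs
  · exact C.lin_mem_homogeneous _ _ _
  · exact C.fox_mem_homogeneous _ _
  · exact C.hvy_mem_homogeneous _ _ _

/-- The terms of the bimodule resolution. -/
def res (n : ℕ) : Submodule (A ⊗[K] Aᵐᵒᵖ) (ℕ → ℕ → A ⊗[K] Aᵐᵒᵖ) where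
  carrier := {ρ | (∀ i j, i + j ≠ n → ρ i j = 0) ∧ ∀ i j, ρ i j * C.omega n = ρ i j}
  zero_mem' := ⟨fun _ _ _ => rfl, fun _ _ => zero_mul _⟩
  add_mem' := fun {ρ ρ'} h h' => ⟨fun i j hij => by
    rw [Pi.add_apply, Pi.add_apply, h.1 i j hij, h'.1 i j hij, add_zero], fun i j => by
    rw [Pi.add_apply, Pi.add_apply, add_mul, h.2, h'.2]⟩
  smul_mem' := fun c ρ h => ⟨fun i j hij => by
    rw [Pi.smul_apply, Pi.smul_apply, h.1 i j hij, smul_eq_mul, mul_zero], fun i j => by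
    rw [Pi.smul_apply, Pi.smul_apply, smul_mul_assoc, h.2]⟩

/-- Cutting a family down to the term of degree `n`. -/
def cut (n : ℕ) : (ℕ → ℕ → A ⊗[K] Aᵐᵒᵖ) →ₗ[A ⊗[K] Aᵐᵒᵖ] C.res n where
  toFun ρ := ⟨fun i j => if i + j = n then ρ i j * C.omega n else 0, fun i j h => if_neg h,
    fun i j => by
      beta_reduce
      split_ifs
      · rw [mul_assoc, omega_mul_omega]
      · rw [zero_mul]⟩
  map_add' ρ ρ' := Subtype.ext <| by
    funext i j
    change (if i + j = n then (ρ i j + ρ' i j) * C.omega n else 0) =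
      (if i + j = n then ρ i j * C.omega n else 0) + (if i + j = n then ρ' i j * C.omega n else 0)
    split_ifs
    · rw [add_mul]
    · rw [add_zero]
  map_smul' c ρ := Subtype.ext <| by
    funext i j
    change (if i + j = n then (c * ρ i j) * C.omega n else 0) =
      c * (if i + j = n then ρ i j * C.omega n else 0)
    split_ifs
    · rw [mul_assoc]
    · rw [mul_zero]

theorem cut_apply (n : ℕ) (ρ : ℕ → ℕ → A ⊗[K] Aᵐᵒᵖ) (i j : ℕ) :
    (C.cut n ρ).1 i j = if i + j = n then ρ i j * C.omega n else 0 := rfl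

theorem cut_coe (n : ℕ) (ρ : C.res n) : C.cut n ρ.1 = ρ := by
  refine Subtype.ext ?_
  funext i j
  rw [cut_apply]
  split_ifs with h
  · exact ρ.2.2 i j
  · exact (ρ.2.1 i j h).symm

/-- Families indexed by `Fin (n + 1)` as families on all bidegrees. -/
def spread (n : ℕ) : (Fin (n + 1) → A ⊗[K] Aᵐᵒᵖ) →ₗ[A ⊗[K] Aᵐᵒᵖ] (ℕ → ℕ → A ⊗[K] Aᵐᵒᵖ) where
  toFun ρ i _ := if h : i < n + 1 then ρ ⟨i, h⟩ else 0
  map_add' ρ ρ' := by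
    funext i j
    change _ = (if h : i < n + 1 then ρ ⟨i, h⟩ else 0) + (if h : i < n + 1 then ρ' ⟨i, h⟩ else 0)
    split_ifs
    · rfl
    · rw [add_zero]
  map_smul' c ρ := by
    funext i j
    change _ = c * (if h : i < n + 1 then ρ ⟨i, h⟩ else 0)
    split_ifs
    · rfl
    · rw [mul_zero]

/-- Right multiplication by the idempotent of degree `n` exhibits the term as a retract of a free
module of rank `n + 1`. -/
instance (n : ℕ) : Module.Projective (A ⊗[K] Aᵐᵒᵖ) (C.res n) := by
  let ι : C.res n →ₗ[A ⊗[K] Aᵐᵒᵖ] (Fin (n + 1) → A ⊗[K] Aᵐᵒᵖ) :=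
    { toFun := fun ρ i => ρ.1 i (n - i)
      map_add' := fun _ _ => rfl
      map_smul' := fun _ _ => rfl }
  refine Module.Projective.of_split ι (C.cut n ∘ₗ spread n) (LinearMap.ext fun ρ => ?_)
  conv_rhs => rw [LinearMap.id_apply, ← C.cut_coe n ρ]
  refine Subtype.ext ?_
  funext i j
  rw [LinearMap.comp_apply, LinearMap.comp_apply, cut_apply, cut_apply]
  split_ifs with h
  · change (if h : i < n + 1 then ρ.1 i (n - i) else 0) * _ = _
    rw [dif_pos (by omega), show n - i = j by omega]
  · rfl

theorem diff_mem_res {n : ℕ} {ρ : ℕ → ℕ → A ⊗[K] Aᵐᵒᵖ} (h : ρ ∈ C.res (n + 1)) :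
    C.diff ρ ∈ C.res n := by
  refine ⟨fun i j hij => ?_, fun i j => ?_⟩
  · rw [CoverRel.diff, h.1 _ _ (by omega), h.1 _ _ (by omega), zero_mul, zero_mul, add_zero]
  · have h1 := C.dgen_mem_homogeneous true i j n
    have h2 := C.dgen_mem_homogeneous false j i n
    have e1 := h.2 (i + 1) j
    have e2 := h.2 i (j + 1)
    push_cast at e1 e2
    rw [CoverRel.diff, CoverRel.d₁, CoverRel.d₂, add_mul, mul_assoc, mul_assoc, ← h1, ← h2,
      ← mul_assoc, ← mul_assoc, e1, e2]

/-- The differentials of the bimodule resolution. -/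
def resD (n : ℕ) : C.res (n + 1) →ₗ[A ⊗[K] Aᵐᵒᵖ] C.res n where
  toFun ρ := ⟨C.diff ρ.1, C.diff_mem_res ρ.2⟩
  map_add' ρ ρ' := Subtype.ext <| by
    funext i j
    change C.diff (fun i j => ρ.1 i j + ρ'.1 i j) i j = C.diff ρ.1 i j + C.diff ρ'.1 i j
    simp only [CoverRel.diff, add_mul, add_add_add_comm]
  map_smul' c ρ := Subtype.ext <| by
    funext i j
    change C.diff (fun i j => c * ρ.1 i j) i j = c * C.diff ρ.1 i j
    simp only [CoverRel.diff, mul_assoc, mul_add]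

theorem resD_apply (n : ℕ) (ρ : C.res (n + 1)) : (C.resD n ρ).1 = C.diff ρ.1 := rfl

/-- Restricting to a degree and its idempotent commutes with the differential. Exactness proved for
arbitrary families of bidegrees thus descends to the individual terms. -/
theorem resD_cut (n : ℕ) (ρ : ℕ → ℕ → A ⊗[K] Aᵐᵒᵖ) :
    C.resD n (C.cut (n + 1) ρ) = C.cut n (C.diff ρ) := by
  refine Subtype.ext ?_
  funext i j
  rw [resD_apply, cut_apply, CoverRel.diff, cut_apply, cut_apply]
  split_ifs with h1 h2 h3 h4 h5 h6 <;> try omega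
  · have h1 := C.dgen_mem_homogeneous true i j n
    have h2 := C.dgen_mem_homogeneous false j i n
    rw [CoverRel.diff, CoverRel.d₁, CoverRel.d₂, add_mul, mul_assoc, mul_assoc, mul_assoc,
      mul_assoc, Nat.cast_add, Nat.cast_one, h1, h2]
  · rw [zero_mul, zero_mul, add_zero]

theorem resD_exact (n : ℕ) : Function.Exact (C.resD (n + 1)) (C.resD n) := by
  intro ρ
  constructor
  · intro h
    have hd : ∀ i j, C.diff ρ.1 i j = 0 := fun i j =>
      congrFun (congrFun (congrArg Subtype.val h) i) j
    obtain ⟨ρ', h'⟩ := C.exists_diff_eq hd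
    refine ⟨C.cut (n + 2) ρ', ?_⟩
    rw [resD_cut, ← C.cut_coe (n + 1) ρ]
    refine Subtype.ext ?_
    funext i j
    rw [cut_apply, cut_apply]
    split_ifs with hij
    · rw [h' i j (by omega)]
    · rfl
  · rintro ⟨ρ', rfl⟩
    refine Subtype.ext ?_
    funext i j
    exact C.diff_diff ρ'.1 i j

/-- The augmentation of the bimodule resolution. -/
def resAug : C.res 0 →ₗ[A ⊗[K] Aᵐᵒᵖ] A where
  toFun ρ := ρ.1 0 0 • (1 : A)
  map_add' _ _ := add_smul _ _ _
  map_smul' _ _ := mul_smul _ _ _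

theorem omega_zero_smul_one : C.omega 0 • (1 : A) = 1 := by
  rw [omega, Finset.sum_smul]
  simp only [tm_smul, mul_one, add_zero, C.e_mul, if_true]
  exact C.e_sum

theorem resAug_surjective : Function.Surjective C.resAug := by
  intro a
  refine ⟨C.cut 0 fun _ _ => tm K a 1, ?_⟩
  change (C.cut 0 _).1 0 0 • (1 : A) = a
  rw [cut_apply, if_pos rfl, mul_smul, Nat.cast_zero, omega_zero_smul_one, tm_smul, mul_one,
    mul_one]

/-- The image of the differential in degree zero. -/
def aug : Submodule (A ⊗[K] Aᵐᵒᵖ) (A ⊗[K] Aᵐᵒᵖ) :=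
  Submodule.span _ {C.d₁ 0 0 * C.omega 0, C.d₂ 0 0 * C.omega 0}

theorem letter_smul_omega (b : Bool) :
    ∃ t ∈ C.aug, tm K (C.letter b) 1 * C.omega 0 = tm K 1 (C.letter b) * C.omega 0 + t := by
  have key : tm K (C.letter b) 1 = tm K 1 (C.letter b) + C.lin b 1 0 := by
    rw [CoverRel.lin, pow_one, pow_zero, mul_one]
    module
  refine ⟨C.lin b 1 0 * C.omega 0, ?_, by rw [key, add_mul]⟩
  cases b
  · exact Submodule.subset_span (Or.inr rfl)
  · exact Submodule.subset_span (Or.inl rfl)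

theorem mul_smul_omega {a a' : A}
    (h : ∃ t ∈ C.aug, tm K a 1 * C.omega 0 = tm K 1 a * C.omega 0 + t)
    (h' : ∃ t ∈ C.aug, tm K a' 1 * C.omega 0 = tm K 1 a' * C.omega 0 + t) :
    ∃ t ∈ C.aug, tm K (a * a') 1 * C.omega 0 = tm K 1 (a * a') * C.omega 0 + t := by
  obtain ⟨t, ht, e⟩ := h
  obtain ⟨t', ht', e'⟩ := h'
  refine ⟨_, add_mem (C.aug.smul_mem (tm K 1 a') ht) (C.aug.smul_mem (tm K a 1) ht'), ?_⟩
  have h1 : tm K (a * a') 1 = tm K a 1 * tm K a' 1 := by rw [tm_mul, mul_one]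
  have h2 : tm K 1 (a * a') = tm K 1 a' * tm K 1 a := by rw [tm_mul, mul_one]
  have h3 : tm K a 1 * tm K 1 a' = tm K 1 a' * tm K a 1 := by
    rw [tm_mul, tm_mul, mul_one, mul_one, one_mul, one_mul]
  rw [h1, h2, mul_assoc, e', mul_add, ← mul_assoc, h3, mul_assoc, e, mul_add, mul_assoc,
    smul_eq_mul, smul_eq_mul, add_assoc]

theorem e_smul_omega (i : ZMod 4) : tm K (C.e i) 1 * C.omega 0 = tm K 1 (C.e i) * C.omega 0 := by
  rw [omega, Finset.mul_sum, Finset.mul_sum]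
  refine Finset.sum_congr rfl fun j _ => ?_
  rw [tm_mul, tm_mul, one_mul, mul_one, add_zero, C.e_mul, C.e_mul]
  by_cases h : i = j
  · rw [if_pos h, if_pos h.symm, h]
  · rw [if_neg h, if_neg (Ne.symm h), tm_zero_left, tm_zero_right]

/-- The property is multiplicative and linear in `a`, so letters and vertices suffice: for a letter
the error is a generator of the image of the differential, and for a vertex there is none. -/
theorem smul_omega (a : A) :
    ∃ t ∈ C.aug, tm K a 1 * C.omega 0 = tm K 1 a * C.omega 0 + t := by
  have he : ∀ i, ∃ t ∈ C.aug, tm K (C.e i) 1 * C.omega 0 = tm K 1 (C.e i) * C.omega 0 + t :=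
    fun i => ⟨0, zero_mem _, by rw [e_smul_omega, add_zero]⟩
  have hw : ∀ b j, ∃ t ∈ C.aug,
      tm K (C.word b j) 1 * C.omega 0 = tm K 1 (C.word b j) * C.omega 0 + t := by
    intro b j
    induction j generalizing b with
    | zero => exact ⟨0, zero_mem _, by rw [C.word_zero, add_zero]⟩
    | succ j ih => exact C.mul_smul_omega (C.letter_smul_omega b) (ih _)
  have ha : a ∈ Submodule.span K (Set.range C.basis) := C.basis.mem_span a
  induction ha using Submodule.span_induction with
  | mem a h =>
    obtain ⟨⟨i, w⟩, rfl⟩ := h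
    obtain ⟨b, j, hbj⟩ := C.exists_wordOf_eq w
    rw [C.basis_apply, hbj]
    exact C.mul_smul_omega (he i) (hw b j)
  | zero => exact ⟨0, zero_mem _, by rw [tm_zero_left, tm_zero_right, zero_mul, add_zero]⟩
  | add a a' _ _ h h' =>
    obtain ⟨t, ht, e⟩ := h
    obtain ⟨t', ht', e'⟩ := h'
    refine ⟨t + t', add_mem ht ht', ?_⟩
    have h1 : tm K (a + a') 1 = tm K a 1 + tm K a' 1 := TensorProduct.add_tmul _ _ _
    have h2 : tm K 1 (a + a') = tm K 1 a + tm K 1 a' := TensorProduct.tmul_add _ _ _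
    rw [h1, h2, add_mul, add_mul, e, e', add_add_add_comm]
  | smul c a _ h =>
    obtain ⟨t, ht, e⟩ := h
    refine ⟨c • t, ?_, by
      rw [tm_smul_left, tm_smul_right, smul_mul_assoc, smul_mul_assoc, e, smul_add]⟩
    have := C.aug.smul_mem (c • (1 : A ⊗[K] Aᵐᵒᵖ)) ht
    rwa [smul_eq_mul, smul_mul_assoc, one_mul] at this

/-- Modulo the image of the differential the right factor may be moved to the left, so only the
value of the augmentation remains. This gives exactness at the end of the resolution. -/
theorem mul_omega_eq (r : A ⊗[K] Aᵐᵒᵖ) :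
    ∃ t ∈ C.aug, r * C.omega 0 + t = tm K (r • (1 : A)) 1 * C.omega 0 := by
  induction r using tm_induction with
  | zero => exact ⟨0, zero_mem _, by rw [zero_env_smul, tm_zero_left, zero_mul, add_zero]⟩
  | tmul a v =>
    obtain ⟨t, ht, e⟩ := C.smul_omega v
    refine ⟨_, C.aug.smul_mem (tm K a 1) ht, ?_⟩
    rw [tm_smul, mul_one]
    have h1 : tm K (a * v) 1 = tm K a 1 * tm K v 1 := by rw [tm_mul, mul_one]
    have h2 : tm K a v = tm K a 1 * tm K 1 v := by rw [tm_mul, mul_one, mul_one]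
    rw [h1, h2, mul_assoc, mul_assoc, e, mul_add, smul_eq_mul]
  | add r r' h h' =>
    obtain ⟨t, ht, e⟩ := h
    obtain ⟨t', ht', e'⟩ := h'
    refine ⟨t + t', add_mem ht ht', ?_⟩
    have h1 : tm K ((r + r') • (1 : A)) 1 = tm K (r • (1 : A)) 1 + tm K (r' • (1 : A)) 1 := by
      rw [add_smul]; exact TensorProduct.add_tmul _ _ _
    rw [h1, add_mul, add_mul, ← e, ← e', add_add_add_comm]

theorem lin_smul_one (b : Bool) (a : A) (h : a * C.letter b = C.letter b * a) :
    C.lin b 1 0 • a = 0 := by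
  rw [CoverRel.lin, pow_one, pow_zero, mul_one, add_smul, smul_assoc, tm_smul, tm_smul,
    one_mul, mul_one, h, neg_one_smul, add_neg_cancel]

theorem resAug_exact : Function.Exact (C.resD 0) C.resAug := by
  intro ρ
  constructor
  · intro h
    obtain ⟨t, ht, e⟩ := C.mul_omega_eq (ρ.1 0 0)
    have h' : ρ.1 0 0 • (1 : A) = 0 := h
    rw [h', tm_zero_left, zero_mul] at e
    have h0 := ρ.2.2 0 0
    rw [Nat.cast_zero] at h0
    have hm : ρ.1 0 0 ∈ C.aug := by
      rw [← h0, eq_neg_of_add_eq_zero_left e]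
      exact neg_mem ht
    obtain ⟨r₁, r₂, hr⟩ := Submodule.mem_span_pair.1 hm
    refine ⟨C.cut 1 fun i j => if i = 1 then r₁ else r₂, ?_⟩
    rw [resD_cut, ← C.cut_coe 0 ρ]
    refine Subtype.ext ?_
    funext i j
    rw [cut_apply, cut_apply]
    split_ifs with hij
    · obtain ⟨rfl, rfl⟩ : i = 0 ∧ j = 0 := by omega
      rw [CoverRel.diff, if_pos rfl, if_neg (by omega), ← hr, smul_eq_mul, smul_eq_mul,
        Nat.cast_zero, ← mul_assoc, ← mul_assoc, ← add_mul, mul_assoc _ (C.omega 0),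
        omega_mul_omega]
    · rfl
  · rintro ⟨ρ', rfl⟩
    change C.diff ρ'.1 0 0 • (1 : A) = 0
    have h1 : C.d₁ 0 0 = C.lin true 1 0 := rfl
    have h2 : C.d₂ 0 0 = C.lin false 1 0 := rfl
    rw [CoverRel.diff, h1, h2, add_smul, mul_smul, mul_smul, C.lin_smul_one _ _ (by simp),
      C.lin_smul_one _ _ (by simp), smul_zero, smul_zero, add_zero]

end Cover

end

noncomputable section

/-! ### The cochain complex computing Hochschild cohomology -/

namespace Cover

variable {K : Type u} [Field K] {A : Type u} [Ring A] [Algebra K A] {T : ℕ} (C : Cover K A T)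

open CoverRel (tm tm_mul tm_zero_left tm_zero_right tm_smul_left tm_smul_right)

attribute [local instance] instModuleTensorProductMop isScalarTower_env

theorem e_mul_self (i : ZMod 4) : C.e i * C.e i = C.e i := by rw [C.e_mul, if_pos rfl]

/-- The elements of weight `n`, that is, the sums of paths of length `n` modulo `4`. -/
def weight (n : ZMod 4) : Submodule K A where
  carrier := {f | ∀ i, C.e i * f = f * C.e (i + n)}
  zero_mem' := fun i => by rw [mul_zero, zero_mul]
  add_mem' := fun h h' i => by rw [mul_add, add_mul, h i, h' i]
  smul_mem' := fun c f h i => by rw [mul_smul_comm, smul_mul_assoc, h i]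

theorem omega_smul (n : ZMod 4) (f : A) : C.omega n • f = ∑ i, C.e i * f * C.e (i + n) := by
  rw [omega, Finset.sum_smul]
  simp only [tm_smul]

theorem mem_weight_iff {n : ZMod 4} {f : A} : f ∈ C.weight n ↔ C.omega n • f = f := by
  constructor
  · intro h
    have h' : ∀ i, C.e i * f = f * C.e (i + n) := h
    rw [omega_smul]
    calc ∑ i, C.e i * f * C.e (i + n) = ∑ i, C.e i * f := Finset.sum_congr rfl fun i _ => by
          rw [h', mul_assoc, e_mul_self]
      _ = f := by rw [← Finset.sum_mul, C.e_sum, one_mul]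
  · intro h i
    rw [← h, omega_smul, Finset.mul_sum, Finset.sum_mul]
    rw [Finset.sum_eq_single i, Finset.sum_eq_single i]
    · simp only [mul_assoc, e_mul_self]
      rw [← mul_assoc, e_mul_self]
    · intro j _ hj
      rw [mul_assoc, C.e_mul, if_neg (by simpa using hj), mul_zero]
    · simp
    · intro j _ hj
      rw [mul_assoc, ← mul_assoc, C.e_mul, if_neg hj.symm, zero_mul]
    · simp

/-- The cochains of degree `n`. -/
def cochain (n : ℕ) : Submodule K (ℕ → ℕ → A) where
  carrier := {f | (∀ i j, i + j ≠ n → f i j = 0) ∧ ∀ i j, f i j ∈ C.weight n}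
  zero_mem' := ⟨fun _ _ _ => rfl, fun _ _ => zero_mem _⟩
  add_mem' := fun {f f'} h h' => ⟨fun i j hij => by
    rw [Pi.add_apply, Pi.add_apply, h.1 i j hij, h'.1 i j hij, add_zero], fun i j =>
    add_mem (h.2 i j) (h'.2 i j)⟩
  smul_mem' := fun c f h => ⟨fun i j hij => by
    rw [Pi.smul_apply, Pi.smul_apply, h.1 i j hij, smul_zero], fun i j =>
    Submodule.smul_mem _ c (h.2 i j)⟩

/-- The coboundary. -/
def cob (f : ℕ → ℕ → A) : ℕ → ℕ → A
  | 0, 0 => 0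
  | i + 1, 0 => C.d₁ i 0 • f i 0
  | 0, j + 1 => C.d₂ 0 j • f 0 j
  | i + 1, j + 1 => C.d₁ i (j + 1) • f i (j + 1) + C.d₂ (i + 1) j • f (i + 1) j

/-- The cocycles of degree `n`. -/
def cocycle (n : ℕ) : Submodule K (ℕ → ℕ → A) where
  carrier := {f | f ∈ C.cochain n ∧ ∀ i j, C.cob f i j = 0}
  zero_mem' := ⟨zero_mem _, fun i j => by
    rcases i with _ | i <;> rcases j with _ | j <;> simp [cob]⟩
  add_mem' := fun {f f'} h h' => ⟨add_mem h.1 h'.1, fun i j => by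
    have e := h.2 i j
    have e' := h'.2 i j
    rcases i with _ | i <;> rcases j with _ | j <;> simp only [cob, Pi.add_apply, smul_add] at e e' ⊢
    · rw [e, e', add_zero]
    · rw [e, e', add_zero]
    · rw [add_add_add_comm, e, e', add_zero]⟩
  smul_mem' := fun c f h => ⟨Submodule.smul_mem _ c h.1, fun i j => by
    have e := h.2 i j
    rcases i with _ | i <;> rcases j with _ | j <;>
      simp only [cob, Pi.smul_apply, smul_comm _ c, ← smul_add] at e ⊢
    all_goals rw [e, smul_zero]⟩

/-- The generators of the terms of the resolution. -/
def gen (n i j : ℕ) : C.res n := C.cut n fun i' j' => if i' = i ∧ j' = j then 1 else 0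

theorem gen_apply (n i j i' j' : ℕ) :
    (C.gen n i j).1 i' j' = if i' = i ∧ j' = j ∧ i + j = n then C.omega n else 0 := by
  rw [gen, cut_apply]
  split_ifs with h1 h2 h3 h4 <;> first | omega | rfl | simp

theorem res_eq_sum {n : ℕ} (ρ : C.res n) :
    ρ = ∑ p ∈ Finset.HasAntidiagonal.antidiagonal n, ρ.1 p.1 p.2 • C.gen n p.1 p.2 := by
  refine Subtype.ext ?_
  funext i j
  rw [AddSubmonoidClass.coe_finsetSum, Finset.sum_apply, Finset.sum_apply]
  simp only [SetLike.val_smul, Pi.smul_apply, gen_apply, smul_eq_mul]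
  by_cases h : i + j = n
  · rw [Finset.sum_eq_single (i, j)]
    · simp [h, ρ.2.2]
    · rintro ⟨i', j'⟩ hp hne
      rw [if_neg, mul_zero]
      rintro ⟨rfl, rfl, -⟩
      exact hne rfl
    · intro h'
      simp [h] at h'
  · rw [ρ.2.1 i j h, Finset.sum_eq_zero]
    rintro ⟨i', j'⟩ -
    rw [if_neg, mul_zero]
    rintro ⟨rfl, rfl, h'⟩
    exact h h'

/-- A bimodule homomorphism is given by its values on the generators. -/
def evalGen (n : ℕ) : (C.res n →ₗ[A ⊗[K] Aᵐᵒᵖ] A) →ₗ[K] (ℕ → ℕ → A) where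
  toFun φ i j := φ (C.gen n i j)
  map_add' _ _ := rfl
  map_smul' _ _ := rfl

theorem evalGen_apply (n : ℕ) (φ : C.res n →ₗ[A ⊗[K] Aᵐᵒᵖ] A) (i j : ℕ) :
    C.evalGen n φ i j = φ (C.gen n i j) := rfl

theorem evalGen_injective (n : ℕ) : Function.Injective (C.evalGen n) := by
  intro φ ψ h
  refine LinearMap.ext fun ρ => ?_
  rw [C.res_eq_sum ρ, map_sum, map_sum]
  refine Finset.sum_congr rfl fun p _ => ?_
  rw [map_smul, map_smul]
  exact congrArg _ (congrFun (congrFun h p.1) p.2)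

theorem omega_smul_gen (n i j : ℕ) : C.omega n • C.gen n i j = C.gen n i j := by
  refine Subtype.ext ?_
  funext i' j'
  rw [SetLike.val_smul, Pi.smul_apply, Pi.smul_apply, gen_apply, smul_eq_mul]
  split_ifs
  · exact C.omega_mul_omega _
  · exact mul_zero _

theorem evalGen_mem (n : ℕ) (φ : C.res n →ₗ[A ⊗[K] Aᵐᵒᵖ] A) : C.evalGen n φ ∈ C.cochain n := by
  refine ⟨fun i j h => ?_, fun i j => ?_⟩
  · have : C.gen n i j = 0 := by
      refine Subtype.ext ?_
      funext i' j'
      rw [gen_apply, if_neg (by tauto)]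
      rfl
    rw [evalGen_apply, this, map_zero]
  · rw [mem_weight_iff, evalGen_apply, ← map_smul, omega_smul_gen]

theorem exists_evalGen_eq {n : ℕ} {f : ℕ → ℕ → A} (hf : f ∈ C.cochain n) :
    ∃ φ, C.evalGen n φ = f := by
  refine ⟨{ toFun := fun ρ => ∑ p ∈ Finset.HasAntidiagonal.antidiagonal n,
              ρ.1 p.1 p.2 • f p.1 p.2
            map_add' := fun ρ ρ' => by
              rw [← Finset.sum_add_distrib]
              exact Finset.sum_congr rfl fun p _ => add_smul _ _ _
            map_smul' := fun c ρ => by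
              rw [RingHom.id_apply, Finset.smul_sum]
              exact Finset.sum_congr rfl fun p _ => mul_smul _ _ _ }, ?_⟩
  funext i j
  rw [evalGen_apply, LinearMap.coe_mk, AddHom.coe_mk]
  by_cases h : i + j = n
  · rw [Finset.sum_eq_single (i, j)]
    · rw [gen_apply, if_pos ⟨rfl, rfl, h⟩]
      exact (C.mem_weight_iff).1 (hf.2 i j)
    · rintro ⟨i', j'⟩ hp hne
      rw [gen_apply, if_neg, zero_env_smul]
      rintro ⟨rfl, rfl, -⟩
      exact hne rfl
    · intro h'
      simp [h] at h'
  · rw [hf.1 i j h, Finset.sum_eq_zero]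
    rintro ⟨i', j'⟩ -
    rw [gen_apply, if_neg (by tauto), zero_env_smul]

theorem range_evalGen (n : ℕ) : LinearMap.range (C.evalGen n) = C.cochain n := by
  ext f
  constructor
  · rintro ⟨φ, rfl⟩
    exact C.evalGen_mem n φ
  · exact fun h => C.exists_evalGen_eq h

/-- The boundary of a generator has at most two nonzero entries, at `(i - 1, j)` and at `(i, j -
1)`; a bimodule map turns them into the two summands of the coboundary. -/
theorem resD_gen (n i j : ℕ) (h : i + j = n + 1) (φ : C.res n →ₗ[A ⊗[K] Aᵐᵒᵖ] A) :
    φ (C.resD n (C.gen (n + 1) i j)) = C.cob (C.evalGen n φ) i j := by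
  have hw : ∀ i j, C.omega n • φ (C.gen n i j) = φ (C.gen n i j) := fun i j => by
    rw [← map_smul, omega_smul_gen]
  have key : φ (C.resD n (C.gen (n + 1) i j)) =
      ∑ p ∈ Finset.HasAntidiagonal.antidiagonal n,
        (if p.1 + 1 = i ∧ p.2 = j then C.d₁ p.1 p.2 • φ (C.gen n p.1 p.2) else 0) +
      ∑ p ∈ Finset.HasAntidiagonal.antidiagonal n,
        (if p.1 = i ∧ p.2 + 1 = j then C.d₂ p.1 p.2 • φ (C.gen n p.1 p.2) else 0) := by
    rw [C.res_eq_sum (C.resD n (C.gen (n + 1) i j)), map_sum, ← Finset.sum_add_distrib]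
    refine Finset.sum_congr rfl fun p _ => ?_
    have h1 := C.dgen_mem_homogeneous true p.1 p.2 n
    have h2 := C.dgen_mem_homogeneous false p.2 p.1 n
    rw [map_smul, resD_apply, CoverRel.diff, gen_apply, gen_apply, add_smul]
    congr 1
    · split_ifs with h3 h4 h4
      · rw [CoverRel.d₁, Nat.cast_add, Nat.cast_one, h1, mul_smul, hw]
      · omega
      · omega
      · rw [zero_mul, zero_env_smul]
    · split_ifs with h3 h4 h4
      · rw [CoverRel.d₂, Nat.cast_add, Nat.cast_one, h2, mul_smul, hw]
      · omega
      · omega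
      · rw [zero_mul, zero_env_smul]
  have s1 : ∀ i', i = i' + 1 → ∑ p ∈ Finset.HasAntidiagonal.antidiagonal n,
        (if p.1 + 1 = i ∧ p.2 = j then C.d₁ p.1 p.2 • φ (C.gen n p.1 p.2) else 0) =
      C.d₁ i' j • φ (C.gen n i' j) := by
    rintro i' rfl
    rw [Finset.sum_eq_single (i', j), if_pos ⟨rfl, rfl⟩]
    · rintro ⟨a, b⟩ - hne
      rw [if_neg]
      rintro ⟨h1, h2⟩
      exact hne (Prod.ext (by simpa using h1) h2)
    · intro h'
      exact absurd (Finset.HasAntidiagonal.mem_antidiagonal.2 (by simp only; omega)) h'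
  have s2 : ∀ j', j = j' + 1 → ∑ p ∈ Finset.HasAntidiagonal.antidiagonal n,
        (if p.1 = i ∧ p.2 + 1 = j then C.d₂ p.1 p.2 • φ (C.gen n p.1 p.2) else 0) =
      C.d₂ i j' • φ (C.gen n i j') := by
    rintro j' rfl
    rw [Finset.sum_eq_single (i, j'), if_pos ⟨rfl, rfl⟩]
    · rintro ⟨a, b⟩ - hne
      rw [if_neg]
      rintro ⟨h1, h2⟩
      exact hne (Prod.ext h1 (by simpa using h2))
    · intro h'
      exact absurd (Finset.HasAntidiagonal.mem_antidiagonal.2 (by simp only; omega)) h'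
  have z1 : i = 0 → ∑ p ∈ Finset.HasAntidiagonal.antidiagonal n,
        (if p.1 + 1 = i ∧ p.2 = j then C.d₁ p.1 p.2 • φ (C.gen n p.1 p.2) else 0) = 0 :=
    fun hi => Finset.sum_eq_zero fun p _ => if_neg (by omega)
  have z2 : j = 0 → ∑ p ∈ Finset.HasAntidiagonal.antidiagonal n,
        (if p.1 = i ∧ p.2 + 1 = j then C.d₂ p.1 p.2 • φ (C.gen n p.1 p.2) else 0) = 0 :=
    fun hj => Finset.sum_eq_zero fun p _ => if_neg (by omega)
  rcases i with _ | i <;> rcases j with _ | j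
  · omega
  · rw [key, z1 rfl, s2 j rfl, zero_add]; rfl
  · rw [key, s1 i rfl, z2 rfl, add_zero]; rfl
  · rw [key, s1 i rfl, s2 j rfl]; rfl

theorem cob_eq_zero_of_ne {n : ℕ} {f : ℕ → ℕ → A} (hf : f ∈ C.cochain n) {i j : ℕ}
    (h : i + j ≠ n + 1) : C.cob f i j = 0 := by
  rcases i with _ | i <;> rcases j with _ | j
  · rfl
  · rw [cob, hf.1 _ _ (by omega), smul_zero]
  · rw [cob, hf.1 _ _ (by omega), smul_zero]
  · rw [cob, hf.1 _ _ (by omega), hf.1 _ _ (by omega), smul_zero, smul_zero, add_zero]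

theorem map_homKer (n : ℕ) :
    (ExtDim.homKer (R := A ⊗[K] Aᵐᵒᵖ) (P := C.res n) (Q := C.res (n + 1)) K
      (C.resD n) A).map (C.evalGen n) = C.cocycle n := by
  ext f
  constructor
  · rintro ⟨φ, hφ, rfl⟩
    refine ⟨C.evalGen_mem n φ, fun i j => ?_⟩
    by_cases h : i + j = n + 1
    · rw [← C.resD_gen n i j h]
      exact (ExtDim.mem_homKer K).1 hφ _
    · exact C.cob_eq_zero_of_ne (C.evalGen_mem n φ) h
  · rintro ⟨hf, hc⟩
    obtain ⟨φ, rfl⟩ := C.exists_evalGen_eq hf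
    refine ⟨φ, (ExtDim.mem_homKer K).2 fun z => ?_, rfl⟩
    rw [C.res_eq_sum z, map_sum, map_sum, Finset.sum_eq_zero]
    intro p hp
    rw [map_smul, map_smul, C.resD_gen n _ _ (Finset.HasAntidiagonal.mem_antidiagonal.1 hp), hc,
      smul_zero]

theorem finite (C : Cover K A T) : Module.Finite K A := Module.Finite.of_basis C.basis

instance (n : ℕ) : Module.Finite K (C.cochain n) := by
  have := C.finite
  let ι : C.cochain n →ₗ[K] (Fin (n + 1) → A) :=
    { toFun := fun f i => f.1 i (n - i)
      map_add' := fun _ _ => rfl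
      map_smul' := fun _ _ => rfl }
  refine Module.Finite.of_injective ι fun f f' h => Subtype.ext ?_
  funext i j
  by_cases hij : i + j = n
  · have : f.1 i (n - i) = f'.1 i (n - i) := congrFun h ⟨i, by omega⟩
    rwa [show n - i = j by omega] at this
  · rw [f.2.1 i j hij, f'.2.1 i j hij]

/-- The space of bimodule homomorphisms is the space of cochains. -/
def homEquivCochain (n : ℕ) : (C.res n →ₗ[A ⊗[K] Aᵐᵒᵖ] A) ≃ₗ[K] C.cochain n :=
  (LinearEquiv.ofInjective _ (C.evalGen_injective n)).trans
    (LinearEquiv.ofEq _ _ (C.range_evalGen n))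

theorem finrank_homKer (n : ℕ) :
    Module.finrank K (ExtDim.homKer (R := A ⊗[K] Aᵐᵒᵖ) (P := C.res n) (Q := C.res (n + 1)) K
      (C.resD n) A) = Module.finrank K (C.cocycle n) := by
  rw [← map_homKer]
  exact (Submodule.equivMapOfInjective _ (C.evalGen_injective n) _).finrank_eq

instance (n : ℕ) : Module.Finite K (C.res n →ₗ[A ⊗[K] Aᵐᵒᵖ] A) :=
  Module.Finite.equiv (C.homEquivCochain n).symm

theorem rank_hochschildCohomology_zero :
    Module.rank K (HochschildCohomology K A 0) = Module.finrank K (C.cocycle 0) := by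
  rw [← finrank_homKer]
  have key := ExtDim.rank_ext_zero (R := A ⊗[K] Aᵐᵒᵖ) (P := C.res 0) (Q := C.res (0 + 1)) K A
    (C.resD 0) A C.resAug
  exact key C.resAug_surjective C.resAug_exact

/-- The coboundaries of degree `n + 1` are the cochains modulo the cocycles of degree `n`, so
dimensions of cochains and cocycles are all that has to be computed. -/
theorem rank_hochschildCohomology_succ (n : ℕ) :
    ∃ h : ℕ, Module.rank K (HochschildCohomology K A (n + 1)) = h ∧
      h + Module.finrank K (C.cochain n) =
        Module.finrank K (C.cocycle (n + 1)) + Module.finrank K (C.cocycle n) := by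
  rw [← finrank_homKer, ← finrank_homKer, ← (C.homEquivCochain n).finrank_eq]
  have key := ExtDim.rank_ext (R := A ⊗[K] Aᵐᵒᵖ) K A n (fun n => C.res n) C.resD
  exact key C.resD_exact A C.resAug C.resAug_surjective C.resAug_exact

end Cover

end

noncomputable section

/-! ### Coordinates -/

namespace Cover

variable {K : Type u} [Field K] {A : Type u} [Ring A] [Algebra K A] {T : ℕ} (C : Cover K A T)

/-- The cyclic shift of the coordinates. -/
def shift : (ZMod 4 → K) ≃ₗ[K] (ZMod 4 → K) :=
  LinearEquiv.funCongrLeft K K (Equiv.addRight 1)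

theorem shift_apply (ε : ZMod 4 → K) (i : ZMod 4) : shift ε i = ε (i + 1) := rfl

theorem shift_single (i : ZMod 4) :
    shift (Pi.single (i + 1) (1 : K)) = Pi.single i 1 := by
  funext j
  rw [shift_apply]
  simp only [Pi.single_apply, add_left_inj]

/-- The diagonal element with the given coordinates. -/
def dg : (ZMod 4 → K) →ₗ[K] A :=
  Fintype.linearCombination K C.e

theorem dg_apply (ε : ZMod 4 → K) : C.dg ε = ∑ i, ε i • C.e i := rfl

theorem dg_single (i : ZMod 4) : C.dg (Pi.single i 1) = C.e i := by
  rw [dg, Fintype.linearCombination_apply_single, one_smul]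

/-- A letter leads from vertex `i` to vertex `i + 1`, so coefficients standing behind it are read
one vertex later when moved to the front. -/
theorem letter_mul_dg (b : Bool) (ε : ZMod 4 → K) :
    C.letter b * C.dg ε = C.dg (shift ε) * C.letter b := by
  rw [dg_apply, dg_apply, Finset.mul_sum, Finset.sum_mul]
  refine (Fintype.sum_equiv (Equiv.addRight (1 : ZMod 4)) _ _ fun i => ?_).symm
  rw [Equiv.coe_addRight, shift_apply, smul_mul_assoc, mul_smul_comm, C.e_letter]

/-- The coefficient of the word of length `j` with first letter `b`. -/
def cf (b : Bool) (j : ℕ) : A →ₗ[K] (ZMod 4 → K) :=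
  LinearMap.pi fun i => match j with
    | 0 => C.basis.coord (i, none)
    | j + 1 => if h : j < 4 * T + 1 then C.basis.coord (i, some (some (b, ⟨j, h⟩))) else 0

/-- The coefficient of the word of maximal length. -/
def ct : A →ₗ[K] (ZMod 4 → K) :=
  LinearMap.pi fun i => C.basis.coord (i, some none)

theorem cf_zero_apply (b : Bool) (f : A) (i : ZMod 4) :
    C.cf b 0 f i = C.basis.coord (i, none) f := rfl

theorem cf_succ_apply (b : Bool) {j : ℕ} (h : j ≤ 4 * T) (f : A) (i : ZMod 4) :
    C.cf b (j + 1) f i = C.basis.coord (i, some (some (b, ⟨j, by omega⟩))) f := by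
  simp only [cf, LinearMap.pi_apply]
  rw [dif_pos (by omega)]

theorem cf_of_lt (b : Bool) {j : ℕ} (h : 4 * T + 1 < j) (f : A) : C.cf b j f = 0 := by
  obtain ⟨j, rfl⟩ := Nat.exists_eq_add_of_lt h
  funext i
  simp only [cf, LinearMap.pi_apply]
  rw [dif_neg (by omega)]
  rfl

theorem ct_apply (f : A) (i : ZMod 4) : C.ct f i = C.basis.coord (i, some none) f := rfl

theorem ext_coef {f g : A} (h₁ : C.cf true 0 f = C.cf true 0 g)
    (h₂ : ∀ b j, j ≤ 4 * T → C.cf b (j + 1) f = C.cf b (j + 1) g) (h₃ : C.ct f = C.ct g) :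
    f = g := by
  refine C.basis.ext_elem fun ⟨i, w⟩ => ?_
  rcases w with _ | _ | ⟨b, j⟩
  · exact congrFun h₁ i
  · exact congrFun h₃ i
  · have := congrFun (h₂ b j (by omega)) i
    rwa [C.cf_succ_apply b (by omega), C.cf_succ_apply b (by omega)] at this

theorem cf_e (b : Bool) (j : ℕ) (i : ZMod 4) :
    C.cf b j (C.e i) = if j = 0 then Pi.single i 1 else 0 := by
  funext l
  rw [e_eq_basis]
  rcases j with _ | j
  · rw [cf_zero_apply, if_pos rfl]
    simp [Finsupp.single_apply, Pi.single_apply, eq_comm]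
  · rw [if_neg (by omega)]
    rcases le_or_gt j (4 * T) with h | h
    · rw [C.cf_succ_apply b h]
      simp
    · rw [C.cf_of_lt b (by omega)]

theorem ct_e (i : ZMod 4) : C.ct (C.e i) = 0 := by
  funext l
  rw [e_eq_basis, ct_apply]
  simp

theorem cf_word (b : Bool) (j : ℕ) (i : ZMod 4) (b' : Bool) {j' : ℕ} (h' : j' ≤ 4 * T) :
    C.cf b j (C.e i * C.word b' (j' + 1)) = if b = b' ∧ j = j' + 1 then Pi.single i 1 else 0 := by
  funext l
  rw [C.e_mul_word_eq_basis i b' h']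
  rcases j with _ | j
  · rw [cf_zero_apply, if_neg (by omega)]
    simp
  · rcases le_or_gt j (4 * T) with h | h
    · rw [C.cf_succ_apply b h]
      simp only [Module.Basis.coord_apply, Module.Basis.repr_self, Finsupp.single_apply,
        Prod.mk.injEq, Option.some.injEq, Fin.mk.injEq, add_left_inj]
      by_cases hl : i = l
      · subst hl
        by_cases hb : b = b' ∧ j = j'
        · rw [if_pos hb, if_pos ⟨rfl, hb.1.symm, hb.2.symm⟩, Pi.single_eq_same]
        · rw [if_neg hb, if_neg fun h => hb ⟨h.2.1.symm, h.2.2.symm⟩]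
          rfl
      · rw [if_neg fun h => hl h.1]
        split_ifs
        · rw [Pi.single_eq_of_ne (Ne.symm hl)]
        · rfl
    · rw [C.cf_of_lt b (by omega), if_neg (by omega)]

theorem ct_word (i : ZMod 4) (b' : Bool) {j' : ℕ} (h' : j' ≤ 4 * T) :
    C.ct (C.e i * C.word b' (j' + 1)) = 0 := by
  funext l
  rw [C.e_mul_word_eq_basis i b' h', ct_apply]
  simp

/-- The coefficient of the word of maximal length with first letter `b` with respect to the
basis element. -/
def topSign (b : Bool) : K := if b then -C.s⁻¹ else 1

theorem topSign_ne (b : Bool) : C.topSign b ≠ 0 := by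
  cases b <;> simp [topSign, C.s_ne]

theorem topSign_not (b : Bool) : C.topSign (!b) = -(C.par b * C.topSign b) := by
  cases b <;> simp [topSign, CoverRel.par, C.s_ne]

theorem word_top_eq (b : Bool) :
    C.word b (4 * T + 2) = C.topSign b • C.word false (4 * T + 2) := by
  cases b
  · simp [topSign]
  · rw [C.word_true_top, topSign, if_pos rfl, neg_smul]

theorem cf_top (b : Bool) (j : ℕ) (i : ZMod 4) (b' : Bool) :
    C.cf b j (C.e i * C.word b' (4 * T + 2)) = 0 := by
  rw [word_top_eq, mul_smul_comm, map_smul, e_mul_top_eq_basis]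
  convert smul_zero (C.topSign b')
  funext l
  rcases j with _ | j
  · rw [cf_zero_apply]
    simp
  · rcases le_or_gt j (4 * T) with h | h
    · rw [C.cf_succ_apply b h]
      simp
    · rw [C.cf_of_lt b (by omega)]

theorem ct_top (i : ZMod 4) (b' : Bool) :
    C.ct (C.e i * C.word b' (4 * T + 2)) = C.topSign b' • Pi.single i 1 := by
  rw [word_top_eq, mul_smul_comm, map_smul, e_mul_top_eq_basis]
  congr 1
  funext l
  rw [ct_apply]
  simp [Finsupp.single_apply, Pi.single_apply, eq_comm]

theorem letter_mul_e (b : Bool) (i : ZMod 4) : C.letter b * C.e i = C.e (i - 1) * C.letter b := by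
  rw [C.e_letter, sub_add_cancel]

theorem letter_mul_e_mul (b : Bool) (i : ZMod 4) (f : A) :
    C.letter b * (C.e i * f) = C.e (i - 1) * (C.letter b * f) := by
  rw [← mul_assoc, letter_mul_e, mul_assoc]

theorem shift_single' (i : ZMod 4) :
    shift (Pi.single i (1 : K)) = Pi.single (i - 1) 1 := by
  have := shift_single (K := K) (i - 1)
  rwa [sub_add_cancel] at this

theorem cf_letter_mul (b b' : Bool) {j : ℕ} (hj : j ≤ 4 * T) (f : A) :
    C.cf b (j + 1) (C.letter b' * f) = if b = b' then shift (C.cf (!b) j f) else 0 := by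
  have : C.cf b (j + 1) ∘ₗ LinearMap.mulLeft K (C.letter b') =
      if b = b' then shift.toLinearMap ∘ₗ C.cf (!b) j else 0 := by
    refine C.linearMap_ext false (fun i => ?_) (fun i c m hm => ?_) (fun i => ?_)
    · have := C.cf_word b (j + 1) (i - 1) b' (j' := 0) (by omega)
      rw [LinearMap.comp_apply, LinearMap.mulLeft_apply, letter_mul_e, ← C.word_one, this]
      by_cases hb : b = b'
      · rw [if_pos hb, LinearMap.comp_apply, cf_e]
        by_cases hj0 : j = 0
        · rw [if_pos ⟨hb, by omega⟩, if_pos hj0]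
          exact (shift_single' i).symm
        · rw [if_neg (by omega), if_neg hj0, map_zero]
      · rw [if_neg (by tauto), if_neg hb]
        rfl
    · rw [LinearMap.comp_apply, LinearMap.mulLeft_apply, letter_mul_e_mul]
      by_cases hc : c = b'
      · rw [hc, C.letter_mul_word_self, mul_zero, map_zero]
        split_ifs with hb
        · rw [LinearMap.comp_apply, C.cf_word _ _ _ _ hm, if_neg (by rw [hb]; simp), map_zero]
        · rfl
      · have hc' : c = !b' := Bool.eq_not_of_ne hc
        subst hc'
        rw [← C.word_succ]
        rcases Nat.lt_or_ge m (4 * T) with h | h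
        · rw [C.cf_word _ _ _ _ (by omega)]
          by_cases hb : b = b'
          · rw [if_pos hb, LinearMap.comp_apply, C.cf_word _ _ _ _ hm, hb]
            by_cases hjm : j = m + 1
            · rw [if_pos ⟨rfl, by omega⟩, if_pos ⟨rfl, hjm⟩]
              exact (shift_single' i).symm
            · rw [if_neg (by omega), if_neg (by omega), map_zero]
          · rw [if_neg (by tauto), if_neg hb]
            rfl
        · obtain rfl : m = 4 * T := by omega
          rw [cf_top]
          split_ifs with hb
          · rw [LinearMap.comp_apply, C.cf_word _ _ _ _ hm, if_neg (by omega), map_zero]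
          · rfl
    · rw [LinearMap.comp_apply, LinearMap.mulLeft_apply, letter_mul_e_mul,
        C.letter_mul_word_cases b' false (4 * T + 2) |>.elim id fun h => by
          rw [h]; exact C.word_top_succ _, mul_zero, map_zero]
      split_ifs with hb
      · rw [LinearMap.comp_apply, cf_top, map_zero]
      · rfl
  have h := LinearMap.congr_fun this f
  rw [LinearMap.comp_apply, LinearMap.mulLeft_apply] at h
  rw [h]
  split_ifs <;> rfl

theorem cf_zero_letter_mul (b b' : Bool) (f : A) : C.cf b 0 (C.letter b' * f) = 0 := by
  have : C.cf b 0 ∘ₗ LinearMap.mulLeft K (C.letter b') = 0 := by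
    refine C.linearMap_ext false (fun i => ?_) (fun i c m hm => ?_) (fun i => ?_)
    · have := C.cf_word b 0 (i - 1) b' (j' := 0) (by omega)
      rw [LinearMap.comp_apply, LinearMap.mulLeft_apply, letter_mul_e, ← C.word_one, this,
        if_neg (by omega)]
      rfl
    · rw [LinearMap.comp_apply, LinearMap.mulLeft_apply, letter_mul_e_mul]
      rcases C.letter_mul_word_cases b' c (m + 1) with h | h <;> rw [h]
      · rw [mul_zero, map_zero]; rfl
      · rcases Nat.lt_or_ge m (4 * T) with h | h
        · rw [C.cf_word _ _ _ _ (by omega), if_neg (by omega)]; rfl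
        · obtain rfl : m = 4 * T := by omega
          rw [cf_top]; rfl
    · rw [LinearMap.comp_apply, LinearMap.mulLeft_apply, letter_mul_e_mul]
      rcases C.letter_mul_word_cases b' false (4 * T + 2) with h | h <;> rw [h]
      · rw [mul_zero, map_zero]; rfl
      · rw [C.word_top_succ, mul_zero, map_zero]; rfl
  exact LinearMap.congr_fun this f

theorem cf_mul_letter (b b' : Bool) {j : ℕ} (hj : j ≤ 4 * T) (f : A) :
    C.cf b (j + 1) (f * C.letter b') = if xor b j.bodd = b' then C.cf b j f else 0 := by
  have : C.cf b (j + 1) ∘ₗ LinearMap.mulRight K (C.letter b') =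
      if xor b j.bodd = b' then C.cf b j else 0 := by
    refine C.linearMap_ext false (fun i => ?_) (fun i c m hm => ?_) (fun i => ?_)
    · have := C.cf_word b (j + 1) i b' (j' := 0) (by omega)
      rw [LinearMap.comp_apply, LinearMap.mulRight_apply, ← C.word_one, this]
      by_cases hb : xor b j.bodd = b'
      · rw [if_pos hb, cf_e]
        by_cases hj0 : j = 0
        · subst hj0
          rw [if_pos ⟨by simpa using hb, rfl⟩, if_pos rfl]
        · rw [if_neg (by omega), if_neg hj0]
      · rw [if_neg hb, if_neg]
        · rfl
        · rintro ⟨rfl, h⟩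
          obtain rfl : j = 0 := by omega
          simp at hb
    · rw [LinearMap.comp_apply, LinearMap.mulRight_apply, mul_assoc]
      by_cases hc : xor c m.bodd = b'
      · rw [C.word_mul_letter_of_eq hc, mul_zero, map_zero]
        split_ifs with hb
        · rw [C.cf_word _ _ _ _ hm, if_neg]
          rintro ⟨rfl, rfl⟩
          rw [← hc, Nat.bodd_succ] at hb
          revert hb
          cases b <;> cases m.bodd <;> decide
        · rfl
      · rw [C.word_mul_letter_of_ne hc]
        have hc' := xor_succ_of_ne hc
        rcases Nat.lt_or_ge m (4 * T) with h | h
        · rw [C.cf_word _ _ _ _ (by omega)]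
          split_ifs with h1 h2 h2
          · rw [C.cf_word _ _ _ _ hm, if_pos ⟨h1.1, by omega⟩]
          · exfalso
            obtain ⟨rfl, h1⟩ := h1
            obtain rfl : j = m + 1 := by omega
            exact h2 hc'
          · rw [C.cf_word _ _ _ _ hm, if_neg]
            rintro ⟨rfl, rfl⟩
            exact h1 ⟨rfl, rfl⟩
          · rfl
        · obtain rfl : m = 4 * T := by omega
          rw [cf_top]
          split_ifs with hb
          · rw [C.cf_word _ _ _ _ hm, if_neg (by omega)]
          · rfl
    · rw [LinearMap.comp_apply, LinearMap.mulRight_apply, mul_assoc, C.word_top_mul_letter,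
        mul_zero, map_zero]
      split_ifs with hb
      · rw [cf_top]
      · rfl
  have h := LinearMap.congr_fun this f
  rw [LinearMap.comp_apply, LinearMap.mulRight_apply] at h
  rw [h]
  split_ifs <;> rfl

theorem cf_zero_mul_letter (b b' : Bool) (f : A) : C.cf b 0 (f * C.letter b') = 0 := by
  have : C.cf b 0 ∘ₗ LinearMap.mulRight K (C.letter b') = 0 := by
    refine C.linearMap_ext false (fun i => ?_) (fun i c m hm => ?_) (fun i => ?_)
    · have := C.cf_word b 0 i b' (j' := 0) (by omega)
      rw [LinearMap.comp_apply, LinearMap.mulRight_apply, ← C.word_one, this,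
        if_neg (by omega)]
      rfl
    · rw [LinearMap.comp_apply, LinearMap.mulRight_apply, mul_assoc]
      by_cases h : xor c m.bodd = b'
      · rw [C.word_mul_letter_of_eq h, mul_zero, map_zero]; rfl
      · rw [C.word_mul_letter_of_ne h]
        rcases Nat.lt_or_ge m (4 * T) with h | h
        · rw [C.cf_word _ _ _ _ (by omega), if_neg (by omega)]; rfl
        · obtain rfl : m = 4 * T := by omega
          rw [cf_top]; rfl
    · rw [LinearMap.comp_apply, LinearMap.mulRight_apply, mul_assoc, C.word_top_mul_letter,
        mul_zero, map_zero]
      rfl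
  exact LinearMap.congr_fun this f

theorem ct_letter_mul (b : Bool) (f : A) :
    C.ct (C.letter b * f) = C.topSign b • shift (C.cf (!b) (4 * T + 1) f) := by
  have : C.ct ∘ₗ LinearMap.mulLeft K (C.letter b) =
      C.topSign b • (shift.toLinearMap ∘ₗ C.cf (!b) (4 * T + 1)) := by
    refine C.linearMap_ext false (fun i => ?_) (fun i c m hm => ?_) (fun i => ?_)
    · rw [LinearMap.comp_apply, LinearMap.mulLeft_apply, letter_mul_e, ← C.word_one,
        C.ct_word _ _ (by omega), LinearMap.smul_apply, LinearMap.comp_apply, cf_e,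
        if_neg (by omega), map_zero, smul_zero]
    · rw [LinearMap.comp_apply, LinearMap.mulLeft_apply, letter_mul_e_mul, LinearMap.smul_apply,
        LinearMap.comp_apply, C.cf_word _ _ _ _ hm]
      by_cases hc : c = b
      · rw [hc, C.letter_mul_word_self, mul_zero, map_zero, if_neg (by simp), map_zero, smul_zero]
      · have hc' : c = !b := Bool.eq_not_of_ne hc
        subst hc'
        rw [← C.word_succ]
        rcases Nat.lt_or_ge m (4 * T) with h | h
        · rw [C.ct_word _ _ (by omega), if_neg (by omega), map_zero, smul_zero]
        · obtain rfl : m = 4 * T := by omega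
          rw [ct_top, if_pos ⟨rfl, rfl⟩, ← shift_single' i]
          rfl
    · rw [LinearMap.comp_apply, LinearMap.mulLeft_apply, letter_mul_e_mul,
        C.letter_mul_word_cases b false (4 * T + 2) |>.elim id fun h => by
          rw [h]; exact C.word_top_succ _, mul_zero, map_zero, LinearMap.smul_apply,
        LinearMap.comp_apply, cf_top, map_zero, smul_zero]
  exact LinearMap.congr_fun this f

theorem ct_mul_letter (b : Bool) (f : A) :
    C.ct (f * C.letter b) = C.topSign (!b) • C.cf (!b) (4 * T + 1) f := by
  have : C.ct ∘ₗ LinearMap.mulRight K (C.letter b) = C.topSign (!b) • C.cf (!b) (4 * T + 1) := by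
    refine C.linearMap_ext false (fun i => ?_) (fun i c m hm => ?_) (fun i => ?_)
    · rw [LinearMap.comp_apply, LinearMap.mulRight_apply, ← C.word_one,
        C.ct_word _ _ (by omega), LinearMap.smul_apply, cf_e, if_neg (by omega), smul_zero]
    · rw [LinearMap.comp_apply, LinearMap.mulRight_apply, mul_assoc, LinearMap.smul_apply,
        C.cf_word _ _ _ _ hm]
      by_cases hc : xor c m.bodd = b
      · rw [C.word_mul_letter_of_eq hc, mul_zero, map_zero, if_neg, smul_zero]
        rintro ⟨rfl, h⟩
        obtain rfl : m = 4 * T := by omega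
        simp at hc
      · rw [C.word_mul_letter_of_ne hc]
        rcases Nat.lt_or_ge m (4 * T) with h | h
        · rw [C.ct_word _ _ (by omega), if_neg (by omega), smul_zero]
        · obtain rfl : m = 4 * T := by omega
          have hc' : c = !b := by
            rw [CoverRel.bodd_four_mul, Bool.xor_false] at hc
            exact Bool.eq_not_of_ne hc
          subst hc'
          rw [ct_top, if_pos ⟨rfl, rfl⟩]
    · rw [LinearMap.comp_apply, LinearMap.mulRight_apply, mul_assoc, C.word_top_mul_letter,
        mul_zero, map_zero, LinearMap.smul_apply, cf_top, smul_zero]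
  exact LinearMap.congr_fun this f

theorem cf_dg (b : Bool) (j : ℕ) (ε : ZMod 4 → K) :
    C.cf b j (C.dg ε) = if j = 0 then ε else 0 := by
  rw [dg_apply, map_sum]
  simp only [map_smul, cf_e]
  split_ifs
  · exact (pi_eq_sum_univ' ε).symm
  · simp

theorem ct_dg (ε : ZMod 4 → K) : C.ct (C.dg ε) = 0 := by
  rw [dg_apply, map_sum]
  simp [ct_e]

theorem dg_mul (ε : ZMod 4 → K) (a : A) : C.dg ε * a = ∑ i, ε i • (C.e i * a) := by
  rw [dg_apply, Finset.sum_mul]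
  simp only [smul_mul_assoc]

theorem cf_dg_mul_word (b : Bool) (j : ℕ) (ε : ZMod 4 → K) (b' : Bool) {j' : ℕ}
    (h' : j' ≤ 4 * T) :
    C.cf b j (C.dg ε * C.word b' (j' + 1)) = if b = b' ∧ j = j' + 1 then ε else 0 := by
  rw [dg_mul, map_sum]
  simp only [map_smul, C.cf_word _ _ _ _ h']
  split_ifs
  · exact (pi_eq_sum_univ' ε).symm
  · simp

theorem ct_dg_mul_word (ε : ZMod 4 → K) (b' : Bool) {j' : ℕ} (h' : j' ≤ 4 * T) :
    C.ct (C.dg ε * C.word b' (j' + 1)) = 0 := by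
  rw [dg_mul, map_sum]
  simp [C.ct_word _ _ h']

theorem cf_dg_mul_top (b : Bool) (j : ℕ) (ε : ZMod 4 → K) (b' : Bool) :
    C.cf b j (C.dg ε * C.word b' (4 * T + 2)) = 0 := by
  rw [dg_mul, map_sum]
  simp [cf_top]

theorem ct_dg_mul_top (ε : ZMod 4 → K) (b' : Bool) :
    C.ct (C.dg ε * C.word b' (4 * T + 2)) = C.topSign b' • ε := by
  rw [dg_mul, map_sum]
  simp only [map_smul, ct_top, smul_comm _ (C.topSign b'), ← Finset.smul_sum]
  congr 1
  exact (pi_eq_sum_univ' ε).symm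

theorem word_mul_e (b : Bool) (j : ℕ) (i : ZMod 4) :
    C.word b j * C.e i = C.e (i - j) * C.word b j := by
  rw [C.e_word, sub_add_cancel]

theorem cast_four_mul_add_one : ((4 * T + 1 : ℕ) : ZMod 4) = 1 := by
  push_cast
  rw [show (4 : ZMod 4) = 0 from rfl, zero_mul, zero_add]

theorem cow_mul_e (b : Bool) (i : ZMod 4) : C.cow b * C.e i = C.e (i - 1) * C.cow b := by
  rw [CoverRel.cow, word_mul_e, cast_four_mul_add_one]

/-- After a word of length `4T + 1` only a vertex or one further letter survives, so only
coefficients of lengths `0` and `1` enter. For this reason the long-word component of the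
differential is invisible in weights `2` and `3`. -/
theorem cow_mul (b : Bool) (f : A) :
    C.cow b * f = C.dg (shift (C.cf true 0 f)) * C.cow b +
      C.dg (shift (C.cf b 1 f)) * C.word (!b) (4 * T + 2) := by
  have : LinearMap.mulLeft K (C.cow b) =
      LinearMap.mulRight K (C.cow b) ∘ₗ C.dg ∘ₗ shift.toLinearMap ∘ₗ C.cf true 0 +
      LinearMap.mulRight K (C.word (!b) (4 * T + 2)) ∘ₗ C.dg ∘ₗ shift.toLinearMap ∘ₗ C.cf b 1 := by
    refine C.linearMap_ext false (fun i => ?_) (fun i c m hm => ?_) (fun i => ?_) <;>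
      simp only [LinearMap.mulLeft_apply, LinearMap.add_apply, LinearMap.comp_apply,
        LinearMap.mulRight_apply, LinearEquiv.coe_coe]
    · rw [cf_e, cf_e, if_pos rfl, if_neg (by omega), map_zero, map_zero, zero_mul, add_zero,
        shift_single', dg_single, cow_mul_e]
    · rw [C.cf_word _ _ _ _ hm, C.cf_word _ _ _ _ hm, if_neg (by omega), map_zero, map_zero,
        zero_mul, zero_add, ← mul_assoc, cow_mul_e, mul_assoc]
      by_cases h : b = c ∧ 1 = m + 1
      · obtain ⟨rfl, h⟩ := h
        obtain rfl : m = 0 := by omega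
        rw [if_pos ⟨rfl, rfl⟩, shift_single', dg_single, C.word_one, C.cow_mul_letter]
      · rw [if_neg h, map_zero, map_zero, zero_mul]
        rcases C.word_mul_word_cases (!b) c (4 * T + 1) (m + 1) with h' | ⟨d, h'⟩
        · rw [CoverRel.cow, h', mul_zero]
        · rcases Nat.eq_zero_or_pos m with rfl | hm'
          · have hc : c = !b := by
              refine Bool.eq_not_of_ne fun hc => h ⟨hc.symm, rfl⟩
            subst hc
            rw [CoverRel.cow, C.word_mul_word_eq_zero (by simp), mul_zero]
          · rw [CoverRel.cow, h', C.word_eq_zero _ (by omega), mul_zero]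
    · rw [cf_top, cf_top, map_zero, map_zero, zero_mul, zero_mul, add_zero, ← mul_assoc, cow_mul_e,
        mul_assoc]
      rcases C.word_mul_word_cases (!b) false (4 * T + 1) (4 * T + 2) with h' | ⟨d, h'⟩
      · rw [CoverRel.cow, h', mul_zero]
      · rw [CoverRel.cow, h', C.word_eq_zero _ (by omega), mul_zero]
  exact LinearMap.congr_fun this f

theorem mul_cow (b : Bool) (f : A) :
    f * C.cow b = C.dg (C.cf true 0 f) * C.cow b + C.dg (C.cf b 1 f) * C.word b (4 * T + 2) := by
  have : LinearMap.mulRight K (C.cow b) =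
      LinearMap.mulRight K (C.cow b) ∘ₗ C.dg ∘ₗ C.cf true 0 +
      LinearMap.mulRight K (C.word b (4 * T + 2)) ∘ₗ C.dg ∘ₗ C.cf b 1 := by
    refine C.linearMap_ext false (fun i => ?_) (fun i c m hm => ?_) (fun i => ?_) <;>
      simp only [LinearMap.add_apply, LinearMap.comp_apply, LinearMap.mulRight_apply]
    · rw [cf_e, cf_e, if_pos rfl, if_neg (by omega), map_zero, zero_mul, add_zero, dg_single]
    · rw [C.cf_word _ _ _ _ hm, C.cf_word _ _ _ _ hm, if_neg (by omega), map_zero,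
        zero_mul, zero_add, mul_assoc]
      by_cases h : b = c ∧ 1 = m + 1
      · obtain ⟨rfl, h⟩ := h
        obtain rfl : m = 0 := by omega
        rw [if_pos ⟨rfl, rfl⟩, dg_single, C.word_one, C.letter_mul_cow]
      · rw [if_neg h, map_zero, zero_mul]
        rcases Nat.eq_zero_or_pos m with rfl | hm'
        · rw [C.word_mul_cow_of_ne, mul_zero]
          rintro hc
          exact h ⟨by simpa using hc.symm, rfl⟩
        · rw [C.word_mul_cow_eq_zero hm', mul_zero]
    · rw [cf_top, cf_top, map_zero, zero_mul, zero_mul, add_zero, mul_assoc, C.word_top_mul_cow,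
        mul_zero]
  exact LinearMap.congr_fun this f

theorem cf_e_mul (b : Bool) (j : ℕ) (i : ZMod 4) (f : A) :
    C.cf b j (C.e i * f) i = C.cf b j f i := by
  have : LinearMap.proj i ∘ₗ C.cf b j ∘ₗ LinearMap.mulLeft K (C.e i) =
      LinearMap.proj i ∘ₗ C.cf b j := by
    refine C.linearMap_ext false (fun l => ?_) (fun l c m hm => ?_) (fun l => ?_) <;>
      simp only [LinearMap.comp_apply, LinearMap.mulLeft_apply, LinearMap.proj_apply, ← mul_assoc,
        C.e_mul] <;>
      by_cases h : i = l
    · rw [if_pos h, h]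
    · rw [if_neg h, map_zero, cf_e]
      split_ifs
      · rw [Pi.single_eq_of_ne h]; rfl
      · rfl
    · rw [if_pos h, h]
    · rw [if_neg h, zero_mul, map_zero, C.cf_word _ _ _ _ hm]
      split_ifs
      · rw [Pi.single_eq_of_ne h]; rfl
      · rfl
    · rw [if_pos h, h]
    · rw [if_neg h, zero_mul, map_zero, cf_top]
  exact LinearMap.congr_fun this f

theorem cf_mul_e (b : Bool) (j : ℕ) (i l : ZMod 4) (f : A) :
    C.cf b j (f * C.e l) i = if i + j = l then C.cf b j f i else 0 := by
  have : LinearMap.proj i ∘ₗ C.cf b j ∘ₗ LinearMap.mulRight K (C.e l) =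
      if i + j = l then LinearMap.proj i ∘ₗ C.cf b j else 0 := by
    refine C.linearMap_ext false (fun k => ?_) (fun k c m hm => ?_) (fun k => ?_) <;>
      simp only [LinearMap.comp_apply, LinearMap.mulRight_apply, LinearMap.proj_apply]
    · rw [C.e_mul]
      by_cases h : k = l
      · rw [if_pos h]
        split_ifs with h'
        · rfl
        · rw [cf_e]
          split_ifs with hj
          · subst hj
            rw [Pi.single_eq_of_ne]
            · rfl
            · rintro rfl
              exact h' (by simpa using h)
          · rfl
      · rw [if_neg h, map_zero]
        split_ifs with h'
        · simp only [LinearMap.comp_apply, LinearMap.proj_apply]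
          rw [cf_e]
          split_ifs with hj
          · subst hj
            rw [Pi.single_eq_of_ne]
            · rfl
            · rintro rfl
              exact h (by simpa using h')
          · rfl
        · rfl
    · rw [mul_assoc, word_mul_e, ← mul_assoc, C.e_mul]
      split_ifs with h h' h'
      · rfl
      · rw [C.cf_word _ _ _ _ hm]
        split_ifs with hj
        · rw [Pi.single_eq_of_ne]
          · rfl
          · rintro rfl
            rw [hj.2, h, sub_add_cancel] at h'
            exact h' rfl
        · rfl
      · rw [zero_mul, map_zero, LinearMap.comp_apply, LinearMap.proj_apply, C.cf_word _ _ _ _ hm]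
        split_ifs with hj
        · rw [Pi.single_eq_of_ne]
          · rfl
          · rintro rfl
            rw [← h', hj.2, add_sub_cancel_right] at h
            exact h rfl
        · rfl
      · rw [zero_mul, map_zero]
        rfl
    · rw [mul_assoc, word_mul_e, ← mul_assoc, C.e_mul]
      split_ifs with h h' h'
      · rfl
      · rw [cf_top]; rfl
      · rw [zero_mul, map_zero, LinearMap.comp_apply, LinearMap.proj_apply, cf_top]
      · rw [zero_mul, map_zero]; rfl
  have h := LinearMap.congr_fun this f
  rw [LinearMap.comp_apply, LinearMap.comp_apply, LinearMap.mulRight_apply,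
    LinearMap.proj_apply] at h
  rw [h]
  split_ifs <;> rfl

theorem ct_e_mul (i : ZMod 4) (f : A) : C.ct (C.e i * f) i = C.ct f i := by
  have : LinearMap.proj i ∘ₗ C.ct ∘ₗ LinearMap.mulLeft K (C.e i) = LinearMap.proj i ∘ₗ C.ct := by
    refine C.linearMap_ext false (fun l => ?_) (fun l c m hm => ?_) (fun l => ?_) <;>
      simp only [LinearMap.comp_apply, LinearMap.mulLeft_apply, LinearMap.proj_apply, ← mul_assoc,
        C.e_mul] <;>
      by_cases h : i = l
    · rw [if_pos h, h]
    · rw [if_neg h, map_zero, ct_e]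
    · rw [if_pos h, h]
    · rw [if_neg h, zero_mul, map_zero, C.ct_word _ _ hm]
    · rw [if_pos h, h]
    · rw [if_neg h, zero_mul, map_zero, ct_top]
      simp [Pi.single_eq_of_ne h]
  exact LinearMap.congr_fun this f

theorem ct_mul_e (i l : ZMod 4) (f : A) (h : i + 2 ≠ l) : C.ct (f * C.e l) i = 0 := by
  have : LinearMap.proj i ∘ₗ C.ct ∘ₗ LinearMap.mulRight K (C.e l) = 0 := by
    refine C.linearMap_ext false (fun k => ?_) (fun k c m hm => ?_) (fun k => ?_) <;>
      simp only [LinearMap.comp_apply, LinearMap.mulRight_apply, LinearMap.proj_apply,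
        LinearMap.zero_apply]
    · rw [C.e_mul]
      split_ifs
      · rw [ct_e]; rfl
      · rw [map_zero]; rfl
    · rw [mul_assoc, word_mul_e, ← mul_assoc, C.e_mul]
      split_ifs
      · rw [C.ct_word _ _ hm]; rfl
      · rw [zero_mul, map_zero]; rfl
    · rw [mul_assoc, word_mul_e, ← mul_assoc, C.e_mul]
      split_ifs with h'
      · rw [ct_top, Pi.smul_apply, Pi.single_eq_of_ne, smul_zero]
        rintro rfl
        apply h
        rw [h']
        push_cast
        rw [show (4 : ZMod 4) = 0 from rfl]
        ring
      · rw [zero_mul, map_zero]; rfl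
  exact LinearMap.congr_fun this f

theorem cf_eq_zero_of_weight {r : ZMod 4} {f : A} (hf : f ∈ C.weight r) (b : Bool) {j : ℕ}
    (hj : (j : ZMod 4) ≠ r) : C.cf b j f = 0 := by
  funext i
  rw [← C.cf_e_mul b j i f, hf i, cf_mul_e, if_neg]
  · rfl
  · simpa using hj

theorem ct_eq_zero_of_weight {r : ZMod 4} {f : A} (hf : f ∈ C.weight r) (hr : (2 : ZMod 4) ≠ r) :
    C.ct f = 0 := by
  funext i
  rw [← C.ct_e_mul i f, hf i, ct_mul_e]
  · rfl
  · simpa using hr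

theorem dg_mul_word_mem_weight (ε : ZMod 4 → K) (b : Bool) (j : ℕ) :
    C.dg ε * C.word b j ∈ C.weight j := by
  intro i
  rw [← mul_assoc, mul_assoc (C.dg ε), ← C.e_word, ← mul_assoc]
  congr 1
  rw [dg_mul, dg_apply, Finset.mul_sum]
  refine Finset.sum_congr rfl fun l _ => ?_
  rw [mul_smul_comm, C.e_mul, C.e_mul]
  by_cases h : i = l
  · rw [h]
  · rw [if_neg h, if_neg (Ne.symm h)]

end Cover

end

noncomputable section

/-! ### Dimensions of spaces of local solutions -/

theorem finrank_eq_finrank_add_of_surjOn {K M W : Type*} [Field K] [AddCommGroup M] [Module K M]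
    [AddCommGroup W] [Module K W] (U U' : Submodule K M) [Module.Finite K U] (π : M →ₗ[K] W)
    (hle : U' ≤ U) (hker : ∀ f ∈ U, π f = 0 ↔ f ∈ U') (hsurj : ∀ w, ∃ f ∈ U, π f = w) :
    Module.finrank K U = Module.finrank K W + Module.finrank K U' := by
  have h := LinearMap.finrank_range_add_finrank_ker (π ∘ₗ U.subtype)
  have h1 : LinearMap.range (π ∘ₗ U.subtype) = ⊤ := by
    refine LinearMap.range_eq_top.2 fun w => ?_
    obtain ⟨f, hf, rfl⟩ := hsurj w
    exact ⟨⟨f, hf⟩, rfl⟩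
  have h2 : LinearMap.ker (π ∘ₗ U.subtype) = U'.comap U.subtype := by
    ext ⟨f, hf⟩
    exact hker f hf
  rw [h1, finrank_top, h2, (Submodule.comapSubtypeEquivOfLe hle).finrank_eq] at h
  exact h.symm

namespace Cover

variable {K : Type u} [Field K] {A : Type u} [Ring A] [Algebra K A] {T : ℕ} (C : Cover K A T)

/-- The solutions of `x f + λ f x = 0`, for `x` the letter `b`. -/
def linKer (b : Bool) (l : K) : Submodule K A :=
  LinearMap.ker (LinearMap.mulLeft K (C.letter b) + l • LinearMap.mulRight K (C.letter b))

theorem mem_linKer {b : Bool} {l : K} {f : A} :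
    f ∈ C.linKer b l ↔ C.letter b * f + l • (f * C.letter b) = 0 := Iff.rfl

/-- The elements of weight `r` that only involve words of lengths between `1` and `4 T`. -/
def core (r : ZMod 4) : Submodule K A :=
  C.weight r ⊓ LinearMap.ker (C.cf true 0) ⊓ LinearMap.ker C.ct ⊓
    ⨅ b, LinearMap.ker (C.cf b (4 * T + 1))

theorem mem_core {r : ZMod 4} {f : A} : f ∈ C.core r ↔
    f ∈ C.weight r ∧ C.cf true 0 f = 0 ∧ C.ct f = 0 ∧ ∀ b, C.cf b (4 * T + 1) f = 0 := by
  simp only [core, Submodule.mem_inf, LinearMap.mem_ker, Submodule.mem_iInf, and_assoc]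

theorem cf_dg_mul_word' (b : Bool) (j : ℕ) (ε : ZMod 4 → K) (b' : Bool) {j' : ℕ}
    (h : 1 ≤ j') (h' : j' ≤ 4 * T + 1) :
    C.cf b j (C.dg ε * C.word b' j') = if b = b' ∧ j = j' then ε else 0 := by
  obtain ⟨m, rfl⟩ : ∃ m, j' = m + 1 := ⟨j' - 1, by omega⟩
  exact C.cf_dg_mul_word b j ε b' (by omega)

theorem ct_dg_mul_word' (ε : ZMod 4 → K) (b' : Bool) {j' : ℕ}
    (h : 1 ≤ j') (h' : j' ≤ 4 * T + 1) : C.ct (C.dg ε * C.word b' j') = 0 := by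
  obtain ⟨m, rfl⟩ : ∃ m, j' = m + 1 := ⟨j' - 1, by omega⟩
  exact C.ct_dg_mul_word ε b' (by omega)

theorem dg_mul_word_mem_core (ε : ZMod 4 → K) (b : Bool) {j : ℕ} (h : 1 ≤ j) (h' : j ≤ 4 * T)
    {r : ZMod 4} (hr : (j : ZMod 4) = r) : C.dg ε * C.word b j ∈ C.core r := by
  refine (C.mem_core).2 ⟨hr ▸ C.dg_mul_word_mem_weight ε b j, ?_, ?_, fun b' => ?_⟩
  · rw [C.cf_dg_mul_word' _ _ _ _ h (by omega), if_neg (by omega)]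
  · rw [C.ct_dg_mul_word' _ _ h (by omega)]
  · rw [C.cf_dg_mul_word' _ _ _ _ h (by omega), if_neg (by omega)]

theorem cast_length (k r : ℕ) : ((4 * k + r : ℕ) : ZMod 4) = r := by
  push_cast
  rw [show (4 : ZMod 4) = 0 from rfl, zero_mul, zero_add]

/-- The representatives run from `1` to `4`: for the class of `0` the value `r = 4` leaves out the
empty word. -/
theorem exists_eq_length {r : ℕ} (h1 : 1 ≤ r) (h4 : r ≤ 4) {j : ℕ} (hj : 1 ≤ j)
    (h : (j : ZMod 4) = r) : ∃ k, j = 4 * k + r := by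
  have := (ZMod.natCast_eq_natCast_iff' j r 4).1 h
  exact ⟨(j - r) / 4, by omega⟩

theorem eq_zero_of_mem_core {r : ℕ} (h1 : 1 ≤ r) (h4 : r ≤ 4) {f : A} (hf : f ∈ C.core r)
    (h : ∀ b k, k < T → C.cf b (4 * k + r) f = 0) : f = 0 := by
  obtain ⟨hw, h0, ht, hT⟩ := (C.mem_core).1 hf
  refine C.ext_coef (by rw [h0, map_zero]) (fun b j hj => ?_) (by rw [ht, map_zero])
  rw [map_zero]
  by_cases hr : ((j + 1 : ℕ) : ZMod 4) = r
  · obtain ⟨k, hk⟩ := exists_eq_length h1 h4 (by omega) hr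
    by_cases hjT : j = 4 * T
    · rw [hjT]; exact hT b
    · rw [hk]; exact h b k (by omega)
  · exact C.cf_eq_zero_of_weight hw b hr

theorem finite_submodule (C : Cover K A T) (U : Submodule K A) : Module.Finite K U := by
  have := C.finite
  exact Module.Finite.of_injective U.subtype U.injective_subtype

theorem sum_ite_fin {M : Type*} [AddCommMonoid M] {n : ℕ} (g : Fin n → M) (k : Fin n) (r : ℕ) :
    ∑ p : Fin n, (if 4 * (k : ℕ) + r = 4 * (p : ℕ) + r then g p else 0) = g k := by
  rw [Finset.sum_eq_single k, if_pos rfl]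
  · intro p _ hp
    rw [if_neg]
    intro h
    exact hp (Fin.ext (by omega))
  · simp

theorem finrank_core {r : ℕ} (h1 : 1 ≤ r) (h4 : r ≤ 4) :
    Module.finrank K (C.core (r : ZMod 4)) = 8 * T := by
  have := C.finite_submodule (C.core (r : ZMod 4))
  rw [finrank_eq_finrank_add_of_surjOn (C.core (r : ZMod 4)) ⊥
    (LinearMap.pi fun b : Bool => LinearMap.pi fun k : Fin T => C.cf b (4 * k + r)) bot_le]
  · simp only [Module.finrank_pi_fintype, Module.finrank_self, Finset.sum_const, Finset.card_univ,
      Fintype.card_bool, Fintype.card_fin, ZMod.card, finrank_bot, smul_eq_mul]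
    ring
  · intro f hf
    rw [Submodule.mem_bot]
    refine ⟨fun h => C.eq_zero_of_mem_core h1 h4 hf fun b k hk => ?_, fun h => by
      rw [h, map_zero]⟩
    exact congrFun (congrFun h b) ⟨k, hk⟩
  · intro g
    refine ⟨∑ b, ∑ k, C.dg (g b k) * C.word b (4 * (k : ℕ) + r), ?_, ?_⟩
    · exact Submodule.sum_mem _ fun b _ => Submodule.sum_mem _ fun k _ =>
        C.dg_mul_word_mem_core _ b (by omega) (by omega) (cast_length k r)
    · funext b k
      simp only [LinearMap.pi_apply, map_sum]
      rw [Finset.sum_eq_single b]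
      · rw [← sum_ite_fin (g b) k r]
        refine Finset.sum_congr rfl fun p _ => ?_
        rw [C.cf_dg_mul_word' _ _ _ _ (by omega) (by omega)]
        simp only [true_and]
      · intro b' _ hb
        refine Finset.sum_eq_zero fun p _ => ?_
        rw [C.cf_dg_mul_word' _ _ _ _ (by omega) (by omega), if_neg fun h => hb h.1.symm]
      · simp

theorem cf_linKer {b : Bool} {l : K} {f : A} (hf : f ∈ C.linKer b l) {m : ℕ} (hm : m ≤ 4 * T) :
    shift (C.cf (!b) m f) + l • (if xor b m.bodd = b then C.cf b m f else 0) = 0 := by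
  have h := congrArg (C.cf b (m + 1)) (C.mem_linKer.1 hf)
  rwa [map_zero, map_add, map_smul, C.cf_letter_mul _ _ hm, C.cf_mul_letter _ _ hm,
    if_pos rfl] at h

/-- The solution of `x f + λ f x = 0` with the given coefficient of a word starting with `x`. -/
def solution (b : Bool) (l : K) (m : ℕ) (ε : ZMod 4 → K) : A :=
  C.dg ε * C.word b m + if m.bodd then 0 else C.dg (-(l • shift.symm ε)) * C.word (!b) m

/-- A word beginning with `b` is killed by `b` from the left. At odd length it also ends in `b` and
is killed from the right; at even length its right product with `b` is compensated by the left
product of the word beginning with the other letter. -/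
theorem solution_mem_linKer (b : Bool) (l : K) {m : ℕ} (hm : 1 ≤ m) (ε : ZMod 4 → K) :
    C.solution b l m ε ∈ C.linKer b l := by
  obtain ⟨m, rfl⟩ : ∃ k, m = k + 1 := ⟨m - 1, by omega⟩
  rw [mem_linKer, solution, mul_add, add_mul]
  have h1 : C.letter b * (C.dg ε * C.word b (m + 1)) = 0 := by
    rw [← mul_assoc, letter_mul_dg, mul_assoc, C.letter_mul_word_self, mul_zero]
  rw [h1, zero_add, mul_assoc]
  by_cases hb : m.bodd
  · have hb' : (m + 1).bodd = false := by rw [Nat.bodd_succ, hb]; rfl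
    simp only [hb', Bool.false_eq_true, if_false]
    rw [C.word_mul_letter_of_ne (by rw [hb]; cases b <;> decide), mul_assoc,
      C.word_mul_letter_of_eq (by rw [hb]; cases b <;> decide), mul_zero, add_zero,
      ← mul_assoc, letter_mul_dg, mul_assoc, ← C.word_succ, map_neg, map_smul,
      LinearEquiv.apply_symm_apply, map_neg, map_smul, neg_mul, smul_mul_assoc, neg_add_cancel]
  · have hb' : (m + 1).bodd = true := by
      rw [Nat.bodd_succ]; simp [hb]
    simp only [hb', if_true]
    rw [C.word_mul_letter_of_eq (by simp [hb]), mul_zero, mul_zero, zero_mul, zero_add, add_zero,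
      smul_zero]

theorem solution_mem_core (b : Bool) (l : K) {m : ℕ} (hm : 1 ≤ m) (hm' : m ≤ 4 * T)
    (ε : ZMod 4 → K) {r : ZMod 4} (hr : (m : ZMod 4) = r) : C.solution b l m ε ∈ C.core r := by
  refine add_mem (C.dg_mul_word_mem_core _ _ hm hm' hr) ?_
  split_ifs
  · exact zero_mem _
  · exact C.dg_mul_word_mem_core _ _ hm hm' hr

theorem cf_solution (b : Bool) (l : K) {m : ℕ} (hm : 1 ≤ m) (hm' : m ≤ 4 * T)
    (ε : ZMod 4 → K) (j : ℕ) : C.cf b j (C.solution b l m ε) = if j = m then ε else 0 := by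
  rw [solution, map_add, C.cf_dg_mul_word' _ _ _ _ hm (by omega)]
  simp only [true_and]
  split_ifs with h1 h2 h2
  · rw [map_zero, add_zero]
  · rw [C.cf_dg_mul_word' _ _ _ _ hm (by omega), if_neg (by simp), add_zero]
  · rw [map_zero, add_zero]
  · rw [C.cf_dg_mul_word' _ _ _ _ hm (by omega), if_neg (by simp), add_zero]

/-- The coefficients of words beginning with `b` are free and determine all others: four coordinates
for each of `T` lengths. -/
theorem finrank_core_inf_linKer {r : ℕ} (h1 : 1 ≤ r) (h4 : r ≤ 4) (b : Bool) (l : K) :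
    Module.finrank K (C.core (r : ZMod 4) ⊓ C.linKer b l : Submodule K A) = 4 * T := by
  have := C.finite_submodule (C.core (r : ZMod 4) ⊓ C.linKer b l)
  rw [finrank_eq_finrank_add_of_surjOn (C.core (r : ZMod 4) ⊓ C.linKer b l) ⊥
    (LinearMap.pi fun k : Fin T => C.cf b (4 * k + r)) bot_le]
  · simp only [Module.finrank_pi_fintype, Module.finrank_self, Finset.sum_const, Finset.card_univ,
      Fintype.card_fin, ZMod.card, finrank_bot, smul_eq_mul]
    ring
  · rintro f ⟨hf, hl⟩
    rw [Submodule.mem_bot]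
    refine ⟨fun h => C.eq_zero_of_mem_core h1 h4 hf fun b' k hk => ?_, fun h => by
      rw [h, map_zero]⟩
    have hb : C.cf b (4 * k + r) f = 0 := congrFun h ⟨k, hk⟩
    by_cases hbb : b' = b
    · rw [hbb, hb]
    · have := C.cf_linKer hl (m := 4 * k + r) (by omega)
      rw [hb, ite_self, smul_zero, add_zero, ← Bool.eq_not_of_ne hbb] at this
      simpa using this
  · intro g
    refine ⟨∑ k : Fin T, C.solution b l (4 * (k : ℕ) + r) (g k), ⟨?_, ?_⟩, ?_⟩
    · exact Submodule.sum_mem _ fun k _ =>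
        C.solution_mem_core b l (by omega) (by omega) _ (cast_length k r)
    · exact Submodule.sum_mem _ fun k _ => C.solution_mem_linKer b l (by omega) _
    · funext k
      simp only [LinearMap.pi_apply, map_sum]
      rw [← sum_ite_fin g k r]
      exact Finset.sum_congr rfl fun p _ => C.cf_solution b l (by omega) (by omega) _ _

/-- The periodic function with the given values. -/
def periodic (g : ZMod 2 → K) (i : ZMod 4) : K := g (ZMod.castHom (show 2 ∣ 4 by norm_num) _ i)

theorem shift_shift_periodic (g : ZMod 2 → K) : shift (shift (periodic g)) = periodic g := by
  funext i
  rw [shift_apply, shift_apply, periodic, periodic, map_add, map_add, map_one, add_assoc,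
    show (1 + 1 : ZMod 2) = 0 from rfl, add_zero]

theorem eq_zero_of_shift_shift {ε : ZMod 4 → K} (h : shift (shift ε) = ε) (h0 : ε 0 = 0)
    (h1 : ε 1 = 0) : ε = 0 := by
  funext i
  have e0 := congrFun h 0
  have e1 := congrFun h 1
  simp only [shift_apply] at e0 e1
  fin_cases i
  · exact h0
  · exact h1
  · exact e0.trans h0
  · exact e1.trans h1

/-- The other letter imposes the same kind of equation with the two coefficient functions exchanged.
Both hold together when translation by two vertices fixes the coefficients, since the scalars are
inverse to each other. -/
theorem solution_eq_solution (b : Bool) {l l' : K} (hl : l * l' = 1) {m : ℕ} (hm : m.bodd = false)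
    {ε : ZMod 4 → K} (h : shift (shift ε) = ε) :
    C.solution b l m ε = C.solution (!b) l' m (-(l • shift.symm ε)) := by
  have h' : shift.symm (shift.symm ε) = ε := by
    conv_lhs => rw [← h]
    rw [LinearEquiv.symm_apply_apply, LinearEquiv.symm_apply_apply]
  rw [solution, solution, hm]
  simp only [Bool.false_eq_true, if_false, Bool.not_not, map_neg, map_smul, h', smul_neg, smul_smul,
    neg_neg, mul_comm l' l, hl, one_smul]
  rw [add_comm]

/-- Combining the two equations gives `shift (shift ε) = ε` because `l * l' = 1`. So for each of `T`
lengths only the values at the vertices `0` and `1` are free. -/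
theorem finrank_core_inf_linKer_inf_linKer {r : ℕ} (h1 : 1 ≤ r) (h4 : r ≤ 4)
    (hr : r.bodd = false) {l l' : K} (hl : l * l' = 1) :
    Module.finrank K (C.core (r : ZMod 4) ⊓ (C.linKer true l ⊓ C.linKer false l') :
      Submodule K A) = 2 * T := by
  have hbodd : ∀ k, (4 * k + r).bodd = false := fun k => by
    rw [Nat.bodd_add, CoverRel.bodd_four_mul, hr]; rfl
  have := C.finite_submodule (C.core (r : ZMod 4) ⊓ (C.linKer true l ⊓ C.linKer false l'))
  rw [finrank_eq_finrank_add_of_surjOn (C.core (r : ZMod 4) ⊓ (C.linKer true l ⊓ C.linKer false l'))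
    ⊥ (LinearMap.pi fun k : Fin T => LinearMap.funLeft K K (fun j : ZMod 2 =>
      if j = 0 then (0 : ZMod 4) else 1) ∘ₗ C.cf true (4 * k + r)) bot_le]
  · simp only [Module.finrank_pi_fintype, Module.finrank_self, Finset.sum_const, Finset.card_univ,
      Fintype.card_fin, ZMod.card, finrank_bot, smul_eq_mul]
    ring
  · rintro f ⟨hf, ht, hff⟩
    rw [Submodule.mem_bot]
    refine ⟨fun h => ?_, fun h => by rw [h, map_zero]⟩
    have key : ∀ k, k < T → C.cf true (4 * k + r) f = 0 := by
      intro k hk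
      have e1 := C.cf_linKer ht (m := 4 * k + r) (by omega)
      have e2 := C.cf_linKer hff (m := 4 * k + r) (by omega)
      rw [hbodd, Bool.xor_false, if_pos rfl] at e1 e2
      have hk0 : C.cf true (4 * k + r) f 0 = 0 := congrFun (congrFun h ⟨k, hk⟩) 0
      have hk1 : C.cf true (4 * k + r) f 1 = 0 := congrFun (congrFun h ⟨k, hk⟩) 1
      refine eq_zero_of_shift_shift ?_ hk0 hk1
      have e3 := congrArg shift e2
      rw [Bool.not_false, map_add, map_smul, map_zero] at e3
      rw [Bool.not_true] at e1
      rw [eq_neg_of_add_eq_zero_left e1, smul_neg, smul_smul, mul_comm l' l, hl, one_smul] at e3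
      rw [← sub_eq_add_neg] at e3
      exact sub_eq_zero.1 e3
    refine C.eq_zero_of_mem_core h1 h4 hf fun b' k hk => ?_
    cases b'
    · have := C.cf_linKer ht (m := 4 * k + r) (by omega)
      rw [key k hk, ite_self, smul_zero, add_zero] at this
      simpa using this
    · exact key k hk
  · intro g
    refine ⟨∑ k : Fin T, C.solution true l (4 * (k : ℕ) + r) (periodic (g k)),
      ⟨?_, ?_, ?_⟩, ?_⟩
    · exact Submodule.sum_mem _ fun k _ =>
        C.solution_mem_core true l (by omega) (by omega) _ (cast_length k r)
    · exact Submodule.sum_mem _ fun k _ => C.solution_mem_linKer true l (by omega) _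
    · refine Submodule.sum_mem _ fun k _ => ?_
      rw [C.solution_eq_solution true hl (hbodd k) (shift_shift_periodic _)]
      exact C.solution_mem_linKer false l' (by omega) _
    · funext k j
      simp only [LinearMap.pi_apply, map_sum, LinearMap.comp_apply]
      have : ∀ p : Fin T, C.cf true (4 * (k : ℕ) + r)
          (C.solution true l (4 * (p : ℕ) + r) (periodic (g p))) =
          if 4 * (k : ℕ) + r = 4 * (p : ℕ) + r then periodic (g p) else 0 :=
        fun p => C.cf_solution true l (by omega) (by omega) _ _
      simp only [this]
      rw [← map_sum, sum_ite_fin (fun p => periodic (g p)) k r, LinearMap.funLeft_apply]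
      fin_cases j <;> rfl

end Cover

end

noncomputable section

namespace Cover

variable {K : Type u} [Field K] {A : Type u} [Ring A] [Algebra K A] {T : ℕ} (C : Cover K A T)

attribute [local instance] instModuleTensorProductMop isScalarTower_env

/-! ### Dimensions of the spaces of cochains -/

theorem core_le_weight (r : ZMod 4) : C.core r ≤ C.weight r := fun _ h => ((C.mem_core).1 h).1

theorem cf_zero_of_weight {r : ZMod 4} (hr : (0 : ZMod 4) ≠ r) {f : A} (hf : f ∈ C.weight r) :
    C.cf true 0 f = 0 :=
  C.cf_eq_zero_of_weight hf true (by simpa using hr)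

theorem cf_one_of_weight {r : ZMod 4} (hr : (1 : ZMod 4) ≠ r) {f : A} (hf : f ∈ C.weight r)
    (b : Bool) : C.cf b 1 f = 0 :=
  C.cf_eq_zero_of_weight hf b (by simpa using hr)

theorem cf_cow_of_weight {r : ZMod 4} (hr : (1 : ZMod 4) ≠ r) {f : A} (hf : f ∈ C.weight r)
    (b : Bool) : C.cf b (4 * T + 1) f = 0 :=
  C.cf_eq_zero_of_weight hf b (by rwa [cast_four_mul_add_one])

theorem weight_three_eq_core : C.weight 3 = C.core 3 := by
  refine le_antisymm (fun f hf => ?_) (C.core_le_weight 3)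
  exact (C.mem_core).2 ⟨hf, C.cf_zero_of_weight (by decide) hf,
    C.ct_eq_zero_of_weight hf (by decide), C.cf_cow_of_weight (by decide) hf⟩

theorem mem_core_zero_iff {f : A} (hf : f ∈ C.weight 0) : f ∈ C.core 0 ↔ C.cf true 0 f = 0 := by
  refine ⟨fun h => ((C.mem_core).1 h).2.1, fun h => ?_⟩
  exact (C.mem_core).2 ⟨hf, h, C.ct_eq_zero_of_weight hf (by decide),
    C.cf_cow_of_weight (by decide) hf⟩

theorem mem_core_two_iff {f : A} (hf : f ∈ C.weight 2) : f ∈ C.core 2 ↔ C.ct f = 0 := by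
  refine ⟨fun h => ((C.mem_core).1 h).2.2.1, fun h => ?_⟩
  exact (C.mem_core).2 ⟨hf, C.cf_zero_of_weight (by decide) hf, h,
    C.cf_cow_of_weight (by decide) hf⟩

theorem mem_core_one_iff {f : A} (hf : f ∈ C.weight 1) :
    f ∈ C.core 1 ↔ ∀ b, C.cf b (4 * T + 1) f = 0 := by
  refine ⟨fun h => ((C.mem_core).1 h).2.2.2, fun h => ?_⟩
  exact (C.mem_core).2 ⟨hf, C.cf_zero_of_weight (by decide) hf,
    C.ct_eq_zero_of_weight hf (by decide), h⟩

theorem finrank_weight_three : Module.finrank K (C.weight 3) = 8 * T := by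
  rw [weight_three_eq_core]
  exact C.finrank_core (r := 3) (by omega) (by omega)

theorem dg_mem_weight (ε : ZMod 4 → K) : C.dg ε ∈ C.weight 0 := by
  simpa using C.dg_mul_word_mem_weight ε true 0

theorem finrank_weight_zero : Module.finrank K (C.weight 0) = 8 * T + 4 := by
  have := C.finite_submodule (C.weight 0)
  rw [finrank_eq_finrank_add_of_surjOn (C.weight 0) (C.core 0) (C.cf true 0) (C.core_le_weight 0)
    (fun f hf => (C.mem_core_zero_iff hf).symm)
    (fun ε => ⟨C.dg ε, C.dg_mem_weight ε, by rw [cf_dg, if_pos rfl]⟩)]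
  have h : Module.finrank K (C.core 0) = 8 * T := C.finrank_core (r := 4) (by omega) (by omega)
  rw [h]
  simp [add_comm]

theorem dg_mul_top_mem_weight (ε : ZMod 4 → K) (b : Bool) :
    C.dg ε * C.word b (4 * T + 2) ∈ C.weight 2 := by
  have := C.dg_mul_word_mem_weight ε b (4 * T + 2)
  rwa [cast_length] at this

theorem exists_ct_eq (ε : ZMod 4 → K) : C.ct (C.dg ε * C.word false (4 * T + 2)) = ε := by
  rw [ct_dg_mul_top, topSign]
  simp

theorem finrank_weight_two : Module.finrank K (C.weight 2) = 8 * T + 4 := by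
  have := C.finite_submodule (C.weight 2)
  rw [finrank_eq_finrank_add_of_surjOn (C.weight 2) (C.core 2) C.ct (C.core_le_weight 2)
    (fun f hf => (C.mem_core_two_iff hf).symm)
    (fun ε => ⟨_, C.dg_mul_top_mem_weight ε false, C.exists_ct_eq ε⟩)]
  have h : Module.finrank K (C.core 2) = 8 * T := C.finrank_core (r := 2) (by omega) (by omega)
  rw [h]
  simp [add_comm]

theorem finrank_weight_one : Module.finrank K (C.weight 1) = 8 * T + 8 := by
  have := C.finite_submodule (C.weight 1)
  have hw : ∀ (ε : ZMod 4 → K) (b : Bool), C.dg ε * C.word b (4 * T + 1) ∈ C.weight 1 := by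
    intro ε b
    have := C.dg_mul_word_mem_weight ε b (4 * T + 1)
    rwa [cast_four_mul_add_one] at this
  rw [finrank_eq_finrank_add_of_surjOn (C.weight 1) (C.core 1)
    (LinearMap.pi fun b : Bool => C.cf b (4 * T + 1)) (C.core_le_weight 1)
    (fun f hf => by rw [C.mem_core_one_iff hf, funext_iff]; rfl)
    (fun ε => ⟨∑ b, C.dg (ε b) * C.word b (4 * T + 1), Submodule.sum_mem _ fun b _ => hw _ b, ?_⟩)]
  · have h : Module.finrank K (C.core 1) = 8 * T := C.finrank_core (r := 1) (by omega) (by omega)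
    rw [h]
    simp only [Module.finrank_pi_fintype, Module.finrank_self, Finset.sum_const, Finset.card_univ,
      Fintype.card_bool, ZMod.card, smul_eq_mul]
    ring
  · funext b
    simp only [LinearMap.pi_apply, map_sum, C.cf_dg_mul_word _ _ _ _ le_rfl, and_true]
    rw [Finset.sum_ite_eq]
    simp

theorem word_top_mem_linKer (ε : ZMod 4 → K) (b b' : Bool) (l : K) :
    C.dg ε * C.word b (4 * T + 2) ∈ C.linKer b' l := by
  have h : C.letter b' * C.word b (4 * T + 2) = 0 := by
    rcases C.letter_mul_word_cases b' b (4 * T + 2) with h | h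
    · exact h
    · rw [h]; exact C.word_top_succ _
  rw [mem_linKer, ← mul_assoc, letter_mul_dg, mul_assoc, mul_assoc, C.word_top_mul_letter, h,
    mul_zero, mul_zero, smul_zero, add_zero]

theorem finrank_weight_two_inf_linKer (b : Bool) (l : K) :
    Module.finrank K (C.weight 2 ⊓ C.linKer b l : Submodule K A) = 4 * T + 4 := by
  have := C.finite_submodule (C.weight 2 ⊓ C.linKer b l)
  rw [finrank_eq_finrank_add_of_surjOn (C.weight 2 ⊓ C.linKer b l) (C.core 2 ⊓ C.linKer b l) C.ct
    (inf_le_inf_right _ (C.core_le_weight 2))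
    (fun f hf => by rw [Submodule.mem_inf, C.mem_core_two_iff hf.1]; exact (and_iff_left hf.2).symm)
    (fun ε => ⟨_, ⟨C.dg_mul_top_mem_weight ε false, C.word_top_mem_linKer _ _ _ _⟩,
      C.exists_ct_eq ε⟩)]
  have h : Module.finrank K (C.core 2 ⊓ C.linKer b l : Submodule K A) = 4 * T :=
    C.finrank_core_inf_linKer (r := 2) (by omega) (by omega) b l
  rw [h]
  simp [add_comm]

theorem finrank_weight_two_inf_linKer_inf_linKer {l l' : K} (hl : l * l' = 1) :
    Module.finrank K (C.weight 2 ⊓ (C.linKer true l ⊓ C.linKer false l') : Submodule K A) =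
      2 * T + 4 := by
  have := C.finite_submodule (C.weight 2 ⊓ (C.linKer true l ⊓ C.linKer false l'))
  rw [finrank_eq_finrank_add_of_surjOn (C.weight 2 ⊓ (C.linKer true l ⊓ C.linKer false l'))
    (C.core 2 ⊓ (C.linKer true l ⊓ C.linKer false l')) C.ct
    (inf_le_inf_right _ (C.core_le_weight 2))
    (fun f hf => by rw [Submodule.mem_inf, C.mem_core_two_iff hf.1]; exact (and_iff_left hf.2).symm)
    (fun ε => ⟨_, ⟨C.dg_mul_top_mem_weight ε false, C.word_top_mem_linKer _ _ _ _,
      C.word_top_mem_linKer _ _ _ _⟩, C.exists_ct_eq ε⟩)]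
  have h : Module.finrank K (C.core 2 ⊓ (C.linKer true l ⊓ C.linKer false l') : Submodule K A) =
      2 * T := C.finrank_core_inf_linKer_inf_linKer (r := 2) (by omega) (by omega) rfl hl
  rw [h]
  simp [add_comm]

/-- Going once around the four vertices multiplies `ε` by `c⁴`. In the applications `c` is, up to
sign, a nontrivial power of `s`, and this is where it matters that the product of the `qᵢ` is not a
root of unity. -/
theorem eq_zero_of_shift_eq_smul {ε : ZMod 4 → K} {c : K} (h : shift ε = c • ε) (hc : c ^ 4 ≠ 1) :
    ε = 0 := by
  have h' : ∀ i, ε (i + 1) = c * ε i := fun i => congrFun h i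
  have h4 : ∀ i, ε i = c ^ 4 * ε i := fun i => by
    conv_lhs => rw [show i = i + 1 + 1 + 1 + 1 by
      rw [add_assoc, add_assoc, add_assoc, show (1 + (1 + (1 + 1)) : ZMod 4) = 0 from rfl,
        add_zero]]
    rw [h', h', h', h']
    ring
  funext i
  have : (1 - c ^ 4) * ε i = 0 := by rw [sub_mul, one_mul, ← h4, sub_self]
  exact (mul_eq_zero.1 this).resolve_left (sub_ne_zero.2 hc.symm)

/-- The dimension of the centre. -/
theorem finrank_weight_zero_inf_linKer :
    Module.finrank K (C.weight 0 ⊓ (C.linKer true (-1) ⊓ C.linKer false (-1)) : Submodule K A) =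
      2 * T + 1 := by
  have := C.finite_submodule (C.weight 0 ⊓ (C.linKer true (-1) ⊓ C.linKer false (-1)))
  -- Commuting with the letter `x` makes the vertex coefficients invariant under the shift, hence
  -- constant.
  have hc : ∀ f ∈ C.linKer true (-1), ∀ i, C.cf true 0 f i = C.cf true 0 f 0 := by
    intro f hf
    have h := congrArg (C.cf true (0 + 1)) (C.mem_linKer.1 hf)
    rw [map_zero, map_add, map_smul, C.cf_letter_mul _ _ (by omega), if_pos rfl,
      C.cf_mul_letter _ _ (by omega), Nat.bodd_zero, Bool.xor_false, if_pos rfl,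
      neg_one_smul, ← sub_eq_add_neg, sub_eq_zero] at h
    have h' : ∀ i, C.cf true 0 f (i + 1) = C.cf true 0 f i := fun i => congrFun h i
    intro i
    fin_cases i
    · rfl
    · exact h' 0
    · exact (h' 1).trans (h' 0)
    · exact (h' 2).trans ((h' 1).trans (h' 0))
  rw [finrank_eq_finrank_add_of_surjOn (C.weight 0 ⊓ (C.linKer true (-1) ⊓ C.linKer false (-1)))
    (C.core 0 ⊓ (C.linKer true (-1) ⊓ C.linKer false (-1)))
    (LinearMap.proj (R := K) (φ := fun _ : ZMod 4 => K) 0 ∘ₗ C.cf true 0)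
    (inf_le_inf_right _ (C.core_le_weight 0))
    (fun f hf => ?_) (fun c => ⟨c • 1, ⟨?_, ?_, ?_⟩, ?_⟩)]
  · have h : Module.finrank K (C.core 0 ⊓ (C.linKer true (-1) ⊓ C.linKer false (-1)) :
        Submodule K A) = 2 * T :=
      C.finrank_core_inf_linKer_inf_linKer (r := 4) (by omega) (by omega) rfl (by ring)
    rw [h, Module.finrank_self, add_comm]
  · rw [Submodule.mem_inf, C.mem_core_zero_iff hf.1]
    refine ⟨fun h => ⟨funext fun i => (hc f hf.2.1 i).trans h, hf.2⟩, fun ⟨h, _⟩ => ?_⟩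
    rw [LinearMap.comp_apply, h]
    rfl
  · exact Submodule.smul_mem _ _ fun i => by rw [mul_one, one_mul, add_zero]
  · exact Submodule.smul_mem _ _ (by
      rw [mem_linKer, mul_one, one_mul, neg_one_smul, add_neg_cancel])
  · exact Submodule.smul_mem _ _ (by
      rw [mem_linKer, mul_one, one_mul, neg_one_smul, add_neg_cancel])
  · rw [map_smul, LinearMap.comp_apply, ← C.e_sum, map_sum]
    simp only [cf_e, if_true]
    simp

/-! ### Families indexed by bidegrees -/

/-- The entries of a family of degree `n` on the side of the letter `b`. -/
def strand (n : ℕ) (f : ℕ → ℕ → A) (b : Bool) (c : ℕ) : A := if b then f (n - c) c else f c (n - c)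

/-- The families of degree `n` whose entries lie in given subspaces. -/
def split (n : ℕ) (L : Bool → ℕ → Submodule K A) (M : Submodule K A) :
    Submodule K (ℕ → ℕ → A) where
  carrier := {f | (∀ i j, i + j ≠ n → f i j = 0) ∧ (∀ b c, 2 * c < n → strand n f b c ∈ L b c) ∧
    ∀ c, 2 * c = n → f c c ∈ M}
  zero_mem' := ⟨fun _ _ _ => rfl, fun b c _ => by cases b <;> exact zero_mem _,
    fun _ _ => zero_mem _⟩
  add_mem' := fun {f g} hf hg => ⟨fun i j h => by
      rw [Pi.add_apply, Pi.add_apply, hf.1 i j h, hg.1 i j h, add_zero],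
    fun b c h => by
      have := add_mem (hf.2.1 b c h) (hg.2.1 b c h)
      cases b <;> exact this,
    fun c h => add_mem (hf.2.2 c h) (hg.2.2 c h)⟩
  smul_mem' := fun a f hf => ⟨fun i j h => by
      rw [Pi.smul_apply, Pi.smul_apply, hf.1 i j h, smul_zero],
    fun b c h => by
      have := Submodule.smul_mem _ a (hf.2.1 b c h)
      cases b <;> exact this,
    fun c h => Submodule.smul_mem _ a (hf.2.2 c h)⟩

/-- The family with given entries. -/
def assemble (n : ℕ) (G : Bool → ℕ → A) (m : A) (i j : ℕ) : A :=
  if i + j = n then if j < i then G true j else if i < j then G false i else m else 0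

theorem strand_assemble {n : ℕ} (G : Bool → ℕ → A) (m : A) (b : Bool) {c : ℕ} (h : 2 * c < n) :
    strand n (assemble n G m) b c = G b c := by
  cases b
  · simp only [strand, assemble, Bool.false_eq_true, if_false]
    rw [if_pos (by omega), if_neg (by omega), if_pos (by omega)]
  · simp only [strand, assemble, if_true]
    rw [if_pos (by omega), if_pos (by omega)]

theorem assemble_diag {n : ℕ} (G : Bool → ℕ → A) (m : A) {c : ℕ} (h : 2 * c = n) :
    assemble n G m c c = m := by
  rw [assemble, if_pos (by omega), if_neg (by omega), if_neg (by omega)]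

theorem ext_of_strand {n : ℕ} {f g : ℕ → ℕ → A} (hf : ∀ i j, i + j ≠ n → f i j = 0)
    (hg : ∀ i j, i + j ≠ n → g i j = 0)
    (h : ∀ b c, 2 * c < n → strand n f b c = strand n g b c) (h' : ∀ c, 2 * c = n → f c c = g c c) :
    f = g := by
  funext i j
  by_cases hij : i + j = n
  · rcases lt_trichotomy i j with hl | rfl | hl
    · have := h false i (by omega)
      simp only [strand, Bool.false_eq_true, if_false] at this
      rwa [show n - i = j by omega] at this
    · exact h' i (by omega)
    · have := h true j (by omega)
      simp only [strand, if_true] at this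
      rwa [show n - j = i by omega] at this
  · rw [hf i j hij, hg i j hij]

/-- There are `(n + 1) / 2` bidegrees strictly on either side of the diagonal, and for even `n` one
more on it. For odd `n` no diagonal entry exists, and `hM` makes the corresponding factor trivial.
-/
theorem finrank_split (C : Cover K A T) {n : ℕ} (L : Bool → ℕ → Submodule K A)
    (M : Submodule K A) (hM : (∃ c, n = 2 * c + 1) → M = ⊥) :
    Module.finrank K (split n L M) =
      ∑ b : Bool, ∑ c : Fin ((n + 1) / 2), Module.finrank K (L b c) + Module.finrank K M := by
  have hL : ∀ b c, Module.Finite K (L b c) := fun b c => C.finite_submodule _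
  have hfM : Module.Finite K M := C.finite_submodule _
  let φ : split n L M →ₗ[K]
      ((∀ b : Bool, ∀ c : Fin ((n + 1) / 2), L b c) × M) :=
    { toFun := fun f => ⟨fun b c => ⟨strand n f.1 b c, f.2.2.1 b c (by omega)⟩,
        ⟨f.1 (n / 2) (n / 2), by
          by_cases h : 2 * (n / 2) = n
          · exact f.2.2.2 _ h
          · rw [f.2.1 _ _ (by omega)]
            exact zero_mem _⟩⟩
      map_add' := fun f g => by
        refine Prod.ext ?_ rfl
        funext b c
        cases b <;> rfl
      map_smul' := fun a f => by
        refine Prod.ext ?_ rfl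
        funext b c
        cases b <;> rfl }
  have hφ : Function.Bijective φ := by
    constructor
    · intro f g h
      have h1 := congrArg Prod.fst h
      have h2 := congrArg Prod.snd h
      refine Subtype.ext (ext_of_strand f.2.1 g.2.1 (fun b c hc => ?_) (fun c hc => ?_))
      · exact congrArg Subtype.val (congrFun (congrFun h1 b) ⟨c, by omega⟩)
      · have := congrArg Subtype.val h2
        obtain rfl : c = n / 2 := by omega
        exact this
    · rintro ⟨G, m⟩
      let G' : Bool → ℕ → A := fun b c => if h : c < (n + 1) / 2 then (G b ⟨c, h⟩).1 else 0
      refine ⟨⟨assemble n G' m.1, fun i j h => if_neg h, fun b c hc => ?_, fun c hc => ?_⟩, ?_⟩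
      · rw [strand_assemble _ _ _ hc]
        simp only [G']
        rw [dif_pos (by omega)]
        exact (G b ⟨c, by omega⟩).2
      · rw [assemble_diag _ _ hc]
        exact m.2
      · refine Prod.ext ?_ (Subtype.ext ?_)
        · funext b c
          refine Subtype.ext ?_
          change strand n (assemble n G' m.1) b c = _
          rw [strand_assemble _ _ _ (by omega)]
          simp only [G']
          rw [dif_pos c.2]
        · change assemble n G' m.1 (n / 2) (n / 2) = m.1
          by_cases h : 2 * (n / 2) = n
          · exact assemble_diag _ _ h
          · have hm := hM ⟨n / 2, by omega⟩
            have hm' : m.1 = 0 := (Submodule.mem_bot K).1 (hm.le m.2)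
            rw [hm', assemble, if_neg (by omega)]
  rw [(LinearEquiv.ofBijective φ hφ).finrank_eq, Module.finrank_prod, Module.finrank_pi_fintype]
  congr 1
  refine Finset.sum_congr rfl fun b _ => ?_
  rw [Module.finrank_pi_fintype]

theorem finrank_split_const (C : Cover K A T) {n : ℕ} (L : Bool → ℕ → Submodule K A)
    (M : Submodule K A) (hM : (∃ c, n = 2 * c + 1) → M = ⊥) {d : ℕ}
    (hd : ∀ b c, 2 * c < n → Module.finrank K (L b c) = d) :
    Module.finrank K (split n L M) = 2 * ((n + 1) / 2) * d + Module.finrank K M := by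
  rw [C.finrank_split L M hM]
  have : ∀ (b : Bool) (c : Fin ((n + 1) / 2)), Module.finrank K (L b c) = d :=
    fun b c => hd b c (by omega)
  simp only [this, Finset.sum_const, Finset.card_univ, Fintype.card_bool, Fintype.card_fin,
    smul_eq_mul]
  ring

theorem mem_cochain_iff {n : ℕ} {f : ℕ → ℕ → A} : f ∈ C.cochain n ↔
    f ∈ split n (fun _ _ => C.weight n) (if 2 * (n / 2) = n then C.weight n else ⊥) := by
  constructor
  · intro h
    refine ⟨h.1, fun b c _ => ?_, fun c hc => ?_⟩
    · cases b <;> exact h.2 _ _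
    · rw [if_pos (by omega)]
      exact h.2 _ _
  · intro h
    refine ⟨h.1, fun i j => ?_⟩
    by_cases hij : i + j = n
    · rcases lt_trichotomy i j with hl | rfl | hl
      · have := h.2.1 false i (by omega)
        simp only [strand, Bool.false_eq_true, if_false] at this
        rwa [show n - i = j by omega] at this
      · have := h.2.2 i (by omega)
        rwa [if_pos (by omega)] at this
      · have := h.2.1 true j (by omega)
        simp only [strand, if_true] at this
        rwa [show n - j = i by omega] at this
    · rw [h.1 i j hij]
      exact zero_mem _

theorem finrank_cochain (n : ℕ) :
    Module.finrank K (C.cochain n) = (n + 1) * Module.finrank K (C.weight n) := by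
  have : C.cochain n = split n (fun _ _ => C.weight n)
      (if 2 * (n / 2) = n then C.weight n else ⊥) := by
    ext f; exact C.mem_cochain_iff
  rw [this, C.finrank_split_const _ _ (fun ⟨c, hc⟩ => if_neg (by omega)) (fun _ _ _ => rfl)]
  by_cases h : 2 * (n / 2) = n
  · rw [if_pos h]
    have : n + 1 = 2 * ((n + 1) / 2) + 1 := by omega
    conv_rhs => rw [this]
    ring
  · rw [if_neg h, finrank_bot, add_zero]
    congr 1
    omega

end Cover

end

noncomputable section

/-! ### Dimensions of the spaces of cocycles in degrees not congruent to `1` -/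

namespace Cover

variable {K : Type u} [Field K] {A : Type u} [Ring A] [Algebra K A] {T : ℕ} (C : Cover K A T)

open CoverRel (tm)

attribute [local instance] instModuleTensorProductMop isScalarTower_env

theorem cob_strand (f : ℕ → ℕ → A) (b : Bool) {c k : ℕ} (h : c ≤ k) :
    (if b then C.cob f (k + 1) c else C.cob f c (k + 1)) =
      C.lin b (k + 1 - c) c • (if b then f k c else f c k) +
        (if c = 0 then 0
          else C.hvy b (k + 1 - c) c • (if b then f (k + 1) (c - 1) else f (c - 1) (k + 1))) := by
  rcases c with _ | c
  · rw [if_pos rfl, add_zero]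
    cases b <;> rfl
  · rw [if_neg (Nat.succ_ne_zero c), Nat.add_sub_cancel]
    have hl : ∀ b, C.dgen b k (c + 1) = C.lin b (k + 1 - (c + 1)) (c + 1) := fun b => by
      rw [CoverRel.dgen, if_pos h]
    have hh : ∀ b, C.dgen b c (k + 1) = C.hvy (!b) (k + 1 - (c + 1)) (c + 1) := fun b => by
      rw [CoverRel.dgen, if_neg (by omega), if_neg (by omega),
        show k + 1 - c - 1 = k + 1 - (c + 1) by omega]
    cases b
    · simp only [Bool.false_eq_true, if_false, cob]
      rw [add_comm, CoverRel.d₁, CoverRel.d₂, hl, hh, Bool.not_true]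
    · simp only [if_true, cob]
      rw [CoverRel.d₁, CoverRel.d₂, hl, hh, Bool.not_false]

theorem cob_diag (f : ℕ → ℕ → A) (c : ℕ) : C.cob f (c + 1) (c + 1) =
    C.fox true (c + 1) • f (c + 1) c + C.fox false (c + 1) • f c (c + 1) := by
  rw [cob, CoverRel.d₁, CoverRel.d₂, CoverRel.dgen, if_neg (by omega), if_pos rfl, CoverRel.dgen,
    if_neg (by omega), if_pos rfl, add_comm, Bool.not_true, Bool.not_false]

/-- Off the diagonal a coboundary entry involves only neighbouring entries of one strand. In odd
degree `2c + 1` the strands meet in the coboundary entry at `(c + 1, c + 1)`; in even degree they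
share the diagonal cochain entry, which is why the condition includes `2 * c = n`. -/
theorem mem_cocycle_iff {n : ℕ} {f : ℕ → ℕ → A} : f ∈ C.cocycle n ↔ f ∈ C.cochain n ∧
    (∀ b c, 2 * c ≤ n → C.lin b (n + 1 - 2 * c) c • strand n f b c +
      (if c = 0 then 0 else C.hvy b (n + 1 - 2 * c) c • strand n f b (c - 1)) = 0) ∧
    ∀ c, 2 * c + 1 = n →
      C.fox true (c + 1) • f (c + 1) c + C.fox false (c + 1) • f c (c + 1) = 0 := by
  have key : ∀ b c, 2 * c ≤ n → C.lin b (n + 1 - 2 * c) c • strand n f b c +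
      (if c = 0 then 0 else C.hvy b (n + 1 - 2 * c) c • strand n f b (c - 1)) =
      if b then C.cob f (n - c + 1) c else C.cob f c (n - c + 1) := by
    intro b c hc
    rw [C.cob_strand f b (by omega), show n - c + 1 - c = n + 1 - 2 * c by omega]
    congr 1
    by_cases h0 : c = 0
    · rw [if_pos h0, if_pos h0]
    · rw [if_neg h0, if_neg h0, strand, show n - (c - 1) = n - c + 1 by omega]
  constructor
  · rintro ⟨hf, hc⟩
    refine ⟨hf, fun b c h => ?_, fun c _ => ?_⟩
    · rw [key b c h, hc, hc, ite_self]
    · rw [← cob_diag, hc]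
  · rintro ⟨hf, h1, h2⟩
    refine ⟨hf, fun i j => ?_⟩
    by_cases hij : i + j = n + 1
    · rcases lt_trichotomy i j with hl | rfl | hl
      · have := key false i (by omega)
        rw [h1 false i (by omega), show n - i + 1 = j by omega] at this
        exact this.symm
      · obtain ⟨c, rfl⟩ : ∃ c, i = c + 1 := ⟨i - 1, by omega⟩
        rw [cob_diag, h2 c (by omega)]
      · have := key true j (by omega)
        rw [h1 true j (by omega), show n - j + 1 = i by omega] at this
        exact this.symm
    · exact C.cob_eq_zero_of_ne hf hij

/-- The scalar in the component of the differential of degree one. -/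
def lam (b : Bool) (a c : ℕ) : K := (-1) ^ a * (C.par b)⁻¹ ^ c

theorem lin_smul (b : Bool) (a c : ℕ) (f : A) :
    C.lin b a c • f = C.letter b * f + C.lam b a c • (f * C.letter b) := by
  rw [CoverRel.lin, add_smul, smul_assoc, tm_smul, tm_smul, mul_one, one_mul, lam]

theorem lin_smul_eq_zero_iff {b : Bool} {a c : ℕ} {f : A} :
    C.lin b a c • f = 0 ↔ f ∈ C.linKer b (C.lam b a c) := by
  rw [lin_smul, mem_linKer]

theorem hvy_smul (b : Bool) (a c : ℕ) (f : A) : C.hvy b a c • f =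
    C.kap b • ((C.par b)⁻¹ ^ a • (C.cow b * f) + ((-1) ^ a * C.par b ^ c) • (f * C.cow b)) := by
  rw [CoverRel.hvy, smul_assoc, add_smul, smul_assoc, smul_assoc, tm_smul, tm_smul, mul_one,
    one_mul]

theorem hvy_smul_eq_zero {b : Bool} {a c : ℕ} {f : A} (h0 : C.cf true 0 f = 0)
    (h1 : C.cf b 1 f = 0) : C.hvy b a c • f = 0 := by
  rw [hvy_smul, C.cow_mul b f, C.mul_cow b f, h0, h1]
  simp

theorem lam_mul_lam (c : ℕ) : C.lam true 1 c * C.lam false 1 c = 1 := by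
  have := C.s_ne
  simp only [lam, CoverRel.par]
  simp
  field_simp

theorem strand_mem_weight {n : ℕ} {f : ℕ → ℕ → A} (hf : f ∈ C.cochain n) (b : Bool) (c : ℕ) :
    strand n f b c ∈ C.weight n := by
  cases b <;> exact hf.2 _ _

theorem strand_diag {n c : ℕ} (h : 2 * c = n) (f : ℕ → ℕ → A) (b : Bool) :
    strand n f b c = f c c := by
  rw [strand, show n - c = c by omega, ite_self]

/-- Weight `2` has no components of length `0` or `1`, so the long-word terms vanish and each entry
satisfies an equation of its own. The diagonal entry must satisfy those of both letters, and their
parameters are inverse to each other. -/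
theorem finrank_cocycle_two {n : ℕ} (hn : (n : ZMod 4) = 2) (hn' : 2 * (n / 2) = n) :
    Module.finrank K (C.cocycle n) = n * (4 * T + 4) + (2 * T + 4) := by
  have key : C.cocycle n = split n
      (fun b c => C.weight 2 ⊓ C.linKer b (C.lam b (n + 1 - 2 * c) c))
      (C.weight 2 ⊓ (C.linKer true (C.lam true 1 (n / 2)) ⊓
        C.linKer false (C.lam false 1 (n / 2)))) := by
    ext f
    rw [mem_cocycle_iff]
    constructor
    · rintro ⟨hf, h, -⟩
      have hw : ∀ i j, f i j ∈ C.weight 2 := fun i j => by rw [← hn]; exact hf.2 i j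
      have hs : ∀ b c, strand n f b c ∈ C.weight 2 := fun b c => by cases b <;> exact hw _ _
      have hl : ∀ b c, 2 * c ≤ n → strand n f b c ∈ C.linKer b (C.lam b (n + 1 - 2 * c) c) := by
        intro b c hc
        have := h b c hc
        rw [C.hvy_smul_eq_zero (C.cf_zero_of_weight (by decide) (hs b (c - 1)))
          (C.cf_one_of_weight (by decide) (hs b (c - 1)) b), ite_self, add_zero] at this
        exact (C.lin_smul_eq_zero_iff).1 this
      refine ⟨hf.1, fun b c hc => ⟨hs b c, hl b c (by omega)⟩, fun c hc => ⟨hw c c, ?_⟩⟩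
      obtain rfl : c = n / 2 := by omega
      have h1 := hl true (n / 2) (by omega)
      have h2 := hl false (n / 2) (by omega)
      rw [strand_diag hn', show n + 1 - 2 * (n / 2) = 1 by omega] at h1 h2
      exact ⟨h1, h2⟩
    · intro h
      have hf : f ∈ C.cochain n := by
        rw [mem_cochain_iff, hn, if_pos hn']
        exact ⟨h.1, fun b c hc => (h.2.1 b c hc).1, fun c hc => (h.2.2 c hc).1⟩
      have hs : ∀ b c, strand n f b c ∈ C.weight 2 := fun b c => by
        have := C.strand_mem_weight hf b c
        rwa [hn] at this
      refine ⟨hf, fun b c hc => ?_, fun c hc => by omega⟩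
      rw [C.hvy_smul_eq_zero (C.cf_zero_of_weight (by decide) (hs b (c - 1)))
          (C.cf_one_of_weight (by decide) (hs b (c - 1)) b), ite_self, add_zero,
          lin_smul_eq_zero_iff]
      rcases Nat.lt_or_ge (2 * c) n with hlt | hge
      · exact (h.2.1 b c hlt).2
      · obtain rfl : c = n / 2 := by omega
        have := (h.2.2 (n / 2) hn').2
        rw [strand_diag hn', show n + 1 - 2 * (n / 2) = 1 by omega]
        cases b
        · exact this.2
        · exact this.1
  rw [key, C.finrank_split_const _ _ (fun ⟨c, hc⟩ => by omega)
    (fun b c _ => C.finrank_weight_two_inf_linKer b _),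
    C.finrank_weight_two_inf_linKer_inf_linKer (C.lam_mul_lam _)]
  congr 2
  omega

/-- Between two words of total length `4T + 1` there is room for one letter only, since products of
length above `4T + 2` vanish. -/
theorem word_mul_mul_word {b b' : Bool} {i j : ℕ} (hij : i + j = 4 * T + 1) {f : A}
    (hf : C.cf true 0 f = 0) : C.word b i * f * C.word b' j =
      C.word b i * (∑ d : Bool, C.dg (C.cf d 1 f) * C.letter d) * C.word b' j := by
  have key : LinearMap.mulRight K (C.word b' j) ∘ₗ LinearMap.mulLeft K (C.word b i) =
      LinearMap.mulRight K (C.word b' j) ∘ₗ LinearMap.mulLeft K (C.word b i) ∘ₗ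
        (C.dg ∘ₗ C.cf true 0 +
          ∑ d : Bool, LinearMap.mulRight K (C.letter d) ∘ₗ C.dg ∘ₗ C.cf d 1) := by
    refine C.linearMap_ext false (fun l => ?_) (fun l c m hm => ?_) (fun l => ?_) <;>
      simp only [LinearMap.comp_apply, LinearMap.mulRight_apply, LinearMap.mulLeft_apply,
        LinearMap.add_apply, LinearMap.sum_apply]
    · simp only [cf_e]
      simp [dg_single]
    · simp only [C.cf_word _ _ _ _ hm]
      rw [if_neg (by omega), map_zero, zero_add]
      rcases Nat.eq_zero_or_pos m with rfl | hm'
      · rw [Finset.sum_eq_single c]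
        · rw [if_pos ⟨rfl, rfl⟩, dg_single, zero_add, C.word_one]
        · intro d _ hd
          rw [if_neg fun h => hd h.1, map_zero, zero_mul]
        · simp
      · rw [Finset.sum_eq_zero fun d _ => by rw [if_neg (by omega), map_zero, zero_mul], mul_zero,
          zero_mul, ← mul_assoc, word_mul_e, mul_assoc, mul_assoc]
        rcases C.word_mul_word_cases c b' (m + 1) j with h | ⟨d, h⟩
        · rw [h, mul_zero, mul_zero]
        · rw [h]
          rcases C.word_mul_word_cases b d i (m + 1 + j) with h | ⟨d', h⟩
          · rw [h, mul_zero]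
          · rw [h, C.word_eq_zero _ (by omega), mul_zero]
    · simp only [cf_top, map_zero, zero_mul, Finset.sum_const_zero, add_zero, mul_zero]
      rw [← mul_assoc, word_mul_e, mul_assoc, mul_assoc]
      rcases C.word_mul_word_cases false b' (4 * T + 2) j with h | ⟨d, h⟩
      · rw [h, mul_zero, mul_zero]
      · rw [h]
        rcases C.word_mul_word_cases b d i (4 * T + 2 + j) with h | ⟨d', h⟩
        · rw [h, mul_zero]
        · rw [h, C.word_eq_zero _ (by omega), mul_zero]
  have h := LinearMap.congr_fun key f
  simp only [LinearMap.comp_apply, LinearMap.mulRight_apply, LinearMap.mulLeft_apply,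
    LinearMap.add_apply, LinearMap.sum_apply, hf, map_zero, zero_add] at h
  exact h

theorem fox_smul (b : Bool) (c : ℕ) (f : A) : C.fox b c • f =
    C.kap b • ∑ k ∈ Finset.HasAntidiagonal.antidiagonal (2 * T),
      (C.par b ^ c • (C.word b (2 * k.1) * f * C.word (!b) (2 * k.2 + 1)) +
        C.word (!b) (2 * k.1 + 1) * f * C.word (!b) (2 * k.2)) := by
  rw [CoverRel.fox, smul_assoc, Finset.sum_smul]
  simp only [add_smul, smul_assoc, tm_smul]

theorem fox_smul_eq_zero (b : Bool) (c : ℕ) {f : A} (h0 : C.cf true 0 f = 0)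
    (h1 : ∀ d, C.cf d 1 f = 0) : C.fox b c • f = 0 := by
  rw [fox_smul, Finset.sum_eq_zero, smul_zero]
  intro k hk
  rw [Finset.HasAntidiagonal.mem_antidiagonal] at hk
  rw [C.word_mul_mul_word (by omega) h0, C.word_mul_mul_word (by omega) h0]
  simp [h1]

/-- The condition on the diagonal is empty as well, because the derivative of the relation only sees
components of lengths `0` and `1`, absent in weight `3`. -/
theorem finrank_cocycle_three {n : ℕ} (hn : (n : ZMod 4) = 3) (hn' : 2 * (n / 2) + 1 = n) :
    Module.finrank K (C.cocycle n) = (n + 1) * (4 * T) := by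
  have key : C.cocycle n = split n
      (fun b c => C.weight 3 ⊓ C.linKer b (C.lam b (n + 1 - 2 * c) c)) ⊥ := by
    ext f
    rw [mem_cocycle_iff]
    constructor
    · rintro ⟨hf, h, -⟩
      have hw : ∀ i j, f i j ∈ C.weight 3 := fun i j => by rw [← hn]; exact hf.2 i j
      have hs : ∀ b c, strand n f b c ∈ C.weight 3 := fun b c => by cases b <;> exact hw _ _
      refine ⟨hf.1, fun b c hc => ⟨hs b c, ?_⟩, fun c hc => by omega⟩
      have := h b c (by omega)
      rw [C.hvy_smul_eq_zero (C.cf_zero_of_weight (by decide) (hs b (c - 1)))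
        (C.cf_one_of_weight (by decide) (hs b (c - 1)) b), ite_self, add_zero] at this
      exact (C.lin_smul_eq_zero_iff).1 this
    · intro h
      have hf : f ∈ C.cochain n := by
        rw [mem_cochain_iff, hn]
        exact ⟨h.1, fun b c hc => (h.2.1 b c hc).1, fun c hc => by omega⟩
      have hw : ∀ i j, f i j ∈ C.weight 3 := fun i j => by rw [← hn]; exact hf.2 i j
      have hs : ∀ b c, strand n f b c ∈ C.weight 3 := fun b c => by cases b <;> exact hw _ _
      refine ⟨hf, fun b c hc => ?_, fun c hc => ?_⟩
      · rw [C.hvy_smul_eq_zero (C.cf_zero_of_weight (by decide) (hs b (c - 1)))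
          (C.cf_one_of_weight (by decide) (hs b (c - 1)) b), ite_self, add_zero,
          lin_smul_eq_zero_iff]
        exact (h.2.1 b c (by omega)).2
      · rw [C.fox_smul_eq_zero _ _ (C.cf_zero_of_weight (by decide) (hw _ _))
            (C.cf_one_of_weight (by decide) (hw _ _)),
          C.fox_smul_eq_zero _ _ (C.cf_zero_of_weight (by decide) (hw _ _))
            (C.cf_one_of_weight (by decide) (hw _ _)), add_zero]
  rw [key, C.finrank_split_const _ _ (fun _ => rfl) (d := 4 * T) (fun b c _ => by
    rw [weight_three_eq_core]
    exact C.finrank_core_inf_linKer (r := 3) (by omega) (by omega) b _), finrank_bot, add_zero]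
  congr 1
  omega

theorem finrank_cocycle_zero : Module.finrank K (C.cocycle 0) = 2 * T + 1 := by
  have hl : ∀ b, C.lam b 1 0 = -1 := fun b => by simp [lam]
  have key : C.cocycle 0 = split 0 (fun _ _ => C.weight 0)
      (C.weight 0 ⊓ (C.linKer true (-1) ⊓ C.linKer false (-1))) := by
    ext f
    rw [mem_cocycle_iff]
    constructor
    · rintro ⟨hf, h, -⟩
      have hl' : ∀ b, f 0 0 ∈ C.linKer b (-1) := by
        intro b
        have := h b 0 le_rfl
        rw [if_pos rfl, add_zero, lin_smul_eq_zero_iff, strand_diag (mul_zero 2)] at this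
        rwa [show 0 + 1 - 2 * 0 = 1 by rfl, hl] at this
      refine ⟨hf.1, fun b c hc => by omega, fun c hc => ?_⟩
      obtain rfl : c = 0 := by omega
      exact ⟨by simpa using hf.2 0 0, hl' true, hl' false⟩
    · intro h
      have hf : f ∈ C.cochain 0 := by
        rw [mem_cochain_iff, Nat.cast_zero]
        exact ⟨h.1, fun b c hc => by omega, fun c hc => by
          rw [if_pos rfl]; exact (h.2.2 c hc).1⟩
      refine ⟨hf, fun b c hc => ?_, fun c hc => by omega⟩
      obtain rfl : c = 0 := by omega
      rw [if_pos rfl, add_zero, lin_smul_eq_zero_iff, strand_diag (mul_zero 2),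
        show 0 + 1 - 2 * 0 = 1 by rfl, hl]
      have := (h.2.2 0 rfl).2
      cases b
      · exact this.2
      · exact this.1
  rw [key, C.finrank_split_const _ _ (fun ⟨c, hc⟩ => by omega) (d := 0)
    (fun b c h => by omega), C.finrank_weight_zero_inf_linKer]
  ring

theorem neg_one_pow_pow_four (a : ℕ) : ((-1 : K) ^ a) ^ 4 = 1 := by
  rw [← pow_mul, mul_comm, pow_mul]
  norm_num

theorem par_pow_ne_one (hs : ∀ n : ℕ, 1 ≤ n → C.s ^ (4 * n) ≠ 1) (b : Bool) {n : ℕ} (hn : 1 ≤ n) :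
    (C.par b ^ n) ^ 4 ≠ 1 := by
  have h := hs n hn
  rw [mul_comm, pow_mul] at h
  cases b
  · simp only [CoverRel.par, Bool.false_eq_true, if_false, inv_pow, ne_eq, inv_eq_one]
    exact h
  · simpa [CoverRel.par] using h

/-- The vertex coefficients satisfy an eigenvalue equation for the shift, taken from a different
part of the cocycle condition according to the position on the strand. -/
theorem cf_cocycle_eq_zero (hs : ∀ n : ℕ, 1 ≤ n → C.s ^ (4 * n) ≠ 1) {n : ℕ} (h2 : 2 ≤ n)
    {f : ℕ → ℕ → A} (hw : ∀ b c, strand n f b c ∈ C.weight 0)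
    (h : ∀ b c, 2 * c ≤ n → C.lin b (n + 1 - 2 * c) c • strand n f b c +
      (if c = 0 then 0 else C.hvy b (n + 1 - 2 * c) c • strand n f b (c - 1)) = 0)
    (b : Bool) {c : ℕ} (hc : 2 * c ≤ n) : C.cf true 0 (strand n f b c) = 0 := by
  have hcow : ∀ ε : ZMod 4 → K, C.cf b 1 (C.dg ε * C.cow b) = 0 := fun ε => by
    rw [CoverRel.cow, C.cf_dg_mul_word _ _ _ _ le_rfl, if_neg (by simp)]
  have hcow' : ∀ ε : ZMod 4 → K, C.cf (!b) (4 * T + 1) (C.dg ε * C.cow b) = ε := fun ε => by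
    rw [CoverRel.cow, C.cf_dg_mul_word _ _ _ _ le_rfl, if_pos ⟨rfl, rfl⟩]
  have hh : ∀ a c c', C.hvy b a c • strand n f b c' = C.kap b •
      ((C.par b)⁻¹ ^ a • (C.dg (shift (C.cf true 0 (strand n f b c'))) * C.cow b) +
        ((-1) ^ a * C.par b ^ c) • (C.dg (C.cf true 0 (strand n f b c')) * C.cow b)) := by
    intro a c c'
    rw [hvy_smul, C.cow_mul b (strand n f b c'), C.mul_cow b (strand n f b c'),
      C.cf_one_of_weight (by decide) (hw b c')]
    simp
  rcases Nat.eq_zero_or_pos c with rfl | hpos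
  -- At the start of the strand the letter component has parameter `±1` and decides nothing.
  -- Instead, the next condition is read off at length `4T + 1`, where the long word contributes;
  -- this needs `2 ≤ n`.
  · have e := congrArg (C.cf (!b) (4 * T + 1)) (h b 1 (by omega))
    rw [if_neg (by omega), hh, lin_smul, map_zero, map_add, map_add, map_smul,
      C.cf_letter_mul _ _ le_rfl, if_neg (by simp), C.cf_mul_letter _ _ le_rfl,
      CoverRel.bodd_four_mul, if_neg (by simp), smul_zero, add_zero, zero_add, map_smul, map_add,
      map_smul, map_smul, hcow', hcow', smul_eq_zero_iff_right (C.kap_ne b)] at e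
    simp only [Nat.sub_self, mul_one, pow_one] at e
    have hp := C.par_ne b
    refine eq_zero_of_shift_eq_smul (c := -((-1) ^ (n + 1 - 2) * C.par b ^ n)) ?_ ?_
    · have e' := congrArg (fun v => C.par b ^ (n + 1 - 2) • v) e
      simp only [smul_add, smul_smul, smul_zero, inv_pow] at e'
      rw [mul_inv_cancel₀ (pow_ne_zero _ hp), one_smul] at e'
      rw [eq_neg_of_add_eq_zero_left e', ← neg_smul]
      congr 2
      rw [mul_left_comm, ← pow_succ, show n + 1 - 2 + 1 = n by omega]
    · rw [neg_pow, mul_pow, neg_one_pow_pow_four]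
      norm_num
      exact C.par_pow_ne_one hs b (by omega)
  -- Further along, the coefficient of the letter `b` sees only the letter component, whose
  -- parameter is up to sign a nonzero power of `par b`.
  · have e := congrArg (C.cf b (0 + 1)) (h b c hc)
    rw [if_neg (by omega), hh, lin_smul, map_zero, map_add, map_add, map_smul,
      C.cf_letter_mul _ _ (by omega), if_pos rfl, C.cf_mul_letter _ _ (by omega), Nat.bodd_zero,
      Bool.xor_false, if_pos rfl, map_smul, map_add, map_smul, map_smul, hcow, hcow, smul_zero,
      smul_zero, add_zero, smul_zero, add_zero] at e
    refine eq_zero_of_shift_eq_smul (c := -(C.lam b (n + 1 - 2 * c) c)) ?_ ?_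
    · rw [neg_smul]
      exact eq_neg_of_add_eq_zero_left e
    · rw [lam, neg_pow, mul_pow, neg_one_pow_pow_four, inv_pow, inv_pow]
      norm_num
      exact C.par_pow_ne_one hs b hpos

/-- Once the vertex coefficients vanish, the long-word terms disappear and the entries are governed
by the two letters separately, as in weight `2`. -/
theorem finrank_cocycle_four (hs : ∀ n : ℕ, 1 ≤ n → C.s ^ (4 * n) ≠ 1) {n : ℕ}
    (hn : (n : ZMod 4) = 0) (hn' : 2 * (n / 2) = n) (h2 : 2 ≤ n) :
    Module.finrank K (C.cocycle n) = n * (4 * T) + 2 * T := by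
  have key : C.cocycle n = split n
      (fun b c => C.core 0 ⊓ C.linKer b (C.lam b (n + 1 - 2 * c) c))
      (C.core 0 ⊓ (C.linKer true (C.lam true 1 (n / 2)) ⊓
        C.linKer false (C.lam false 1 (n / 2)))) := by
    ext f
    rw [mem_cocycle_iff]
    constructor
    · rintro ⟨hf, h, -⟩
      have hw : ∀ i j, f i j ∈ C.weight 0 := fun i j => by rw [← hn]; exact hf.2 i j
      have hs' : ∀ b c, strand n f b c ∈ C.weight 0 := fun b c => by cases b <;> exact hw _ _
      have hc0 : ∀ b c, 2 * c ≤ n → C.cf true 0 (strand n f b c) = 0 :=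
        fun b c hc => C.cf_cocycle_eq_zero hs h2 hs' h b hc
      have hl : ∀ b c, 2 * c ≤ n → strand n f b c ∈ C.linKer b (C.lam b (n + 1 - 2 * c) c) := by
        intro b c hc
        have := h b c hc
        rw [C.hvy_smul_eq_zero (hc0 b (c - 1) (by omega))
          (C.cf_one_of_weight (by decide) (hs' b (c - 1)) b), ite_self, add_zero] at this
        exact (C.lin_smul_eq_zero_iff).1 this
      refine ⟨hf.1, fun b c hc => ⟨(C.mem_core_zero_iff (hs' b c)).2 (hc0 b c (by omega)),
        hl b c (by omega)⟩, fun c hc => ?_⟩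
      obtain rfl : c = n / 2 := by omega
      have h0 := hc0 true (n / 2) (by omega)
      have h1 := hl true (n / 2) (by omega)
      have h2 := hl false (n / 2) (by omega)
      rw [strand_diag hn'] at h0
      rw [strand_diag hn', show n + 1 - 2 * (n / 2) = 1 by omega] at h1 h2
      exact ⟨(C.mem_core_zero_iff (hw _ _)).2 h0, h1, h2⟩
    · intro h
      have hf : f ∈ C.cochain n := by
        rw [mem_cochain_iff, hn, if_pos hn']
        exact ⟨h.1, fun b c hc => C.core_le_weight _ (h.2.1 b c hc).1,
          fun c hc => C.core_le_weight _ (h.2.2 c hc).1⟩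
      have hs' : ∀ b c, strand n f b c ∈ C.weight 0 := fun b c => by
        have := C.strand_mem_weight hf b c
        rwa [hn] at this
      have hv : ∀ b c, (if c = 0 then 0 else
          C.hvy b (n + 1 - 2 * c) c • strand n f b (c - 1)) = 0 ∨ ¬ 2 * c ≤ n := by
        intro b c
        by_cases hc : 2 * c ≤ n
        · left
          split_ifs with h0
          · rfl
          · exact C.hvy_smul_eq_zero ((C.mem_core_zero_iff (hs' b (c - 1))).1
              (h.2.1 b (c - 1) (by omega)).1) (C.cf_one_of_weight (by decide) (hs' b (c - 1)) b)
        · exact Or.inr hc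
      refine ⟨hf, fun b c hc => ?_, fun c hc => by omega⟩
      rw [(hv b c).resolve_right (not_not.2 hc), add_zero, lin_smul_eq_zero_iff]
      rcases Nat.lt_or_ge (2 * c) n with hlt | hge
      · exact (h.2.1 b c hlt).2
      · obtain rfl : c = n / 2 := by omega
        have := (h.2.2 (n / 2) hn').2
        rw [strand_diag hn', show n + 1 - 2 * (n / 2) = 1 by omega]
        cases b
        · exact this.2
        · exact this.1
  have h4 : ((4 : ℕ) : ZMod 4) = 0 := rfl
  have hd : ∀ b l, Module.finrank K (C.core 0 ⊓ C.linKer b l : Submodule K A) = 4 * T := by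
    intro b l
    have := C.finrank_core_inf_linKer (r := 4) (by omega) (by omega) b l
    rwa [h4] at this
  rw [key, C.finrank_split_const _ _ (fun ⟨c, hc⟩ => by omega) (fun b c _ => hd b _)]
  have h := C.finrank_core_inf_linKer_inf_linKer (r := 4) (by omega) (by omega) rfl
    (C.lam_mul_lam (n / 2))
  rw [h4] at h
  rw [h]
  congr 2
  omega

end Cover

end

noncomputable section

/-! ### Cocycles in degrees congruent to `1`, up to the relation on the diagonal -/

theorem finrank_eq_finrank_add_of_mapsTo {K M W : Type*} [Field K] [AddCommGroup M] [Module K M]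
    [AddCommGroup W] [Module K W] (U U' : Submodule K M) [Module.Finite K U] (π : M →ₗ[K] W)
    (R : Submodule K W) (hle : U' ≤ U) (hker : ∀ f ∈ U, π f = 0 ↔ f ∈ U') (hmem : ∀ f ∈ U, π f ∈ R)
    (hsurj : ∀ w ∈ R, ∃ f ∈ U, π f = w) :
    Module.finrank K U = Module.finrank K R + Module.finrank K U' := by
  have h := LinearMap.finrank_range_add_finrank_ker (π ∘ₗ U.subtype)
  have h1 : LinearMap.range (π ∘ₗ U.subtype) = R := by
    ext w
    constructor
    · rintro ⟨f, rfl⟩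
      exact hmem f.1 f.2
    · intro hw
      obtain ⟨f, hf, rfl⟩ := hsurj w hw
      exact ⟨⟨f, hf⟩, rfl⟩
  have h2 : LinearMap.ker (π ∘ₗ U.subtype) = U'.comap U.subtype := by
    ext ⟨f, hf⟩
    exact hker f hf
  rw [h1, h2, (Submodule.comapSubtypeEquivOfLe hle).finrank_eq] at h
  exact h.symm

namespace Cover

variable {K : Type u} [Field K] {A : Type u} [Ring A] [Algebra K A] {T : ℕ} (C : Cover K A T)

attribute [local instance] instModuleTensorProductMop isScalarTower_env

/-- The elements of weight one annihilated by the letter `b`. -/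
def letterAnn (b : Bool) : Submodule K A :=
  C.weight 1 ⊓ LinearMap.ker (LinearMap.mulLeft K (C.letter b))

theorem cf_not_of_mem_letterAnn {b : Bool} {f : A} (hf : f ∈ C.letterAnn b) {j : ℕ}
    (hj : j ≤ 4 * T + 1) : C.cf (!b) j f = 0 := by
  have h : C.letter b * f = 0 := hf.2
  rcases Nat.lt_or_ge (4 * T) j with h' | h'
  · obtain rfl : j = 4 * T + 1 := by omega
    have e := congrArg C.ct h
    rw [ct_letter_mul, map_zero, smul_eq_zero_iff_right (C.topSign_ne b)] at e
    simpa using e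
  · have e := congrArg (C.cf b (j + 1)) h
    rw [C.cf_letter_mul _ _ h', if_pos rfl, map_zero] at e
    simpa using e

theorem mem_letterAnn {b : Bool} {f : A} (hf : f ∈ C.weight 1)
    (h : ∀ j, j ≤ 4 * T + 1 → C.cf (!b) j f = 0) : f ∈ C.letterAnn b := by
  refine ⟨hf, ?_⟩
  change C.letter b * f = 0
  refine C.ext_coef ?_ (fun b' j hj => ?_) ?_
  · rw [cf_zero_letter_mul, map_zero]
  · rw [C.cf_letter_mul _ _ hj, map_zero]
    split_ifs with hb
    · rw [hb, h j (by omega), map_zero]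
    · rfl
  · rw [ct_letter_mul, h _ le_rfl, map_zero, map_zero, smul_zero]

/-- Weight one means odd length, so a word beginning with `b` also ends in `b`. -/
theorem mul_letter_of_mem_letterAnn {b : Bool} {f : A} (hf : f ∈ C.letterAnn b) :
    f * C.letter b = 0 := by
  refine C.ext_coef ?_ (fun b' j hj => ?_) ?_
  · rw [cf_zero_mul_letter, map_zero]
  · rw [C.cf_mul_letter _ _ hj, map_zero]
    split_ifs with hb
    · by_cases hb' : b' = b
      · subst hb'
        refine C.cf_eq_zero_of_weight hf.1 b' fun h => ?_
        have hj1 : j.bodd = false := by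
          revert hb; cases b' <;> cases j.bodd <;> decide
        have := (ZMod.natCast_eq_natCast_iff' j 1 4).1 (by simpa using h)
        have h2 := Nat.mod_two_of_bodd j
        rw [hj1] at h2
        simp at h2
        omega
      · rw [Bool.eq_not_of_ne hb']
        exact C.cf_not_of_mem_letterAnn hf (by omega)
    · rfl
  · rw [ct_mul_letter, C.cf_not_of_mem_letterAnn hf le_rfl, map_zero, smul_zero]

theorem dg_mul_word_mem_letterAnn (ε : ZMod 4 → K) (b : Bool) (k : ℕ) :
    C.dg ε * C.word b (4 * k + 1) ∈ C.letterAnn b := by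
  refine ⟨?_, ?_⟩
  · have := C.dg_mul_word_mem_weight ε b (4 * k + 1)
    rwa [cast_length, Nat.cast_one] at this
  · change C.letter b * _ = 0
    rw [← mul_assoc, letter_mul_dg, mul_assoc, C.letter_mul_word_self, mul_zero]

theorem finrank_letterAnn (b : Bool) : Module.finrank K (C.letterAnn b) = 4 * T + 4 := by
  have := C.finite_submodule (C.letterAnn b)
  rw [finrank_eq_finrank_add_of_surjOn (C.letterAnn b) ⊥
    (LinearMap.pi fun k : Fin (T + 1) => C.cf b (4 * k + 1)) bot_le]
  · simp only [Module.finrank_pi_fintype, Module.finrank_self, Finset.sum_const, Finset.card_univ,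
      Fintype.card_fin, ZMod.card, finrank_bot, smul_eq_mul]
    ring
  · intro f hf
    rw [Submodule.mem_bot]
    refine ⟨fun h => ?_, fun h => by rw [h, map_zero]⟩
    refine C.ext_coef ?_ (fun b' j hj => ?_) ?_
    · rw [C.cf_zero_of_weight (by decide) hf.1, map_zero]
    · rw [map_zero]
      by_cases hb : b' = b
      · subst hb
        by_cases hr : ((j + 1 : ℕ) : ZMod 4) = (1 : ℕ)
        · obtain ⟨k, hk⟩ := exists_eq_length (r := 1) le_rfl (by omega) (by omega) hr
          rw [hk]
          exact congrFun h ⟨k, by omega⟩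
        · exact C.cf_eq_zero_of_weight hf.1 b' (by simpa using hr)
      · rw [Bool.eq_not_of_ne hb]
        exact C.cf_not_of_mem_letterAnn hf (by omega)
    · rw [C.ct_eq_zero_of_weight hf.1 (by decide), map_zero]
  · intro g
    refine ⟨∑ k : Fin (T + 1), C.dg (g k) * C.word b (4 * (k : ℕ) + 1),
      Submodule.sum_mem _ fun k _ => C.dg_mul_word_mem_letterAnn _ b k, ?_⟩
    funext k
    simp only [LinearMap.pi_apply, map_sum]
    rw [← sum_ite_fin g k 1]
    refine Finset.sum_congr rfl fun p _ => ?_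
    rw [C.cf_dg_mul_word' _ _ _ _ (by omega) (by omega)]
    simp only [true_and]

theorem dg_mul_letter_mem_letterAnn (ε : ZMod 4 → K) (b : Bool) :
    C.dg ε * C.letter b ∈ C.letterAnn b := by
  have := C.dg_mul_word_mem_letterAnn ε b 0
  rwa [mul_zero, zero_add, C.word_one] at this

theorem cf_dg_mul_letter (ε : ZMod 4 → K) (b b' : Bool) :
    C.cf b 1 (C.dg ε * C.letter b') = if b = b' then ε else 0 := by
  rw [← C.word_one, C.cf_dg_mul_word' _ _ _ _ le_rfl (by omega)]
  simp only [and_true]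

theorem finrank_letterAnn_inf (b : Bool) :
    Module.finrank K (C.letterAnn b ⊓ LinearMap.ker (C.cf b 1) : Submodule K A) = 4 * T := by
  have := C.finite_submodule (C.letterAnn b)
  have h := finrank_eq_finrank_add_of_surjOn (C.letterAnn b)
    (C.letterAnn b ⊓ LinearMap.ker (C.cf b 1)) (C.cf b 1) inf_le_left
    (fun f hf => ⟨fun h => ⟨hf, h⟩, fun h => h.2⟩)
    (fun ε => ⟨_, C.dg_mul_letter_mem_letterAnn ε b, by rw [cf_dg_mul_letter, if_pos rfl]⟩)
  rw [C.finrank_letterAnn] at h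
  simp at h
  omega

/-- The coefficient of the word of maximal length in the coboundary. -/
def topCoeff (b : Bool) (a c : ℕ) (p x : ZMod 4 → K) : ZMod 4 → K :=
  shift p - (C.lam b a c * C.par b) • p +
    C.kap b • (((-1) ^ a * C.par b ^ c) • x - ((C.par b)⁻¹ ^ a * C.par b) • shift x)

/-- The cochains satisfying all cocycle conditions but the one on the diagonal. -/
def preCocycle (n : ℕ) : Submodule K (ℕ → ℕ → A) where
  carrier := {f | f ∈ C.cochain n ∧
    ∀ b c, 2 * c ≤ n → C.lin b (n + 1 - 2 * c) c • strand n f b c +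
      (if c = 0 then 0 else C.hvy b (n + 1 - 2 * c) c • strand n f b (c - 1)) = 0}
  zero_mem' := ⟨zero_mem _, fun b c _ => by
    have : ∀ c, strand n (0 : ℕ → ℕ → A) b c = 0 := fun c => by cases b <;> rfl
    rw [this, this, smul_zero, smul_zero, ite_self, add_zero]⟩
  add_mem' := fun {f g} hf hg => ⟨add_mem hf.1 hg.1, fun b c hc => by
    have : ∀ c, strand n (f + g) b c = strand n f b c + strand n g b c :=
      fun c => by cases b <;> rfl
    have e := congrArg₂ (· + ·) (hf.2 b c hc) (hg.2 b c hc)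
    simp only [add_zero] at e
    refine Eq.trans ?_ e
    rw [this, this, smul_add]
    split_ifs
    · abel
    · rw [smul_add]; abel⟩
  smul_mem' := fun a f hf => ⟨Submodule.smul_mem _ a hf.1, fun b c hc => by
    have : ∀ c, strand n (a • f) b c = a • strand n f b c := fun c => by cases b <;> rfl
    have e := congrArg (a • ·) (hf.2 b c hc)
    simp only [smul_zero, smul_add] at e
    refine Eq.trans ?_ e
    rw [this, this, smul_comm _ a]
    split_ifs
    · rw [smul_zero]
    · rw [smul_comm _ a]⟩

theorem hvy_smul_of_weight_one {b : Bool} {a c : ℕ} {g : A} (hg : g ∈ C.weight 1) :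
    C.hvy b a c • g = C.dg (C.kap b • (((-1) ^ a * C.par b ^ c) • C.cf b 1 g -
      ((C.par b)⁻¹ ^ a * C.par b) • shift (C.cf b 1 g))) * C.word b (4 * T + 2) := by
  rw [hvy_smul, C.cow_mul b g, C.mul_cow b g, C.cf_zero_of_weight (by decide) hg,
    C.word_not_top b]
  simp only [map_zero, zero_mul, zero_add, map_smul, map_sub, smul_mul_assoc, sub_mul, mul_neg,
    mul_smul_comm]
  module

theorem ct_lin_smul (b : Bool) (a c : ℕ) (f : A) : C.ct (C.lin b a c • f) =
    C.topSign b • (shift (C.cf (!b) (4 * T + 1) f) -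
      (C.lam b a c * C.par b) • C.cf (!b) (4 * T + 1) f) := by
  rw [lin_smul, map_add, map_smul, ct_letter_mul, ct_mul_letter, topSign_not]
  module

theorem strand_preCocycle {n : ℕ} (hn : (n : ZMod 4) = 1) {f : ℕ → ℕ → A}
    (hf : f ∈ C.preCocycle n) (b : Bool) (c : ℕ) : strand n f b c ∈ C.weight 1 := by
  have := C.strand_mem_weight hf.1 b c
  rwa [hn] at this

/-- An odd word beginning with the other letter is prolonged by `b` on the left to a word that no
right product with `b` reaches; the long-word term has top length and cannot compensate it either.
-/
theorem cf_preCocycle_eq_zero {n : ℕ} (hn : (n : ZMod 4) = 1) {f : ℕ → ℕ → A}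
    (hf : f ∈ C.preCocycle n) (b : Bool) {c : ℕ} (hc : 2 * c ≤ n) {j : ℕ} (hj : j ≤ 4 * T) :
    C.cf (!b) j (strand n f b c) = 0 := by
  have hw := C.strand_preCocycle hn hf
  by_cases h1 : (j : ZMod 4) = 1
  · have h := (ZMod.natCast_eq_natCast_iff' j 1 4).1 (by simpa using h1)
    have hjo : j.bodd = true := by
      have h2 := Nat.mod_two_of_bodd j
      cases hb : j.bodd
      · rw [hb] at h2
        simp at h2
        omega
      · rfl
    have e := congrArg (C.cf b (j + 1)) (hf.2 b c hc)
    rw [map_add, C.hvy_smul_of_weight_one (hw b (c - 1)), lin_smul, map_add, map_smul,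
      C.cf_letter_mul _ _ hj, if_pos rfl, C.cf_mul_letter _ _ hj, hjo,
      if_neg (by cases b <;> decide), smul_zero, add_zero, map_zero] at e
    have h0 : C.cf b (j + 1) (if c = 0 then 0 else C.dg (C.kap b •
        (((-1) ^ (n + 1 - 2 * c) * C.par b ^ c) • C.cf b 1 (strand n f b (c - 1)) -
      ((C.par b)⁻¹ ^ (n + 1 - 2 * c) * C.par b) • shift (C.cf b 1 (strand n f b (c - 1))))) *
        C.word b (4 * T + 2)) = 0 := by
      split_ifs
      · rw [map_zero]
      · rw [cf_dg_mul_top]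
    rw [h0, add_zero] at e
    simpa using e
  · exact C.cf_eq_zero_of_weight (hw b c) _ h1

/-- In top length the condition couples the coefficient of length `4T + 1` in one entry with the
letter coefficient of its predecessor. -/
theorem topCoeff_eq_zero {n : ℕ} (hn : (n : ZMod 4) = 1) {f : ℕ → ℕ → A}
    (hf : f ∈ C.preCocycle n) (b : Bool) {c : ℕ} (hc : 2 * (c + 1) ≤ n) :
    C.topCoeff b (n + 1 - 2 * (c + 1)) (c + 1) (C.cf (!b) (4 * T + 1) (strand n f b (c + 1)))
      (C.cf b 1 (strand n f b c)) = 0 := by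
  have e := congrArg C.ct (hf.2 b (c + 1) hc)
  rw [if_neg (by omega), Nat.add_sub_cancel,
    C.hvy_smul_of_weight_one (C.strand_preCocycle hn hf b c), map_add, ct_lin_smul, ct_dg_mul_top,
    ← smul_add, map_zero, smul_eq_zero_iff_right (C.topSign_ne b)] at e
  exact e

/-- The first entry of a strand has no predecessor, so its coefficient of length `4T + 1` is an
eigenvector of the shift for `±par b`. -/
theorem cf_preCocycle_zero (hs : ∀ n : ℕ, 1 ≤ n → C.s ^ (4 * n) ≠ 1) {n : ℕ} {f : ℕ → ℕ → A}
    (hf : f ∈ C.preCocycle n) (b : Bool) : C.cf (!b) (4 * T + 1) (strand n f b 0) = 0 := by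
  have e := congrArg C.ct (hf.2 b 0 (by omega))
  rw [if_pos rfl, add_zero, ct_lin_smul, map_zero, smul_eq_zero_iff_right (C.topSign_ne b),
    sub_eq_zero] at e
  refine eq_zero_of_shift_eq_smul e ?_
  rw [lam, pow_zero, mul_one, mul_pow, neg_one_pow_pow_four, one_mul]
  simpa using C.par_pow_ne_one hs b (n := 1) le_rfl

/-- The operator that relates consecutive coefficients is injective. -/
theorem eq_zero_of_heavy (hs : ∀ n : ℕ, 1 ≤ n → C.s ^ (4 * n) ≠ 1) {b : Bool} {a c : ℕ}
    (h : 2 ≤ a + c) {x : ZMod 4 → K}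
    (hx : C.kap b • (((-1) ^ a * C.par b ^ c) • x - ((C.par b)⁻¹ ^ a * C.par b) • shift x) = 0) :
    x = 0 := by
  have hp := C.par_ne b
  rw [smul_eq_zero_iff_right (C.kap_ne b), sub_eq_zero] at hx
  refine eq_zero_of_shift_eq_smul (c := (-1) ^ a * C.par b ^ (a + c - 1)) ?_ ?_
  · have e := congrArg (fun v => (C.par b ^ a * (C.par b)⁻¹) • v) hx
    simp only [smul_smul] at e
    rw [show C.par b ^ a * (C.par b)⁻¹ * ((C.par b)⁻¹ ^ a * C.par b) = 1 by
      rw [inv_pow]; field_simp, one_smul] at e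
    rw [← e]
    congr 1
    obtain ⟨d, hd⟩ : ∃ d, a + c = d + 1 := ⟨a + c - 1, by omega⟩
    rw [hd, Nat.add_sub_cancel]
    have : C.par b ^ a * C.par b ^ c = C.par b ^ d * C.par b := by
      rw [← pow_add, hd, pow_succ]
    calc C.par b ^ a * (C.par b)⁻¹ * ((-1) ^ a * C.par b ^ c) =
        (-1) ^ a * (C.par b)⁻¹ * (C.par b ^ a * C.par b ^ c) := by ring
      _ = _ := by rw [this]; field_simp
  · rw [mul_pow, neg_one_pow_pow_four, one_mul]
    exact C.par_pow_ne_one hs b (by omega)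

theorem exists_topCoeff_eq_zero (hs : ∀ n : ℕ, 1 ≤ n → C.s ^ (4 * n) ≠ 1) (b : Bool) {a c : ℕ}
    (h : 2 ≤ a + c) (p : ZMod 4 → K) : ∃ x, C.topCoeff b a c p x = 0 := by
  let φ : (ZMod 4 → K) →ₗ[K] (ZMod 4 → K) := C.kap b • (((-1) ^ a * C.par b ^ c) • LinearMap.id -
    ((C.par b)⁻¹ ^ a * C.par b) • shift.toLinearMap)
  have hφ : Function.Injective φ := (injective_iff_map_eq_zero _).2
    fun x hx => C.eq_zero_of_heavy hs h hx
  obtain ⟨x, hx⟩ := LinearMap.surjective_of_injective hφ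
    (-(shift p - (C.lam b a c * C.par b) • p))
  refine ⟨x, ?_⟩
  have : C.topCoeff b a c p x = shift p - (C.lam b a c * C.par b) • p + φ x := rfl
  rw [this, hx, add_neg_cancel]

/-- The subspace of the cochains that do not involve the long words. -/
theorem mem_split_iff (hs : ∀ n : ℕ, 1 ≤ n → C.s ^ (4 * n) ≠ 1) {n m : ℕ}
    (hn : (n : ZMod 4) = 1) (hm : n = 2 * m + 1) {f : ℕ → ℕ → A} :
    f ∈ split n (fun b c => if c = m then C.letterAnn b
      else C.letterAnn b ⊓ LinearMap.ker (C.cf b 1)) ⊥ ↔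
    f ∈ C.preCocycle n ∧ ∀ b c, c ≤ m → C.cf (!b) (4 * T + 1) (strand n f b c) = 0 := by
  constructor
  · intro h
    have hann : ∀ b c, c ≤ m → strand n f b c ∈ C.letterAnn b := fun b c hc => by
      have := h.2.1 b c (by omega)
      beta_reduce at this
      split_ifs at this
      · exact this
      · exact this.1
    have hcf : ∀ b c, c < m → C.cf b 1 (strand n f b c) = 0 := fun b c hc => by
      have := h.2.1 b c (by omega)
      beta_reduce at this
      rw [if_neg (by omega)] at this
      exact this.2
    have hf : f ∈ C.cochain n := by
      rw [mem_cochain_iff, hn]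
      exact ⟨h.1, fun b c hc => (hann b c (by omega)).1, fun c hc => by omega⟩
    refine ⟨⟨hf, fun b c hc => ?_⟩, fun b c hc => C.cf_not_of_mem_letterAnn (hann b c hc) le_rfl⟩
    have h1 : C.letter b * strand n f b c = 0 := (hann b c (by omega)).2
    rw [lin_smul, h1, C.mul_letter_of_mem_letterAnn (hann b c (by omega)), smul_zero, zero_add,
      zero_add]
    split_ifs with h0
    · rfl
    · refine C.hvy_smul_eq_zero ?_ (hcf b (c - 1) (by omega))
      exact C.cf_zero_of_weight (by decide) (hann b (c - 1) (by omega)).1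
  · rintro ⟨hf, h⟩
    refine ⟨hf.1.1, fun b c hc => ?_, fun c hc => by omega⟩
    have hann : strand n f b c ∈ C.letterAnn b :=
      C.mem_letterAnn (C.strand_preCocycle hn hf b c) fun j hj => by
        rcases Nat.lt_or_ge (4 * T) j with h' | h'
        · obtain rfl : j = 4 * T + 1 := by omega
          exact h b c (by omega)
        · exact C.cf_preCocycle_eq_zero hn hf b (by omega) h'
    beta_reduce
    split_ifs with hcm
    · exact hann
    · refine ⟨hann, ?_⟩
      have e := C.topCoeff_eq_zero hn hf b (c := c) (by omega)
      rw [topCoeff, h b (c + 1) (by omega), map_zero, smul_zero, sub_zero, zero_add] at e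
      exact C.eq_zero_of_heavy hs (by omega) e

/-- On each strand the coefficients of length `4T + 1` in the entries `1, …, m` are free, and each
determines the letter coefficient of the preceding entry through an invertible operator. If they
vanish, the entries consist of words beginning with their own letter, and the letter coefficient is
zero except in the last entry. Together this gives `2 * (4 * m + m * (4 * T) + (4 * T + 4))`. -/
theorem finrank_preCocycle (hs : ∀ n : ℕ, 1 ≤ n → C.s ^ (4 * n) ≠ 1) {n m : ℕ}
    (hn : (n : ZMod 4) = 1) (hm : n = 2 * m + 1) :
    Module.finrank K (C.preCocycle n) = (n + 1) * (4 * T + 4) := by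
  have : Module.Finite K (C.preCocycle n) :=
    Module.Finite.of_injective (Submodule.inclusion (fun f hf => hf.1 :
      C.preCocycle n ≤ C.cochain n)) (Submodule.inclusion_injective _)
  set U' : Submodule K (ℕ → ℕ → A) := split n (fun b c => if c = m then C.letterAnn b
      else C.letterAnn b ⊓ LinearMap.ker (C.cf b 1)) ⊥ with hU'
  let π : (ℕ → ℕ → A) →ₗ[K] (Bool → Fin m → ZMod 4 → K) :=
    LinearMap.pi fun b => LinearMap.pi fun c =>
      { toFun := fun f => C.cf (!b) (4 * T + 1) (strand n f b (c + 1))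
        map_add' := fun f g => by
          have : strand n (f + g) b (c + 1) = strand n f b (c + 1) + strand n g b (c + 1) := by
            cases b <;> rfl
          rw [this, map_add]
        map_smul' := fun a f => by
          have : strand n (a • f) b (c + 1) = a • strand n f b (c + 1) := by cases b <;> rfl
          rw [this, map_smul]
          rfl }
  have hπ : ∀ f b c, π f b c = C.cf (!b) (4 * T + 1) (strand n f b (c + 1)) := fun _ _ _ => rfl
  have h := finrank_eq_finrank_add_of_surjOn (C.preCocycle n) U' π
    (fun f hf => ((C.mem_split_iff hs hn hm).1 hf).1) (fun f hf => ?_) (fun w => ?_)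
  · have hfin : Module.finrank K U' = 2 * (m * (4 * T) + (4 * T + 4)) := by
      rw [hU', C.finrank_split _ _ (fun _ => rfl), finrank_bot, add_zero]
      have hsum : ∀ b : Bool, ∑ c : Fin ((n + 1) / 2), Module.finrank K
          (if (c : ℕ) = m then C.letterAnn b
            else C.letterAnn b ⊓ LinearMap.ker (C.cf b 1) : Submodule K A) =
          m * (4 * T) + (4 * T + 4) := by
        intro b
        have e : (n + 1) / 2 = m + 1 := by omega
        rw [e, Fin.sum_univ_castSucc]
        have h1 : ∀ c : Fin m, Module.finrank K (if ((Fin.castSucc c : Fin (m + 1)) : ℕ) = m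
            then C.letterAnn b
            else C.letterAnn b ⊓ LinearMap.ker (C.cf b 1) : Submodule K A) = 4 * T := fun c => by
          rw [if_neg (by simp only [Fin.val_castSucc]; omega)]
          exact C.finrank_letterAnn_inf b
        simp only [h1]
        rw [if_pos (by simp), C.finrank_letterAnn]
        simp
      simp only [hsum]
      simp [two_mul]
    rw [h, hfin]
    simp only [Module.finrank_pi_fintype, Module.finrank_self, Finset.sum_const, Finset.card_univ,
      Fintype.card_bool, Fintype.card_fin, ZMod.card, smul_eq_mul]
    rw [hm]
    ring
  · rw [hU', C.mem_split_iff hs hn hm]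
    refine ⟨fun h0 => ⟨hf, fun b c hc => ?_⟩, fun h0 => ?_⟩
    · rcases c with _ | c
      · exact C.cf_preCocycle_zero hs hf b
      · exact congrFun (congrFun h0 b) ⟨c, by omega⟩
    · funext b c
      rw [hπ, h0.2 b _ (by omega)]
      rfl
  · let p : Bool → ℕ → ZMod 4 → K := fun b c =>
      if h : 1 ≤ c ∧ c - 1 < m then w b ⟨c - 1, h.2⟩ else 0
    have hx : ∀ (b : Bool) (c : ℕ), ∃ x, c < m →
        C.topCoeff b (n + 1 - 2 * (c + 1)) (c + 1) (p b (c + 1)) x = 0 := by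
      intro b c
      by_cases hc : c < m
      · obtain ⟨x, hx⟩ := C.exists_topCoeff_eq_zero hs b (a := n + 1 - 2 * (c + 1)) (c := c + 1)
          (by omega) (p b (c + 1))
        exact ⟨x, fun _ => hx⟩
      · exact ⟨0, fun h => absurd h hc⟩
    choose x hx using hx
    let G : Bool → ℕ → A := fun b c => C.dg (p b c) * C.cow b + C.dg (x b c) * C.letter b
    have hGw : ∀ b c, G b c ∈ C.weight 1 := fun b c =>
      add_mem (C.dg_mul_word_mem_letterAnn _ _ T).1 (C.dg_mul_letter_mem_letterAnn _ _).1
    have hGp : ∀ b c, C.cf (!b) (4 * T + 1) (G b c) = p b c := fun b c => by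
      simp only [G]
      rw [map_add, CoverRel.cow, C.cf_dg_mul_word _ _ _ _ le_rfl, if_pos ⟨rfl, rfl⟩,
        C.cf_not_of_mem_letterAnn (C.dg_mul_letter_mem_letterAnn _ _) le_rfl, add_zero]
    have hGx : ∀ b c, C.cf b 1 (G b c) = x b c := fun b c => by
      simp only [G]
      rw [map_add, CoverRel.cow, C.cf_dg_mul_word _ _ _ _ le_rfl, if_neg (by simp), zero_add,
        cf_dg_mul_letter, if_pos rfl]
    have hlin : ∀ b a c', ∀ c, C.lin b a c' • G b c = C.dg (shift (p b c) -
        (C.lam b a c' * C.par b) • p b c) * C.word b (4 * T + 2) := by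
      intro b a c' c
      have h1 : C.letter b * (C.dg (x b c) * C.letter b) = 0 :=
        (C.dg_mul_letter_mem_letterAnn _ _).2
      have h2 : C.dg (x b c) * C.letter b * C.letter b = 0 := by
        rw [mul_assoc, C.letter_sq, mul_zero]
      rw [lin_smul]
      simp only [G]
      rw [mul_add, add_mul, h1, h2, add_zero, add_zero, mul_assoc, C.cow_mul_letter,
        ← mul_assoc, letter_mul_dg, mul_assoc, C.letter_mul_cow, C.word_not_top, map_sub, map_smul,
        sub_mul, mul_neg, mul_smul_comm, smul_mul_assoc]
      module
    have hst : ∀ b c, c ≤ m → strand n (assemble n G 0) b c = G b c := fun b c hc =>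
      strand_assemble G 0 b (by omega)
    refine ⟨assemble n G 0, ⟨?_, fun b c hc => ?_⟩, ?_⟩
    · rw [mem_cochain_iff, hn]
      refine ⟨fun i j hij => if_neg hij, fun b c hc => ?_, fun c hc => by omega⟩
      rw [hst b c (by omega)]
      exact hGw b c
    · rw [hst b c (by omega), hst b (c - 1) (by omega), hlin, C.hvy_smul_of_weight_one (hGw _ _),
        hGx]
      rcases c with _ | c
      · have hp0 : p b 0 = 0 := dif_neg (by omega)
        rw [if_pos rfl, hp0, map_zero, smul_zero, sub_zero, map_zero, zero_mul, add_zero]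
      · rw [if_neg (by omega), Nat.add_sub_cancel, ← add_mul, ← map_add]
        have := hx b c (by omega)
        rw [topCoeff] at this
        rw [this, map_zero, zero_mul]
    · funext b c
      rw [hπ, hst b _ (by omega), hGp]
      simp only [p]
      rw [dif_pos ⟨by omega, by omega⟩]
      rfl

end Cover

end

noncomputable section

/-! ### Cocycles in degrees congruent to `1` -/

namespace Cover

section Cyclic

variable {K : Type u} [Field K]

/-- The sum of the translates of a function by the first `2T + 1` even numbers. -/
def theta (T : ℕ) : (ZMod 4 → K) →ₗ[K] (ZMod 4 → K) :=
  ∑ k ∈ Finset.range (2 * T + 1), LinearMap.funLeft K K fun i => i + ((2 * k : ℕ) : ZMod 4)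

theorem theta_eq_sum (T : ℕ) (ε : ZMod 4 → K) : theta T ε =
    ∑ k ∈ Finset.range (2 * T + 1), fun i => ε (i + ((2 * k : ℕ) : ZMod 4)) := by
  rw [theta, LinearMap.sum_apply]
  rfl

/-- Of the `2T + 1` translates, the `T + 1` with even `k` are the identity and the `T` with odd `k`
are the translation by two. -/
theorem theta_apply (T : ℕ) (ε : ZMod 4 → K) (i : ZMod 4) :
    theta T ε i = (T + 1) * ε i + T * ε (i + 2) := by
  rw [theta_eq_sum, Finset.sum_apply]
  induction T with
  | zero => simp
  | succ T ih =>
    rw [show 2 * (T + 1) + 1 = 2 * T + 1 + 1 + 1 by ring, Finset.sum_range_succ,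
      Finset.sum_range_succ, ih]
    have h4 : (4 : ZMod 4) = 0 := rfl
    have e1 : ((2 * (2 * T + 1) : ℕ) : ZMod 4) = 2 := by
      push_cast
      linear_combination (T : ZMod 4) * h4
    have e2 : ((2 * (2 * T + 1 + 1) : ℕ) : ZMod 4) = 0 := by
      push_cast
      linear_combination ((T : ZMod 4) + 1) * h4
    rw [e1, e2, add_zero]
    push_cast
    ring

theorem add_two_add_two (i : ZMod 4) : i + 2 + 2 = i := by
  rw [add_assoc, show (2 + 2 : ZMod 4) = 0 from rfl, add_zero]

/-- The functions on the cyclic group with sum zero. -/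
def sumZero (K : Type u) [Field K] : Submodule K (ZMod 4 → K) :=
  LinearMap.ker (∑ i : ZMod 4, LinearMap.proj i : (ZMod 4 → K) →ₗ[K] K)

theorem mem_sumZero {v : ZMod 4 → K} : v ∈ sumZero K ↔ v 0 + v 1 + v 2 + v 3 = 0 := by
  rw [sumZero, LinearMap.mem_ker, LinearMap.sum_apply]
  exact (Fin.sum_univ_four (fun i : Fin 4 => v i)).congr_left

theorem finrank_sumZero : Module.finrank K (sumZero K) = 3 := by
  have h := LinearMap.finrank_range_add_finrank_ker
    (∑ i : ZMod 4, LinearMap.proj i : (ZMod 4 → K) →ₗ[K] K)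
  rw [LinearMap.range_eq_top.2, finrank_top, Module.finrank_self, Module.finrank_pi, ZMod.card]
    at h
  · exact Nat.add_left_cancel h
  · intro a
    exact ⟨Pi.single 0 a, by simp [LinearMap.sum_apply]⟩

/-- The sums of a function over the cosets of the subgroup of order two. -/
def cosetSums (K : Type u) [Field K] : (ZMod 4 → K) →ₗ[K] K × K :=
  let p (i : ZMod 4) : (ZMod 4 → K) →ₗ[K] K := LinearMap.proj i
  (p 0 + p 2).prod (p 1 + p 3)

theorem cosetSums_apply (v : ZMod 4 → K) : cosetSums K v = (v 0 + v 2, v 1 + v 3) := rfl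

/-- The functions on the cyclic group that change sign under translation by two. -/
def antiperiodic (K : Type u) [Field K] : Submodule K (ZMod 4 → K) := LinearMap.ker (cosetSums K)

theorem mem_antiperiodic {v : ZMod 4 → K} :
    v ∈ antiperiodic K ↔ v 0 + v 2 = 0 ∧ v 1 + v 3 = 0 := by
  rw [antiperiodic, LinearMap.mem_ker, cosetSums_apply, Prod.mk_eq_zero]

theorem add_two_of_antiperiodic {v : ZMod 4 → K} (h : v ∈ antiperiodic K) (i : ZMod 4) :
    v (i + 2) = -v i := by
  obtain ⟨h0, h1⟩ := mem_antiperiodic.1 h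
  have : ∀ i : ZMod 4, i = 0 ∨ i = 1 ∨ i = 2 ∨ i = 3 := by decide
  rcases this i with rfl | rfl | rfl | rfl
  · exact eq_neg_of_add_eq_zero_right h0
  · exact eq_neg_of_add_eq_zero_right h1
  · exact eq_neg_of_add_eq_zero_left h0
  · exact eq_neg_of_add_eq_zero_left h1

theorem finrank_antiperiodic : Module.finrank K (antiperiodic K) = 2 := by
  have h := LinearMap.finrank_range_add_finrank_ker (cosetSums K)
  rw [LinearMap.range_eq_top.2, finrank_top, Module.finrank_prod, Module.finrank_self,
    Module.finrank_pi, ZMod.card] at h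
  · exact Nat.add_left_cancel h
  · rintro ⟨a, b⟩
    refine ⟨Pi.single 0 a + Pi.single 1 b, ?_⟩
    have h1 : (2 : ZMod 4) ≠ 0 := by decide
    have h2 : (2 : ZMod 4) ≠ 1 := by decide
    have h3 : (3 : ZMod 4) ≠ 0 := by decide
    have h4 : (3 : ZMod 4) ≠ 1 := by decide
    have h5 : (1 : ZMod 4) ≠ 0 := by decide
    simp [cosetSums_apply, h1, h2, h3, h4, h5, h5.symm]

/-- Partial sums of `v` solve the equation; the vanishing of the total sum closes the cycle. -/
theorem exists_shift_sub_eq {v : ZMod 4 → K} (h : v ∈ sumZero K) :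
    ∃ ε : ZMod 4 → K, shift ε - ε = v := by
  rw [mem_sumZero] at h
  let ε : Fin 4 → K := ![0, v 0, v 0 + v 1, v 0 + v 1 + v 2]
  refine ⟨ε, ?_⟩
  funext i
  have : ∀ i : ZMod 4, i = 0 ∨ i = 1 ∨ i = 2 ∨ i = 3 := by decide
  rcases this i with rfl | rfl | rfl | rfl
  · change v 0 - 0 = v 0
    ring
  · change v 0 + v 1 - v 0 = v 1
    ring
  · change v 0 + v 1 + v 2 - (v 0 + v 1) = v 2
    ring
  · change 0 - (v 0 + v 1 + v 2) = v 3
    linear_combination -h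

theorem exists_shift_sub_smul_eq {c : K} (hc : c ^ 4 ≠ 1) (v : ZMod 4 → K) :
    ∃ ε : ZMod 4 → K, shift ε - c • ε = v := by
  let φ : (ZMod 4 → K) →ₗ[K] (ZMod 4 → K) := shift.toLinearMap - c • LinearMap.id
  have hφ : Function.Injective φ := (injective_iff_map_eq_zero _).2
    fun x hx => eq_zero_of_shift_eq_smul (sub_eq_zero.1 hx) hc
  exact LinearMap.surjective_of_injective hφ v

/-- On each coset of the subgroup of order two the operator has diagonal entries `T + 1` and
off-diagonal entries `T`, with determinant `2T + 1`; the witness is given by the inverse matrix. -/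
theorem exists_theta_eq {T : ℕ} (hT : (2 * T + 1 : K) ≠ 0) (v : ZMod 4 → K) :
    ∃ ε : ZMod 4 → K, theta T ε = v ∧ (v ∈ sumZero K → ε ∈ sumZero K) := by
  have hd := mul_inv_cancel₀ hT
  refine ⟨fun i => (2 * T + 1 : K)⁻¹ * ((T + 1) * v i - T * v (i + 2)), ?_, fun h => ?_⟩
  · funext i
    rw [theta_apply, add_two_add_two]
    linear_combination v i * hd
  · rw [mem_sumZero] at h ⊢
    have e : (0 : ZMod 4) + 2 = 2 ∧ (1 : ZMod 4) + 2 = 3 ∧ (2 : ZMod 4) + 2 = 0 ∧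
      (3 : ZMod 4) + 2 = 1 := by decide
    rw [e.1, e.2.1, e.2.2.1, e.2.2.2]
    linear_combination (2 * T + 1 : K)⁻¹ * h

theorem theta_mem_sumZero (T : ℕ) {ε : ZMod 4 → K} (h : ε ∈ sumZero K) :
    theta T ε ∈ sumZero K := by
  rw [mem_sumZero] at h ⊢
  have e : (0 : ZMod 4) + 2 = 2 ∧ (1 : ZMod 4) + 2 = 3 ∧ (2 : ZMod 4) + 2 = 0 ∧
    (3 : ZMod 4) + 2 = 1 := by decide
  simp only [theta_apply]
  rw [e.1, e.2.1, e.2.2.1, e.2.2.2]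
  linear_combination (2 * T + 1 : K) * h

/-- The operator multiplies the two coset sums by `2T + 1`. -/
theorem theta_mem_antiperiodic {T : ℕ} (hT : (2 * T + 1 : K) = 0) (ε : ZMod 4 → K) :
    theta T ε ∈ antiperiodic K := by
  rw [mem_antiperiodic]
  have e : (0 : ZMod 4) + 2 = 2 ∧ (1 : ZMod 4) + 2 = 3 ∧ (2 : ZMod 4) + 2 = 0 ∧
    (3 : ZMod 4) + 2 = 1 := by decide
  simp only [theta_apply]
  rw [e.1, e.2.1, e.2.2.1, e.2.2.2]
  constructor
  · linear_combination (ε 0 + ε 2) * hT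
  · linear_combination (ε 1 + ε 3) * hT

theorem theta_of_antiperiodic (T : ℕ) {v : ZMod 4 → K} (h : v ∈ antiperiodic K) :
    theta T v = v := by
  funext i
  rw [theta_apply, add_two_of_antiperiodic h]
  ring

theorem antiperiodic_le_sumZero : antiperiodic K ≤ sumZero K := fun v h => by
  obtain ⟨h0, h1⟩ := mem_antiperiodic.1 h
  rw [mem_sumZero]
  linear_combination h0 + h1

theorem shift_sub_mem_sumZero (ε : ZMod 4 → K) : shift ε - ε ∈ sumZero K := by
  rw [mem_sumZero]
  change (ε 1 - ε 0) + (ε 2 - ε 1) + (ε 3 - ε 2) + (ε 0 - ε 3) = 0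
  ring

end Cyclic

variable {K : Type u} [Field K] {A : Type u} [Ring A] [Algebra K A] {T : ℕ} (C : Cover K A T)

attribute [local instance] instModuleTensorProductMop isScalarTower_env

theorem word_mul_dg (b : Bool) (j : ℕ) (ε : ZMod 4 → K) :
    C.word b j * C.dg ε = C.dg (fun i => ε (i + j)) * C.word b j := by
  rw [dg_apply, dg_apply, Finset.mul_sum, Finset.sum_mul]
  refine (Fintype.sum_equiv (Equiv.addRight (j : ZMod 4)) _ _ fun i => ?_).symm
  rw [Equiv.coe_addRight, smul_mul_assoc, mul_smul_comm, C.e_word]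

theorem word_mul_mul_word_not (b : Bool) {i j : ℕ} (hij : i + j = 2 * T) {f : A}
    (hf : C.cf true 0 f = 0) : C.word b (2 * i) * f * C.word (!b) (2 * j + 1) =
      C.dg (fun l => C.cf b 1 f (l + (2 * i : ℕ))) * C.word b (4 * T + 2) := by
  rw [C.word_mul_mul_word (by omega) hf, mul_assoc, Finset.sum_mul, Finset.sum_eq_single b]
  · rw [mul_assoc (C.dg _), ← C.word_succ, ← mul_assoc, word_mul_dg, mul_assoc,
      show 4 * T + 2 = 2 * i + (2 * j + 1 + 1) by omega, C.word_add b (2 * i)]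
    simp
  · intro d _ hd
    rw [Bool.eq_not_of_ne hd, mul_assoc, C.letter_mul_word_self, mul_zero]
  · simp

theorem word_not_mul_mul_word (b : Bool) {i j : ℕ} (hij : i + j = 2 * T) {f : A}
    (hf : C.cf true 0 f = 0) : C.word (!b) (2 * i + 1) * f * C.word (!b) (2 * j) =
      C.dg (fun l => C.cf b 1 f (l + (2 * i + 1 : ℕ))) * C.word (!b) (4 * T + 2) := by
  rw [C.word_mul_mul_word (by omega) hf, Finset.mul_sum, Finset.sum_mul, Finset.sum_eq_single b]
  · rw [← mul_assoc, word_mul_dg, mul_assoc (C.dg _), mul_assoc (C.dg _),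
      show 4 * T + 2 = 2 * i + 1 + 1 + 2 * j by omega, C.word_add (!b) (2 * i + 1 + 1),
      C.word_succ' (!b) (2 * i + 1)]
    simp
  · intro d _ hd
    rw [Bool.eq_not_of_ne hd, ← mul_assoc, word_mul_dg, mul_assoc (C.dg _)]
    have := C.word_succ_mul_letter (!b) (2 * i)
    simp only [Nat.bodd_mul, Nat.bodd_two, Bool.false_and, Bool.xor_false] at this
    rw [this, mul_zero, zero_mul]
  · simp

/-- Each summand of the derivative completes a top word by a letter `b` of `f`, at position `2k` in
one half and `2k + 1` in the other, and so translates the coefficients by that amount. The other top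
word contributes the factor `-par b`, and summation over `k` gives `theta`. -/
theorem fox_smul_of_cf_zero (b : Bool) (c : ℕ) {f : A} (hf : C.cf true 0 f = 0) :
    C.fox b c • f = C.dg (C.kap b • theta T (C.par b ^ c • C.cf b 1 f -
      C.par b • shift (C.cf b 1 f))) * C.word b (4 * T + 2) := by
  have h : ∀ k ∈ Finset.HasAntidiagonal.antidiagonal (2 * T),
      (C.par b ^ c • (C.word b (2 * k.1) * f * C.word (!b) (2 * k.2 + 1)) +
        C.word (!b) (2 * k.1 + 1) * f * C.word (!b) (2 * k.2)) =
      C.dg (fun l => (C.par b ^ c • C.cf b 1 f - C.par b • shift (C.cf b 1 f))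
        (l + (2 * k.1 : ℕ))) * C.word b (4 * T + 2) := by
    intro k hk
    rw [Finset.HasAntidiagonal.mem_antidiagonal] at hk
    rw [C.word_mul_mul_word_not b hk hf, C.word_not_mul_mul_word b hk hf, C.word_not_top, mul_neg,
      mul_smul_comm, ← smul_mul_assoc, ← smul_mul_assoc, ← sub_eq_add_neg, ← sub_mul, ← map_smul,
      ← map_smul, ← map_sub]
    congr 2
    funext l
    simp only [Pi.sub_apply, Pi.smul_apply, shift_apply]
    push_cast
    rw [add_assoc]
  rw [fox_smul, Finset.sum_congr rfl h, Finset.Nat.sum_antidiagonal_eq_sum_range_succ_mk,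
    ← Finset.sum_mul, ← map_sum, map_smul, smul_mul_assoc, theta_eq_sum]

/-- The coefficient of the coboundary on the diagonal. -/
def diagCoeff (T m : ℕ) (s : K) (ε ε' : ZMod 4 → K) : ZMod 4 → K :=
  theta T (shift ε - s ^ m • ε - (shift ε' - s⁻¹ ^ m • ε'))

theorem fox_smul_add_fox_smul (m : ℕ) {f g : A} (hf : C.cf true 0 f = 0)
    (hg : C.cf true 0 g = 0) : C.fox true (m + 1) • f + C.fox false (m + 1) • g =
      C.dg (diagCoeff T m C.s (C.cf true 1 f) (C.cf false 1 g)) * C.word false (4 * T + 2) := by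
  have hs := C.s_ne
  rw [C.fox_smul_of_cf_zero _ _ hf, C.fox_smul_of_cf_zero _ _ hg, C.word_true_top, mul_neg,
    mul_smul_comm, ← smul_mul_assoc, ← neg_mul, ← add_mul, ← map_smul, ← map_neg, ← map_add]
  congr 2
  simp only [CoverRel.kap, CoverRel.par, if_true, Bool.false_eq_true, if_false, diagCoeff, map_sub,
    map_smul, smul_sub, smul_smul, pow_succ, one_mul]
  rw [inv_mul_cancel₀ hs, mul_inv_cancel₀ hs, mul_comm _ C.s, inv_mul_cancel_left₀ hs,
    mul_comm _ C.s⁻¹, mul_inv_cancel_left₀ hs]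
  module

/-- The diagonal condition is a linear map on the families that satisfy all others. Its image is
already reached by families supported next to the diagonal with values in multiples of the letters,
which satisfy the other conditions automatically. -/
theorem finrank_cocycle_one_add (hs : ∀ n : ℕ, 1 ≤ n → C.s ^ (4 * n) ≠ 1) {n m : ℕ}
    (hn : (n : ZMod 4) = 1) (hm : n = 2 * m + 1) (R : Submodule K (ZMod 4 → K))
    (hmem : ∀ ε ε', diagCoeff T m C.s ε ε' ∈ R)
    (hsurj : ∀ w ∈ R, ∃ ε ε', diagCoeff T m C.s ε ε' = w) :
    Module.finrank K R + Module.finrank K (C.cocycle n) = (n + 1) * (4 * T + 4) := by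
  have : Module.Finite K (C.preCocycle n) :=
    Module.Finite.of_injective (Submodule.inclusion (fun f hf => hf.1 :
      C.preCocycle n ≤ C.cochain n)) (Submodule.inclusion_injective _)
  let π : (ℕ → ℕ → A) →ₗ[K] (ZMod 4 → K) :=
    { toFun := fun f => diagCoeff T m C.s (C.cf true 1 (f (m + 1) m)) (C.cf false 1 (f m (m + 1)))
      map_add' := fun f g => by
        refine Eq.trans (congrArg (theta T) ?_) (map_add (theta T) _ _)
        simp only [Pi.add_apply, map_add]
        module
      map_smul' := fun a f => by
        refine Eq.trans (congrArg (theta T) ?_) (map_smul (theta T) _ _)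
        simp only [Pi.smul_apply, map_smul, RingHom.id_apply]
        module }
  rw [← C.finrank_preCocycle hs hn hm]
  refine (finrank_eq_finrank_add_of_mapsTo _ _ π R ?_ ?_ (fun f _ => hmem _ _) ?_).symm
  · intro f hf
    rw [mem_cocycle_iff] at hf
    exact ⟨hf.1, hf.2.1⟩
  · intro f hf
    have hw : ∀ i j, C.cf true 0 (f i j) = 0 := fun i j =>
      C.cf_zero_of_weight (r := 1) (by decide) (by rw [← hn]; exact hf.1.2 i j)
    have key := C.fox_smul_add_fox_smul m (hw (m + 1) m) (hw m (m + 1))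
    rw [mem_cocycle_iff]
    constructor
    · intro h0
      refine ⟨hf.1, hf.2, fun c hc => ?_⟩
      obtain rfl : c = m := by omega
      have h0' : diagCoeff T c C.s (C.cf true 1 (f (c + 1) c)) (C.cf false 1 (f c (c + 1))) = 0 :=
        h0
      rw [key, h0', map_zero, zero_mul]
    · rintro ⟨-, -, h⟩
      rw [h m hm.symm] at key
      have := congrArg C.ct key
      rw [C.exists_ct_eq, map_zero] at this
      exact this.symm
  · intro w hw
    obtain ⟨ε, ε', rfl⟩ := hsurj w hw
    let G : Bool → ℕ → A := fun b c =>
      if c = m then C.dg (if b then ε else ε') * C.letter b else 0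
    have hst : ∀ b c, c ≤ m → strand n (assemble n G 0) b c = G b c := fun b c hc =>
      strand_assemble G 0 b (by omega)
    refine ⟨assemble n G 0, ((C.mem_split_iff hs hn hm).1 ?_).1, ?_⟩
    · refine ⟨fun i j hij => if_neg hij, fun b c hc => ?_, fun c hc => by omega⟩
      rw [hst b c (by omega)]
      simp only [G]
      by_cases h : c = m
      · rw [if_pos h, if_pos h]
        exact C.dg_mul_letter_mem_letterAnn _ _
      · rw [if_neg h, if_neg h]
        exact zero_mem _
    · have h1 := hst true m le_rfl
      have h2 := hst false m le_rfl
      simp only [strand, G, if_true, Bool.false_eq_true, if_false,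
        show n - m = m + 1 by omega] at h1 h2
      change diagCoeff T m C.s (C.cf true 1 (assemble n G 0 (m + 1) m))
        (C.cf false 1 (assemble n G 0 m (m + 1))) = _
      rw [h1, h2, cf_dg_mul_letter, cf_dg_mul_letter, if_pos rfl, if_pos rfl]

theorem s_pow_pow_four_ne (hs : ∀ n : ℕ, 1 ≤ n → C.s ^ (4 * n) ≠ 1) {m : ℕ} (h : 1 ≤ m) :
    (C.s ^ m) ^ 4 ≠ 1 := by
  have := C.par_pow_ne_one hs true h
  simpa [CoverRel.par] using this

/-- For `m ≥ 1` the operator `shift - s^m` is bijective, so one strand alone produces the whole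
range of `theta`. -/
theorem exists_diagCoeff_eq (hs : ∀ n : ℕ, 1 ≤ n → C.s ^ (4 * n) ≠ 1) {m : ℕ} (h : 1 ≤ m)
    (v : ZMod 4 → K) : ∃ ε ε', diagCoeff T m C.s ε ε' = theta T v := by
  obtain ⟨ε, hε⟩ := exists_shift_sub_smul_eq (C.s_pow_pow_four_ne hs h) v
  exact ⟨ε, 0, by rw [diagCoeff, hε, map_zero, smul_zero, sub_zero, sub_zero]⟩

/-- For `m = 0` the operators of the two strands coincide, so only the difference of the
coefficients matters, and the sum of the values is lost. -/
theorem diagCoeff_zero (s : K) (ε ε' : ZMod 4 → K) :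
    diagCoeff T 0 s ε ε' = theta T (shift (ε - ε') - (ε - ε')) := by
  rw [diagCoeff, pow_zero, pow_zero, one_smul, one_smul, map_sub shift]
  congr 1
  abel

theorem exists_diagCoeff_zero_eq (s : K) {v : ZMod 4 → K} (h : v ∈ sumZero K) :
    ∃ ε ε', diagCoeff T 0 s ε ε' = theta T v := by
  obtain ⟨ε, hε⟩ := exists_shift_sub_eq h
  exact ⟨ε, 0, by rw [diagCoeff_zero, sub_zero, hε]⟩

/-- With `2T + 1` invertible, `theta` maps the functions of sum zero onto themselves; this accounts
for the rank `3`. -/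
theorem finrank_cocycle_one_of_ne (hs : ∀ n : ℕ, 1 ≤ n → C.s ^ (4 * n) ≠ 1)
    (hT : (2 * T + 1 : K) ≠ 0) : 3 + Module.finrank K (C.cocycle 1) = 2 * (4 * T + 4) := by
  refine (congrArg (· + _) (finrank_sumZero (K := K)).symm).trans <|
    C.finrank_cocycle_one_add hs (n := 1) (m := 0) Nat.cast_one rfl _ (fun ε ε' => ?_)
    fun w hw => ?_
  · rw [diagCoeff_zero]
    exact theta_mem_sumZero T (shift_sub_mem_sumZero _)
  · obtain ⟨v, rfl, hv⟩ := exists_theta_eq hT w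
    exact exists_diagCoeff_zero_eq _ (hv hw)

/-- With `2T + 1 = 0`, `theta` has antiperiodic values. It fixes the antiperiodic functions, and
these have sum zero, so the full rank `2` is attained even for `m = 0`. -/
theorem finrank_cocycle_one_of_eq (hs : ∀ n : ℕ, 1 ≤ n → C.s ^ (4 * n) ≠ 1)
    (hT : (2 * T + 1 : K) = 0) : 2 + Module.finrank K (C.cocycle 1) = 2 * (4 * T + 4) := by
  refine (congrArg (· + _) (finrank_antiperiodic (K := K)).symm).trans <|
    C.finrank_cocycle_one_add hs (n := 1) (m := 0) Nat.cast_one rfl _ (fun ε ε' => ?_)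
    fun w hw => ?_
  · exact theta_mem_antiperiodic hT _
  · rw [← theta_of_antiperiodic T hw]
    exact exists_diagCoeff_zero_eq _ (antiperiodic_le_sumZero hw)

theorem finrank_cocycle_five_of_ne (hs : ∀ n : ℕ, 1 ≤ n → C.s ^ (4 * n) ≠ 1)
    (hT : (2 * T + 1 : K) ≠ 0) {n m : ℕ} (hn : (n : ZMod 4) = 1) (hm : n = 2 * m + 1)
    (h : 1 ≤ m) : 4 + Module.finrank K (C.cocycle n) = (n + 1) * (4 * T + 4) := by
  have h4 : Module.finrank K (⊤ : Submodule K (ZMod 4 → K)) = 4 := by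
    rw [finrank_top, Module.finrank_pi, ZMod.card]
  refine (congrArg (· + _) h4.symm).trans <|
    C.finrank_cocycle_one_add hs hn hm _ (fun ε ε' => Submodule.mem_top)
      fun w hw => ?_
  obtain ⟨v, rfl, -⟩ := exists_theta_eq hT w
  exact C.exists_diagCoeff_eq hs h v

theorem finrank_cocycle_five_of_eq (hs : ∀ n : ℕ, 1 ≤ n → C.s ^ (4 * n) ≠ 1)
    (hT : (2 * T + 1 : K) = 0) {n m : ℕ} (hn : (n : ZMod 4) = 1) (hm : n = 2 * m + 1)
    (h : 1 ≤ m) : 2 + Module.finrank K (C.cocycle n) = (n + 1) * (4 * T + 4) := by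
  refine (congrArg (· + _) (finrank_antiperiodic (K := K)).symm).trans <|
    C.finrank_cocycle_one_add hs hn hm _ (fun ε ε' => theta_mem_antiperiodic hT _)
    fun w hw => ?_
  rw [← theta_of_antiperiodic T hw]
  exact C.exists_diagCoeff_eq hs h w

end Cover

end

noncomputable section

/-! ### Dimensions of the Hochschild cohomology groups -/

namespace Cover

variable {K : Type u} [Field K] {A : Type u} [Ring A] [Algebra K A] {T : ℕ} (C : Cover K A T)

theorem cast_four_mul_add (m r : ℕ) : ((4 * m + r : ℕ) : ZMod 4) = r := by
  push_cast
  rw [show (4 : ZMod 4) = 0 from rfl, zero_mul, zero_add]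

theorem finrank_cochain_four_mul (m : ℕ) :
    Module.finrank K (C.cochain (4 * m)) = (4 * m + 1) * (8 * T + 4) := by
  have h : ((4 * m : ℕ) : ZMod 4) = 0 := cast_four_mul_add m 0
  rw [finrank_cochain, h, finrank_weight_zero]

theorem finrank_cochain_four_mul_add_one (m : ℕ) :
    Module.finrank K (C.cochain (4 * m + 1)) = (4 * m + 2) * (8 * T + 8) := by
  have h : ((4 * m + 1 : ℕ) : ZMod 4) = 1 := cast_four_mul_add m 1
  rw [finrank_cochain, h, finrank_weight_one]

theorem finrank_cochain_four_mul_add_two (m : ℕ) :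
    Module.finrank K (C.cochain (4 * m + 2)) = (4 * m + 3) * (8 * T + 4) := by
  have h : ((4 * m + 2 : ℕ) : ZMod 4) = 2 := cast_four_mul_add m 2
  rw [finrank_cochain, h, finrank_weight_two]

theorem finrank_cochain_four_mul_add_three (m : ℕ) :
    Module.finrank K (C.cochain (4 * m + 3)) = (4 * m + 4) * (8 * T) := by
  have h : ((4 * m + 3 : ℕ) : ZMod 4) = 3 := cast_four_mul_add m 3
  rw [finrank_cochain, h, finrank_weight_three]

theorem finrank_cocycle_four_mul_add_two (m : ℕ) :
    Module.finrank K (C.cocycle (4 * m + 2)) = (4 * m + 2) * (4 * T + 4) + (2 * T + 4) :=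
  C.finrank_cocycle_two (cast_four_mul_add m 2) (by omega)

theorem finrank_cocycle_four_mul_add_three (m : ℕ) :
    Module.finrank K (C.cocycle (4 * m + 3)) = (4 * m + 4) * (4 * T) :=
  C.finrank_cocycle_three (cast_four_mul_add m 3) (by omega)

theorem finrank_cocycle_four_mul (hs : ∀ n : ℕ, 1 ≤ n → C.s ^ (4 * n) ≠ 1) {m : ℕ} (hm : 1 ≤ m) :
    Module.finrank K (C.cocycle (4 * m)) = 4 * m * (4 * T) + 2 * T :=
  C.finrank_cocycle_four hs (cast_four_mul_add m 0) (by omega) (by omega)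

theorem rank_four_mul_add_three (C : Cover K A T) (m : ℕ) :
    Module.rank K (HochschildCohomology K A (4 * m + 3)) = (2 * T : ℕ) := by
  obtain ⟨h, e, e'⟩ := C.rank_hochschildCohomology_succ (4 * m + 2)
  rw [finrank_cochain_four_mul_add_two, finrank_cocycle_four_mul_add_two,
    finrank_cocycle_four_mul_add_three] at e'
  obtain rfl : h = 2 * T := by linarith
  exact e

theorem rank_four_mul (hs : ∀ n : ℕ, 1 ≤ n → C.s ^ (4 * n) ≠ 1) {m : ℕ} (hm : 1 ≤ m) :
    Module.rank K (HochschildCohomology K A (4 * m)) = (2 * T : ℕ) := by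
  obtain ⟨m, rfl⟩ : ∃ k, m = k + 1 := ⟨m - 1, by omega⟩
  obtain ⟨h, e, e'⟩ := C.rank_hochschildCohomology_succ (4 * m + 3)
  rw [finrank_cochain_four_mul_add_three, finrank_cocycle_four_mul_add_three,
    show 4 * m + 3 + 1 = 4 * (m + 1) by ring, C.finrank_cocycle_four_mul hs hm] at e'
  obtain rfl : h = 2 * T := by linarith
  exact e

theorem rank_zero (C : Cover K A T) :
    Module.rank K (HochschildCohomology K A 0) = (2 * T + 1 : ℕ) := by
  rw [C.rank_hochschildCohomology_zero, finrank_cocycle_zero]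

/-- `d` is the rank of the diagonal condition. It reduces the cohomology in this degree by removing
cocycles, and in the following degree by adding coboundaries. -/
theorem rank_one_add {d : ℕ} (hd : d + Module.finrank K (C.cocycle 1) = 2 * (4 * T + 4)) :
    ∃ h : ℕ, Module.rank K (HochschildCohomology K A 1) = h ∧ h + d = 2 * T + 5 := by
  obtain ⟨h, e, e'⟩ := C.rank_hochschildCohomology_succ 0
  have hc := C.finrank_cochain_four_mul 0
  rw [mul_zero] at hc
  rw [hc, finrank_cocycle_zero, zero_add] at e'
  exact ⟨h, e, by linarith⟩

theorem rank_two_add {m d : ℕ}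
    (hd : d + Module.finrank K (C.cocycle (4 * m + 1)) = (4 * m + 2) * (4 * T + 4)) :
    ∃ h : ℕ, Module.rank K (HochschildCohomology K A (4 * m + 2)) = h ∧ h + d = 2 * T + 4 := by
  obtain ⟨h, e, e'⟩ := C.rank_hochschildCohomology_succ (4 * m + 1)
  rw [finrank_cochain_four_mul_add_one, finrank_cocycle_four_mul_add_two] at e'
  exact ⟨h, e, by linarith⟩

theorem rank_five_add (hs : ∀ n : ℕ, 1 ≤ n → C.s ^ (4 * n) ≠ 1) {m d : ℕ} (hm : 1 ≤ m)
    (hd : d + Module.finrank K (C.cocycle (4 * m + 1)) = (4 * m + 2) * (4 * T + 4)) :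
    ∃ h : ℕ, Module.rank K (HochschildCohomology K A (4 * m + 1)) = h ∧ h + d = 2 * T + 4 := by
  obtain ⟨h, e, e'⟩ := C.rank_hochschildCohomology_succ (4 * m)
  rw [finrank_cochain_four_mul, C.finrank_cocycle_four_mul hs hm] at e'
  exact ⟨h, e, by linarith⟩

theorem cocycle_one_of_eq (hs : ∀ n : ℕ, 1 ≤ n → C.s ^ (4 * n) ≠ 1) (hT : (2 * T + 1 : K) = 0)
    {m : ℕ} (hm : 1 ≤ m) :
    2 + Module.finrank K (C.cocycle (4 * m + 1)) = (4 * m + 2) * (4 * T + 4) :=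
  C.finrank_cocycle_five_of_eq hs hT (m := 2 * m) (by simpa using cast_four_mul_add m 1) (by ring)
    (by omega)

theorem cocycle_one_of_ne (hs : ∀ n : ℕ, 1 ≤ n → C.s ^ (4 * n) ≠ 1) (hT : (2 * T + 1 : K) ≠ 0)
    {m : ℕ} (hm : 1 ≤ m) :
    4 + Module.finrank K (C.cocycle (4 * m + 1)) = (4 * m + 2) * (4 * T + 4) :=
  C.finrank_cocycle_five_of_ne hs hT (m := 2 * m) (by simpa using cast_four_mul_add m 1) (by ring)
    (by omega)

end Cover

/-! ### Global dimension -/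

/-- If the left annihilator of `x` is `A x` and the map `A → A x` does not split, then `A x` has
infinite projective dimension. -/
theorem globalDimension_eq_top {A : Type u} [Ring A] {x : A} (hx : x * x = 0)
    (hker : ∀ f : A, f * x = 0 → ∃ g, g * x = f) (hsplit : ∀ w : A, w * x = x → x * w ≠ 0) :
    globalDimension A = ⊤ := by
  let φ : A →ₗ[A] A := LinearMap.toSpanSingleton A A x
  have hφ : ∀ a, φ a = a * x := fun a => rfl
  have hex : Function.Exact φ φ.rangeRestrict := by
    intro f
    rw [Subtype.ext_iff]
    change f * x = 0 ↔ _
    constructor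
    · intro h
      exact hker f h
    · rintro ⟨g, rfl⟩
      rw [hφ, mul_assoc, hx, mul_zero]
  have hS := ExtDim.rangeComplex_shortExact φ φ.rangeRestrict hex φ.surjective_rangeRestrict
  have hproj : Projective (ExtDim.rangeComplex φ φ.rangeRestrict hex).X₂ :=
    inferInstanceAs (Projective (ModuleCat.of A A))
  have hno : ∀ n : ℕ, ¬ HasProjectiveDimensionLT (ModuleCat.of A (LinearMap.range φ)) (n + 1) := by
    intro n
    induction n with
    | zero =>
      intro h
      rw [← projective_iff_hasProjectiveDimensionLT_one, ← IsProjective.iff_projective] at h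
      -- A section of `A → A x` sends `x` to some `w` with `w * x = x`, and `x * w = 0` by linearity
      -- because `x² = 0`.
      obtain ⟨σ, hσ⟩ := Module.projective_lifting_property φ.rangeRestrict LinearMap.id
        φ.surjective_rangeRestrict
      let y : LinearMap.range φ := ⟨x, 1, by rw [hφ, one_mul]⟩
      have h1 : σ y * x = x := congrArg Subtype.val (LinearMap.congr_fun hσ y)
      have h2 : x • y = 0 := Subtype.ext hx
      have h3 := congrArg σ h2
      rw [map_smul, map_zero] at h3
      exact hsplit _ h1 h3
    | succ n ih =>
      intro h
      -- The kernel of `A → A x` is `A x` again, so a finite bound on its projective dimension could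
      -- be lowered by one.
      exact ih ((hS.hasProjectiveDimensionLT_X₃_iff n hproj).1 h)
  rw [globalDimension, eq_top_iff]
  refine le_trans ?_ (le_iSup _ (ModuleCat.of A (LinearMap.range φ)))
  rw [top_le_iff]
  by_contra h
  obtain ⟨n, hn⟩ := (projectiveDimension_ne_top_iff _).1 h
  exact hno n hn

namespace Cover

variable {K : Type u} [Field K] {A : Type u} [Ring A] [Algebra K A]

/-- For `T = 0` the words are `1`, `y`, `x` and `yx`. The last two are grouped as a left multiple of
`x`, which exhibits the left annihilator of `x` as `A x`. -/
theorem eq_dg_add (C : Cover K A 0) (f : A) : f = C.dg (C.cf true 0 f) +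
    C.dg (C.cf false 1 f) * C.letter false +
      (C.dg (C.cf true 1 f) + C.dg (C.ct f) * C.letter false) * C.letter true := by
  have h1 : ∀ (b b' : Bool) (j : ℕ) (ε : ZMod 4 → K), C.cf b j (C.dg ε * C.letter b') =
      if b = b' ∧ j = 1 then ε else 0 := fun b b' j ε => by
    rw [← C.word_one]
    exact C.cf_dg_mul_word b j ε b' (j' := 0) le_rfl
  have h2 : ∀ (b' : Bool) (ε : ZMod 4 → K), C.ct (C.dg ε * C.letter b') = 0 := fun b' ε => by
    rw [← C.word_one]
    exact C.ct_dg_mul_word ε b' (j' := 0) le_rfl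
  have hw : C.letter false * C.letter true = C.word false (4 * 0 + 2) := by
    simp [C.word_succ]
  have h3 : ∀ (b : Bool) (j : ℕ) (ε : ZMod 4 → K),
      C.cf b j (C.dg ε * C.word false (4 * 0 + 2)) = 0 := fun b j ε => C.cf_dg_mul_top b j ε false
  have h4 : ∀ ε : ZMod 4 → K, C.ct (C.dg ε * C.word false (4 * 0 + 2)) = ε := fun ε =>
    C.exists_ct_eq ε
  rw [add_mul, mul_assoc, hw]
  refine C.ext_coef ?_ (fun b j hj => ?_) ?_
  · simp only [map_add, cf_dg, h1, h3]
    simp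
  · obtain rfl : j = 0 := by omega
    simp only [map_add, cf_dg, h1, h3]
    cases b <;> simp
  · simp only [map_add, ct_dg, h2, h4]
    simp

theorem globalDimension_eq_top (C : Cover K A 0) : globalDimension A = ⊤ := by
  refine _root_.globalDimension_eq_top (x := C.letter true) (C.letter_sq true) (fun f hf => ?_)
    (fun w hw h => ?_)
  · have h0 : C.cf true 0 f = 0 := by
      have := congrArg (C.cf true (0 + 1)) hf
      rwa [C.cf_mul_letter _ _ (Nat.zero_le _), Nat.bodd_zero, Bool.xor_false, if_pos rfl,
        map_zero] at this
    have h1 : C.cf false 1 f = 0 := by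
      have := congrArg C.ct hf
      rwa [ct_mul_letter, map_zero, smul_eq_zero_iff_right (C.topSign_ne _)] at this
    have := C.eq_dg_add f
    rw [h0, h1, map_zero, zero_mul, add_zero, zero_add] at this
    exact ⟨_, this.symm⟩
  -- The equation `x * w = 0` kills the vertex coefficients of `w`, whereas `w * x = x` makes them
  -- all equal to `1`.
  · have h0 : C.cf true 0 w = 0 := by
      have := congrArg (C.cf true (0 + 1)) h
      rw [C.cf_letter_mul _ _ (Nat.zero_le _), if_pos rfl, map_zero] at this
      exact (LinearEquiv.map_eq_zero_iff _).1 this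
    have h1 := congrArg (C.cf true (0 + 1)) hw
    rw [C.cf_mul_letter _ _ (Nat.zero_le _), Nat.bodd_zero, Bool.xor_false, if_pos rfl, h0] at h1
    have h2 := C.cf_dg_mul_letter 1 true true
    have h3 : C.dg (1 : ZMod 4 → K) = 1 := by
      rw [dg_apply, ← C.e_sum]
      simp
    rw [h3, one_mul, if_pos rfl] at h2
    exact zero_ne_one (congrFun (h1.trans h2) 0)

end Cover

theorem theorem3p4 (K : Type u) [Field K] [IsAlgClosed K] (T : ℕ) (q : GammaVertex → Kˣ)
    (hq : ∀ n : ℕ, 1 ≤ n → (q 0 * q 1 * q 2 * q 3) ^ n ≠ 1) :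
    -- (a) the dimensions of the Hochschild cohomology groups
    ((Module.rank K (HochschildCohomology K (AlgA T q) 0) = (2 * T + 1 : ℕ)) ∧
      (ringChar K ∣ 2 * T + 1 →
        Module.rank K (HochschildCohomology K (AlgA T q) 1) = (2 * T + 3 : ℕ)) ∧
      (¬ ringChar K ∣ 2 * T + 1 →
        Module.rank K (HochschildCohomology K (AlgA T q) 1) = (2 * T + 2 : ℕ)) ∧
      (ringChar K ∣ 2 * T + 1 →
        Module.rank K (HochschildCohomology K (AlgA T q) 2) = (2 * T + 2 : ℕ)) ∧
      (¬ ringChar K ∣ 2 * T + 1 →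
        Module.rank K (HochschildCohomology K (AlgA T q) 2) = (2 * T + 1 : ℕ)) ∧
      (∀ m : ℕ,
        Module.rank K (HochschildCohomology K (AlgA T q) (4 * m + 3)) = (2 * T : ℕ)) ∧
      (∀ m : ℕ, 1 ≤ m →
        Module.rank K (HochschildCohomology K (AlgA T q) (4 * m)) = (2 * T : ℕ)) ∧
      (∀ m : ℕ, 1 ≤ m → ringChar K ∣ 2 * T + 1 →
        Module.rank K (HochschildCohomology K (AlgA T q) (4 * m + 1)) = (2 * T + 2 : ℕ) ∧
        Module.rank K (HochschildCohomology K (AlgA T q) (4 * m + 2)) = (2 * T + 2 : ℕ)) ∧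
      (∀ m : ℕ, 1 ≤ m → ¬ ringChar K ∣ 2 * T + 1 →
        Module.rank K (HochschildCohomology K (AlgA T q) (4 * m + 1)) = (2 * T : ℕ) ∧
        Module.rank K (HochschildCohomology K (AlgA T q) (4 * m + 2)) = (2 * T : ℕ))) ∧
    -- (b) vanishing in degrees at least three
    ((∀ n : ℕ, 3 ≤ n → Subsingleton (HochschildCohomology K (AlgA T q) n)) ↔ T = 0) ∧
    -- for `T = 0` the algebra is finite-dimensional of infinite global dimension
    (T = 0 → Module.Finite K (AlgA T q) ∧ globalDimension (AlgA T q) = ⊤) := by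
  obtain ⟨C, hC⟩ := GammaCover.exists_cover T q
  have hs : ∀ n : ℕ, 1 ≤ n → C.s ^ (4 * n) ≠ 1 := fun n hn h => hq n hn <| Units.ext <| by
    rw [pow_mul, hC] at h
    simpa using h
  have hchar : ringChar K ∣ 2 * T + 1 ↔ (2 * T + 1 : K) = 0 := by
    rw [← ringChar.spec]
    push_cast
    rfl
  have heq : ∀ m : ℕ, 1 ≤ m → ringChar K ∣ 2 * T + 1 →
      Module.rank K (HochschildCohomology K (AlgA T q) (4 * m + 1)) = (2 * T + 2 : ℕ) ∧
      Module.rank K (HochschildCohomology K (AlgA T q) (4 * m + 2)) = (2 * T + 2 : ℕ) := by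
    intro m hm hT
    have hd := C.cocycle_one_of_eq hs (hchar.1 hT) hm
    obtain ⟨h, e, e'⟩ := C.rank_five_add hs hm hd
    obtain ⟨k, d, d'⟩ := C.rank_two_add hd
    obtain rfl : h = 2 * T + 2 := by omega
    obtain rfl : k = 2 * T + 2 := by omega
    exact ⟨e, d⟩
  have hne : ∀ m : ℕ, 1 ≤ m → ¬ ringChar K ∣ 2 * T + 1 →
      Module.rank K (HochschildCohomology K (AlgA T q) (4 * m + 1)) = (2 * T : ℕ) ∧
      Module.rank K (HochschildCohomology K (AlgA T q) (4 * m + 2)) = (2 * T : ℕ) := by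
    intro m hm hT
    have hd := C.cocycle_one_of_ne hs (fun h => hT (hchar.2 h)) hm
    obtain ⟨h, e, e'⟩ := C.rank_five_add hs hm hd
    obtain ⟨k, d, d'⟩ := C.rank_two_add hd
    obtain rfl : h = 2 * T := by omega
    obtain rfl : k = 2 * T := by omega
    exact ⟨e, d⟩
  refine ⟨⟨C.rank_zero, fun hT => ?_, fun hT => ?_, fun hT => ?_, fun hT => ?_,
    C.rank_four_mul_add_three, fun m hm => C.rank_four_mul hs hm, heq, hne⟩,
    ⟨fun h => ?_, ?_⟩, ?_⟩
  · obtain ⟨h, e, e'⟩ := C.rank_one_add (C.finrank_cocycle_one_of_eq hs (hchar.1 hT))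
    obtain rfl : h = 2 * T + 3 := by omega
    exact e
  · obtain ⟨h, e, e'⟩ := C.rank_one_add (C.finrank_cocycle_one_of_ne hs fun h => hT (hchar.2 h))
    obtain rfl : h = 2 * T + 2 := by omega
    exact e
  · obtain ⟨h, e, e'⟩ := C.rank_two_add (m := 0) (C.finrank_cocycle_one_of_eq hs (hchar.1 hT))
    obtain rfl : h = 2 * T + 2 := by omega
    exact e
  · obtain ⟨h, e, e'⟩ := C.rank_two_add (m := 0)
      (C.finrank_cocycle_one_of_ne hs fun h => hT (hchar.2 h))
    obtain rfl : h = 2 * T + 1 := by omega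
    exact e
  -- Degree `3` alone decides, since its dimension is `2T` in every characteristic.
  · have h3 := h 3 le_rfl
    have e := C.rank_four_mul_add_three 0
    rw [mul_zero, zero_add, rank_subsingleton'] at e
    have : (0 : ℕ) = 2 * T := by exact_mod_cast e
    omega
  · rintro rfl n hn
    have hT : ¬ ringChar K ∣ 2 * 0 + 1 := fun h => by
      have := hchar.1 h
      simp at this
    rw [← rank_zero_iff (R := K)]
    obtain ⟨m, r, hr, rfl⟩ : ∃ m r, r < 4 ∧ n = 4 * m + r := ⟨n / 4, n % 4, by omega, by omega⟩
    have : r = 0 ∨ r = 1 ∨ r = 2 ∨ r = 3 := by omega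
    rcases this with rfl | rfl | rfl | rfl
    · exact (C.rank_four_mul hs (by omega)).trans Nat.cast_zero
    · exact (hne m (by omega) hT).1.trans Nat.cast_zero
    · exact (hne m (by omega) hT).2.trans Nat.cast_zero
    · exact (C.rank_four_mul_add_three m).trans Nat.cast_zero
  · rintro rfl
    exact ⟨C.finite, C.globalDimension_eq_top⟩

end
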